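/- **Setting.** Let $\Omega$ be a rectangle $\prod_{n=1}^d(0,L_n)$, $d\in\{1,2,3\}$, with Dirichlet, Neumann or periodic boundary conditions (in the periodic case $\Omega$ is the fundamental cell of the torus), or an open nondegenerate planar triangle ($d=2$) with Dirichlet or Neumann boundary conditions. Let $H=L^2(\Omega)$; let $V=W^{1,2}_0(\Omega)$ (Dirichlet) or $V=W^{1,2}(\Omega)$ (Neumann; periodic: $W^{1,2}$ of the torus), with $(v,w)_V=(\nabla v,\nabla w)_{L^2}+(v,w)_{L^2}$; let $A\colon V\to V'$, $\langle Av,w\rangle=(v,w)_V$, $\mathrm D(A)=\{v\in V: Av\in H\}$ with norm $\|Av\|_H$, and $A_0=A-1=-\Delta$. Put $\langle A^2v,w\rangle=(Av,Aw)_H$ for $v,w\in \mathrm D(A)$, so that $A^2\colon \mathrm D(A)\to \mathrm D(A)'$. **Actuators.** Let $\omega=\prod_n(-l_n,l_n)$, $l_n>0$, be a box with $d+2$ pairwise disjoint translates in $\Omega$, centered at points $c_{1,0},\dots,c_{1,d}$ that lie in no common hyperplane, and at $c_2$. For $M\ge1$ divide $\Omega$ into cells similar to $\Omega$: $M^d$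 translates of $M^{-1}\Omega$ if $\Omega$ is a rectangle; if $\Omega$ is a triangle, the $4^{M-1}$ triangles obtained by $M-1$ successive subdivisions by the midpoints of the edges. For a cell $k$ let $S_k$ be the affine bijection (translation, homothety and rotation by $0$ or $\pi$) of the cell onto $\Omega$. With $\varphi(z)=1_\omega(z)\prod_n\sin\big(\pi\tfrac{z_n+l_n}{2l_n}\big)$, the actuators are $\Phi_{k,j}=1_\omega(S_kx-c_{1,j})$, $0\le j\le d$, and $\Psi_k=1_\omega(S_kx-c_2)$, with spans $\mathcal U_M$ and $\mathcal V_M$; the auxiliary functions are $\widetilde\Phi_{k,j}=\varphi^2(S_kx-c_{1,j})$ and $\widetilde\Psi_k=\varphi(S_kx-c_2)$, with spans $\widetilde{\mathcal U}_M\subset \mathrm D(A)$ and $\widetilde{\mathcal V}_M\subset V$. Let $P_F^G$ denote the oblique projection onto $F$ along $G$; the projections $P_{\mathcal U_M}^{\widetilde{\mathcal U}_M^\perp}$ and $P_{\mathcal V_M}^{\widetilde{\mathcal V}_M^\perp}$ are extended by duality to $\mathrm D(A)'$ and $V'$. Put $$\mathbf F_1=-\lambda_1P_{\mathcal U_M}^{\widetilde{\mathcal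 U}_M^\perp}A^2P_{\widetilde{\mathcal U}_M}^{\mathcal U_M^\perp},\qquad \mathbf F_2=-\lambda_2P_{\mathcal V_M}^{\widetilde{\mathcal V}_M^\perp}AP_{\widetilde{\mathcal V}_M}^{\mathcal V_M^\perp}.$$ **System.** Let $\nu_0,\nu_1\in\mathbb R$, $\nu_2>0$, $f,g\colon\mathbb R\to\mathbb R$, and let $h=(h_1,h_2)$ be a function of time $t>0$ with values in $\mathrm D(A)'\times V'$. With $q=(q_1,q_2)$ consider $$\partial_ty_1+\nu_2\Delta^2y_1-\Delta(f(y_1)-\nu_1y_2)+g(y_1)=h_1+q_1,\qquad \partial_t(y_2+\nu_0y_1)-\Delta y_2=h_2+q_2,$$ with the chosen boundary conditions. A (weak) solution on $[0,\infty)$ is a $y=(y_1,y_2)\in C([0,\infty);H\times H)\cap L^2_{\rm loc}([0,\infty);\mathrm D(A)\times V)$ with $\partial_ty_1\in L^2_{\rm loc}([0,\infty);\mathrm D(A)')$ and $\partial_t(y_2+\nu_0y_1)\in L^2_{\rm loc}([0,\infty);V')$ such that, for almost every $t>0$, $f(y_1(t)),g(y_1(t))\in L^2(\Omega)$ and the equations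 hold in $\mathrm D(A)'\times V'$, where $-\Delta f(y_1)$ stands for the functional $\phi\mapsto(f(y_1)-f(0),A_0\phi)_H$ and $\Delta^2y_1$ for $\phi\mapsto(A_0y_1,A_0\phi)_H$. The target $y_{\tt r}$ is a solution with $q=0$. The controlled trajectory $y_{\tt c}$ is a solution with $q_1=\mathbf F_1y_1$ and $q_2=\mathbf F_2(y_2+\nu_0y_1)$, where $y=(y_1,y_2)=y_{\tt c}-y_{\tt r}$. **Growth assumption**, with an integer $n\ge1$ and constants $C_f,C_g,\zeta_i^f,\eta_i^f,\zeta_i^g,\eta_i^g\ge0$ such that $\eta_i^f,\eta_i^g<2$, $\zeta_i^f+\eta_i^f\ge2$, $\zeta_i^g+\eta_i^g\ge2$ for $1\le i\le n$: for almost all $t>0$ and all $z\in \mathrm D(A)$, $$-\langle A_0N_f(t,z),z\rangle\le C_f\sum_{i=1}^n\|z\|_H^{\zeta_i^f}\|z\|_{\mathrm D(A)}^{\eta_i^f},\qquad -\langle N_g(t,z),z\rangle\le C_g\sum_{i=1}^n\|z\|_H^{\zeta_i^g}\|z\|_{\mathrm D(A)}^{\eta_i^g},$$ where $N_f(t,z)=f(y_{1\tt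 r}(t)+z)-f(y_{1\tt r}(t))$, $N_g(t,z)=g(y_{1\tt r}(t)+z)-g(y_{1\tt r}(t))$ and $\langle A_0N_f,z\rangle=(N_f,A_0z)_H$; each inequality is required only where $N_f(t,z)$, respectively $N_g(t,z)$, is in $L^2(\Omega)$. **Corollary (semiglobal exponential stabilization to trajectories).** Let $\Omega$, the boundary conditions, and the data $\omega,c_{1,j},c_2$ of the actuators be fixed. For every $\mu>0$ there is $\overline\lambda_2\ge0$ such that for all $R>0$, $\nu_0,\nu_1\in\mathbb R$, $\nu_2>0$ and all constants $n,C_f,C_g,\zeta_i^f,\eta_i^f,\zeta_i^g,\eta_i^g$ as above there are $\overline M\ge1$ and $\overline\lambda_1\ge0$ with the following property. For all $f,g,h$ and every target $y_{\tt r}$ that satisfies the growth assumption with these constants, for all $M\ge\overline M$, $\lambda_1\ge\overline\lambda_1$, $\lambda_2\ge\overline\lambda_2$, and every controlled trajectory $y_{\tt c}$ with $$\|(y_1(0),\,y_2(0)+\nu_0y_1(0))\|_{H\times H}\le R,\qquad y=y_{\tt c}-y_{\tt r},$$ one has $$\|y(t)\|_{H\times H}^2\le4(1+\nu_0^2)^2e^{-2\mu(t-s)}\|y(s)\|_{H\times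 H}^2\qquad\text{for all }t\ge s\ge0.$$ -/

import Mathlib

open MeasureTheory Set
open scoped ContDiff

namespace CahnHilliard

/-! ### Spatial domains and boundary conditions -/

/-- The Euclidean space `ℝ^d`. -/
abbrev E (d : ℕ) := EuclideanSpace ℝ (Fin d)

inductive BoundaryCondition
  | dirichlet
  | neumann
  | periodic

/-- The spatial domains for which the actuators are constructed: a rectangle
`(0, L 0) × ⋯ × (0, L (d-1))` (which is also the fundamental cell of the torus in the periodic
case), or the open planar triangle with vertices `p 0`, `p 1`, `p 2`. -/
inductive Domain (d : ℕ)
  | box (L : Fin d → ℝ)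
  | triangle (p : Fin 3 → E d)

namespace Domain

variable {d : ℕ}

def region : Domain d → Set (E d)
  | .box L => {x | ∀ n, 0 < x n ∧ x n < L n}
  | .triangle p => interior (convexHull ℝ (Set.range p))

/-- The admissible pairs of a domain and a boundary condition. Rectangles are taken in dimension
`1`, `2` or `3`, with any of the three boundary conditions; triangles are nondegenerate, planar,
and not combined with periodic boundary conditions. -/
def Admissible : Domain d → BoundaryCondition → Prop
  | .box L, _ => (d = 1 ∨ d = 2 ∨ d = 3) ∧ ∀ n, 0 < L n
  | .triangle p, bc => d = 2 ∧ AffineIndependent ℝ p ∧ bc ≠ .periodic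

/-- The periods of the torus (only meaningful for rectangles). -/
def periods : Domain d → Set (E d)
  | .box L => {v | ∃ n, v = EuclideanSpace.single n (L n)}
  | .triangle _ => ∅

theorem measurableSet_region (D : Domain d) : MeasurableSet D.region := by
  cases D with
  | box L =>
    have : (Domain.box L).region = ⋂ n, {x : E d | 0 < x n ∧ x n < L n} := by
      ext x; simp [region]
    rw [this]
    refine MeasurableSet.iInter fun n => ?_
    have hn : Measurable fun x : E d => x n := by fun_prop
    exact (measurableSet_lt measurable_const hn).inter (measurableSet_lt hn measurable_const)
  | triangle p => exact isOpen_interior.measurableSet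

theorem isBounded_region (D : Domain d) : Bornology.IsBounded D.region := by
  cases D with
  | box L =>
    refine (Metric.isBounded_iff_subset_closedBall (0 : E d)).2 ⟨√(∑ n, (L n) ^ 2), ?_⟩
    intro x hx
    rw [mem_closedBall_zero_iff, EuclideanSpace.norm_eq]
    refine Real.sqrt_le_sqrt (Finset.sum_le_sum fun n _ => ?_)
    have h := hx n
    rw [Real.norm_eq_abs, sq_abs]
    nlinarith [h.1, h.2]
  | triangle p =>
    exact ((isBounded_convexHull).2 (Set.finite_range p).isBounded).subset interior_subset

instance (D : Domain d) : IsFiniteMeasure (volume.restrict D.region) :=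
  ⟨by simpa using D.isBounded_region.measure_lt_top⟩

end Domain

variable {d : ℕ}

/-- A bounded measurable function is square integrable on the domain. -/
theorem memLp_of_bounded (D : Domain d) {φ : E d → ℝ} (hφ : Measurable φ)
    (C : ℝ) (hC : ∀ x, |φ x| ≤ C) : MemLp φ 2 (volume.restrict D.region) :=
  MemLp.of_bound hφ.aestronglyMeasurable C (Filter.Eventually.of_forall hC)

/-- A continuous function is square integrable on the (bounded) domain. -/
theorem memLp_of_continuous (D : Domain d) {φ : E d → ℝ} (hφ : Continuous φ) :
    MemLp φ 2 (volume.restrict D.region) := by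
  obtain ⟨C, hC⟩ := D.isBounded_region.isCompact_closure.exists_bound_of_continuousOn
    hφ.continuousOn
  refine MemLp.of_bound hφ.aestronglyMeasurable C ?_
  filter_upwards [ae_restrict_mem D.measurableSet_region] with x hx
  exact hC x (subset_closure hx)

/-! ### Function spaces -/

/-- The pivot space `H = L²(Ω)`. -/
noncomputable abbrev H (D : Domain d) := Lp ℝ 2 (volume.restrict D.region)

/-- `L²(Ω) × L²(Ω)^d`, with its Hilbert space structure. An element stands for a function together
with its gradient. -/
noncomputable abbrev HGrad (D : Domain d) := WithLp 2 (H D × PiLp 2 fun _ : Fin d => H D)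

/-- The partial derivative of a smooth function. -/
noncomputable def pderiv (φ : E d → ℝ) (i : Fin d) (x : E d) : ℝ :=
  fderiv ℝ φ x (EuclideanSpace.single i 1)

theorem continuous_pderiv {φ : E d → ℝ} (hφ : ContDiff ℝ ∞ φ) (i : Fin d) :
    Continuous (pderiv φ i) :=
  (hφ.continuous_fderiv (by simp)).clm_apply continuous_const

/-- Smooth test functions: compactly supported in `Ω`, or smooth functions on the torus. -/
def IsTestFunction (D : Domain d) : BoundaryCondition → (E d → ℝ) → Prop
  | .periodic, φ => ContDiff ℝ ∞ φ ∧ ∀ v ∈ D.periods, ∀ x, φ (x + v) = φ x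
  | _, φ => ContDiff ℝ ∞ φ ∧ HasCompactSupport φ ∧ tsupport φ ⊆ D.region

theorem IsTestFunction.contDiff {D : Domain d} {bc : BoundaryCondition} {φ : E d → ℝ}
    (h : IsTestFunction D bc φ) : ContDiff ℝ ∞ φ := by
  cases bc <;> exact h.1

/-- The vector field `G` is the weak gradient of `u`. -/
def IsWeakGradient (D : Domain d) (bc : BoundaryCondition) (u : H D) (G : Fin d → H D) : Prop :=
  ∀ φ, IsTestFunction D bc φ → ∀ i,
    ∫ x in D.region, u x * pderiv φ i x = - ∫ x in D.region, G i x * φ x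

/-- The Sobolev space `W^{1,2}` of `Ω` (or of the torus), as the space of the pairs `(u, ∇u)`. -/
noncomputable def W12 (D : Domain d) (bc : BoundaryCondition) : Submodule ℝ (HGrad D) where
  carrier := {p | IsWeakGradient D bc p.fst p.snd}
  zero_mem' := by
    intro φ hφ i
    have h0 : ((0 : H D) : E d → ℝ) =ᵐ[volume.restrict D.region] 0 := Lp.coeFn_zero _ _ _
    rw [integral_eq_zero_of_ae, integral_eq_zero_of_ae, neg_zero]
    · filter_upwards [h0] with x hx
      change (0 : H D) x * _ = 0
      rw [hx, Pi.zero_apply, zero_mul]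
    · filter_upwards [h0] with x hx
      change (0 : H D) x * _ = 0
      rw [hx, Pi.zero_apply, zero_mul]
  add_mem' := by
    intro p q hp hq φ hφ i
    have key : ∀ (a b : H D) (ψ : E d → ℝ), Continuous ψ →
        ∫ x in D.region, (a + b : H D) x * ψ x
          = (∫ x in D.region, a x * ψ x) + ∫ x in D.region, b x * ψ x := by
      intro a b ψ hψ
      have hψ2 := memLp_of_continuous D hψ
      have ha : Integrable (fun x => a x * ψ x) (volume.restrict D.region) :=
        (Lp.memLp a).integrable_mul hψ2
      have hb : Integrable (fun x => b x * ψ x) (volume.restrict D.region) :=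
        (Lp.memLp b).integrable_mul hψ2
      rw [← integral_add ha hb]
      refine integral_congr_ae ?_
      filter_upwards [Lp.coeFn_add a b] with x hx
      rw [hx, Pi.add_apply, add_mul]
    have h1 := hp φ hφ i
    have h2 := hq φ hφ i
    have e1 := key p.fst q.fst (pderiv φ i) (continuous_pderiv hφ.contDiff i)
    have e2 := key (p.snd i) (q.snd i) φ hφ.contDiff.continuous
    change ∫ x in D.region, (p.fst + q.fst : H D) x * pderiv φ i x
      = - ∫ x in D.region, (p.snd i + q.snd i : H D) x * φ x
    rw [e1, e2, h1, h2]
    ring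
  smul_mem' := by
    intro c p hp φ hφ i
    have key : ∀ (a : H D) (ψ : E d → ℝ),
        ∫ x in D.region, (c • a : H D) x * ψ x = c * ∫ x in D.region, a x * ψ x := by
      intro a ψ
      rw [← integral_const_mul]
      refine integral_congr_ae ?_
      filter_upwards [Lp.coeFn_smul c a] with x hx
      rw [hx, Pi.smul_apply, smul_eq_mul, mul_assoc]
    change ∫ x in D.region, (c • p.fst : H D) x * pderiv φ i x
      = - ∫ x in D.region, (c • p.snd i : H D) x * φ x
    rw [key, key, hp φ hφ i]
    ring

/-- `W₀^{1,2}(Ω)`, the closure in `W^{1,2}(Ω)` of the smooth functions compactly supported in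
`Ω`. -/
noncomputable def W012 (D : Domain d) : Submodule ℝ (HGrad D) :=
  (Submodule.span ℝ {p : HGrad D | ∃ φ : E d → ℝ, IsTestFunction D .dirichlet φ ∧
    p.fst =ᵐ[volume.restrict D.region] φ ∧
    ∀ i, p.snd i =ᵐ[volume.restrict D.region] pderiv φ i}).topologicalClosure

/-- The space `V` (as the space of the pairs `(u, ∇u)`). It inherits the inner product
`(u, w)_V = (∇u, ∇w)_{L²} + (u, w)_{L²} = ⟨A u, w⟩_{V',V}`. -/
noncomputable def VSub (D : Domain d) : BoundaryCondition → Submodule ℝ (HGrad D)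
  | .dirichlet => W012 D
  | .neumann => W12 D .neumann
  | .periodic => W12 D .periodic

def V (D : Domain d) (bc : BoundaryCondition) : Type := VSub D bc

noncomputable instance (D : Domain d) (bc : BoundaryCondition) : NormedAddCommGroup (V D bc) :=
  inferInstanceAs (NormedAddCommGroup (VSub D bc))

noncomputable instance (D : Domain d) (bc : BoundaryCondition) : InnerProductSpace ℝ (V D bc) :=
  inferInstanceAs (InnerProductSpace ℝ (VSub D bc))

/-- The inclusion of `V` in `H`. -/
noncomputable def V.toH (D : Domain d) (bc : BoundaryCondition) : V D bc →L[ℝ] H D :=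
  (WithLp.fstL 2 ℝ (H D) (PiLp 2 fun _ : Fin d => H D)).comp (VSub D bc).subtypeL

/-- The gradient of an element of `V`. -/
noncomputable def V.grad (D : Domain d) (bc : BoundaryCondition) :
    V D bc →L[ℝ] PiLp 2 fun _ : Fin d => H D :=
  (WithLp.sndL 2 ℝ (H D) (PiLp 2 fun _ : Fin d => H D)).comp (VSub D bc).subtypeL

theorem V.inner_eq (D : Domain d) (bc : BoundaryCondition) (v w : V D bc) :
    inner ℝ v w = inner ℝ (V.grad D bc v) (V.grad D bc w)
      + inner ℝ (V.toH D bc v) (V.toH D bc w) := by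
  rw [add_comm]
  exact WithLp.prod_inner_apply _ _

/-- The domain `D(A) = {u ∈ V : A u ∈ H}` of the shifted Laplacian, as the space of the pairs
`(u, A u)`. -/
noncomputable def DASub (D : Domain d) (bc : BoundaryCondition) : Submodule ℝ (H D × H D) where
  carrier := {p | ∃ v : V D bc, V.toH D bc v = p.1 ∧
    ∀ w : V D bc, inner ℝ v w = inner ℝ p.2 (V.toH D bc w)}
  zero_mem' := ⟨0, by simp, by simp⟩
  add_mem' := by
    rintro p q ⟨v, hv, hv'⟩ ⟨w, hw, hw'⟩
    exact ⟨v + w, by simp [hv, hw], fun z => by simp [inner_add_left, hv', hw']⟩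
  smul_mem' := by
    rintro c p ⟨v, hv, hv'⟩
    exact ⟨c • v, by simp [hv], fun z => by
      rw [real_inner_smul_left, Prod.smul_snd, hv', real_inner_smul_left]⟩

/-- The space `D(A)`. The norm that it inherits from `H × H` is `‖A u‖_H`, see `DA.norm_eq`. -/
def DA (D : Domain d) (bc : BoundaryCondition) : Type := DASub D bc

noncomputable instance (D : Domain d) (bc : BoundaryCondition) : NormedAddCommGroup (DA D bc) :=
  inferInstanceAs (NormedAddCommGroup (DASub D bc))

noncomputable instance (D : Domain d) (bc : BoundaryCondition) : NormedSpace ℝ (DA D bc) :=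
  inferInstanceAs (NormedSpace ℝ (DASub D bc))

/-- The inclusion of `D(A)` in `H`. -/
noncomputable def DA.toH (D : Domain d) (bc : BoundaryCondition) : DA D bc →L[ℝ] H D :=
  (ContinuousLinearMap.fst ℝ (H D) (H D)).comp (DASub D bc).subtypeL

/-- The shifted Laplacian `A = -Δ + 1` from `D(A)` to `H`. -/
noncomputable def DA.A (D : Domain d) (bc : BoundaryCondition) : DA D bc →L[ℝ] H D :=
  (ContinuousLinearMap.snd ℝ (H D) (H D)).comp (DASub D bc).subtypeL

/-- The Laplacian `A₀ = A - 1 = -Δ` from `D(A)` to `H`. -/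
noncomputable def DA.A₀ (D : Domain d) (bc : BoundaryCondition) : DA D bc →L[ℝ] H D :=
  DA.A D bc - DA.toH D bc

theorem DA.norm_eq (D : Domain d) (bc : BoundaryCondition) (z : DA D bc) :
    ‖z‖ = ‖DA.A D bc z‖ := by
  obtain ⟨v, hv, hv'⟩ := z.2
  have hle : ‖V.toH D bc v‖ ≤ ‖v‖ := WithLp.norm_fst_le (H D) v.1
  have h1 : ‖v‖ ^ 2 ≤ ‖z.1.2‖ * ‖v‖ := by
    rw [← real_inner_self_eq_norm_sq, hv']
    exact (real_inner_le_norm _ _).trans (by gcongr)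
  have h2 : ‖v‖ ≤ ‖z.1.2‖ := by
    by_contra! h
    nlinarith [norm_nonneg v, norm_nonneg z.1.2]
  have h3 : ‖z.1.1‖ ≤ ‖z.1.2‖ := by rw [← hv]; exact hle.trans h2
  exact max_eq_right h3

/-- `A² : D(A) → D(A)'`, `⟨A² z, w⟩ = (A z, A w)_H`. -/
noncomputable def DA.Asq (D : Domain d) (bc : BoundaryCondition) (z : DA D bc) :
    StrongDual ℝ (DA D bc) :=
  (innerSL ℝ (DA.A D bc z)).comp (DA.A D bc)

/-- `A : V → V'`, `⟨A v, w⟩ = (v, w)_V`. -/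
noncomputable def V.A (D : Domain d) (bc : BoundaryCondition) (v : V D bc) :
    StrongDual ℝ (V D bc) :=
  innerSL ℝ v

/-! ### Actuators and auxiliary functions -/

/-- The open box `ω = (-l 0, l 0) × ⋯ × (-l (d-1), l (d-1))`. -/
def omega (l : Fin d → ℝ) : Set (E d) := {z | ∀ n, -l n < z n ∧ z n < l n}

/-- The data of the actuators for `M = 1`: a box `ω` centered at the origin, and `d + 2` disjoint
translates of it in `Ω`, with centers `c₁ 0, …, c₁ d` (in no common hyperplane) and `c₂`. -/
structure ActuatorData (D : Domain d) where
  l : Fin d → ℝ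
  l_pos : ∀ n, 0 < l n
  c₁ : Fin (d + 1) → E d
  c₂ : E d
  subset₁ : ∀ j, {x | x - c₁ j ∈ omega l} ⊆ D.region
  subset₂ : {x | x - c₂ ∈ omega l} ⊆ D.region
  disjoint₁ : ∀ i j, i ≠ j → Disjoint {x | x - c₁ i ∈ omega l} {x | x - c₁ j ∈ omega l}
  disjoint₂ : ∀ j, Disjoint {x | x - c₁ j ∈ omega l} {x | x - c₂ ∈ omega l}
  affineIndependent : AffineIndependent ℝ c₁

/-- The indices of the rescaled copies of `Ω` that `Ω` is divided into: `M^d` copies for a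
rectangle; `4^(M-1)` copies for a triangle, which is divided `M - 1` times by the midpoints of the
edges. -/
abbrev Domain.Cell : Domain d → ℕ → Type
  | .box _, M => Fin d → Fin M
  | .triangle _, M => Fin (M - 1) → Fin 4

instance (D : Domain d) (M : ℕ) : Fintype (D.Cell M) :=
  match D with
  | .box _ => inferInstanceAs (Fintype (Fin d → Fin M))
  | .triangle _ => inferInstanceAs (Fintype (Fin (M - 1) → Fin 4))

/-- The affine bijection of a subtriangle of the midpoint subdivision onto the whole triangle:
`i = 0, 1, 2` is the subtriangle at the vertex `p i`, and `i = 3` is the central one, which is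
rotated by the angle `π`. -/
noncomputable def triangleUnscale (p : Fin 3 → E d) (i : Fin 4) (x : E d) : E d :=
  if h : i.val < 3 then (2 : ℝ) • x - p ⟨i.val, h⟩ else p 0 + p 1 + p 2 - (2 : ℝ) • x

/-- The bijection (a translation, a homothety and a rotation) of the copy with index `k` onto
`Ω`. -/
noncomputable def Domain.unscale : (D : Domain d) → (M : ℕ) → D.Cell M → E d → E d
  | .box L, M, k, x => WithLp.toLp 2 fun n => (M : ℝ) * x n - (k n : ℕ) * L n
  | .triangle p, _, k, x => (List.ofFn k).foldl (fun y i => triangleUnscale p i y) x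

/-- `φ(z) = 1_ω(z) ∏ₙ sin (π (zₙ + lₙ) / (2 lₙ))`. -/
noncomputable def bump (l : Fin d → ℝ) : E d → ℝ :=
  (omega l).indicator fun z => ∏ n, Real.sin (Real.pi * ((z n + l n) / (2 * l n)))

theorem measurableSet_omega (l : Fin d → ℝ) : MeasurableSet (omega l) := by
  have : omega l = ⋂ n, {x : E d | -l n < x n ∧ x n < l n} := by
    ext x; simp [omega]
  rw [this]
  refine MeasurableSet.iInter fun n => ?_
  have hn : Measurable fun x : E d => x n := by fun_prop
  exact (measurableSet_lt measurable_const hn).inter (measurableSet_lt hn measurable_const)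

theorem measurable_bump (l : Fin d → ℝ) : Measurable (bump l) :=
  Measurable.indicator (by fun_prop) (measurableSet_omega l)

theorem abs_bump_le (l : Fin d → ℝ) (z : E d) : |bump l z| ≤ 1 := by
  unfold bump
  by_cases h : z ∈ omega l
  · rw [Set.indicator_of_mem h, Finset.abs_prod]
    exact Finset.prod_le_one (fun _ _ => abs_nonneg _) fun _ _ => Real.abs_sin_le_one _
  · simp [Set.indicator_of_notMem h]

theorem Domain.continuous_unscale (D : Domain d) (M : ℕ) (k : D.Cell M) :
    Continuous (D.unscale M k) := by
  cases D with
  | box L =>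
    change Continuous fun x : E d => (WithLp.toLp 2 fun n => (M : ℝ) * x n - (k n : ℕ) * L n : E d)
    fun_prop
  | triangle p =>
    change Continuous fun x : E d => (List.ofFn k).foldl (fun y i => triangleUnscale p i y) x
    generalize List.ofFn k = s
    induction s with
    | nil => exact continuous_id
    | cons i s ih =>
      simp only [List.foldl_cons]
      refine ih.comp ?_
      unfold triangleUnscale
      split_ifs <;> fun_prop

theorem memLp_actuator (D : Domain d) (l : Fin d → ℝ) (c : E d) (M : ℕ) (k : D.Cell M) :
    MemLp (fun x => (omega l).indicator (fun _ => (1 : ℝ)) (D.unscale M k x - c)) 2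
      (volume.restrict D.region) := by
  refine memLp_of_bounded D ?_ 1 fun x => ?_
  · exact (measurable_const.indicator (measurableSet_omega l)).comp
      ((D.continuous_unscale M k).measurable.sub_const c)
  · by_cases h : D.unscale M k x - c ∈ omega l <;> simp [h]

theorem memLp_bump_pow (D : Domain d) (l : Fin d → ℝ) (c : E d) (M : ℕ) (k : D.Cell M) (m : ℕ) :
    MemLp (fun x => bump l (D.unscale M k x - c) ^ m) 2 (volume.restrict D.region) := by
  refine memLp_of_bounded D ?_ 1 fun x => ?_
  · exact ((measurable_bump l).comp
      ((D.continuous_unscale M k).measurable.sub_const c)).pow_const m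
  · rw [abs_pow]
    exact pow_le_one₀ (abs_nonneg _) (abs_bump_le l _)

namespace ActuatorData

variable {D : Domain d}

/-- The actuators `Φ_j^M` on the order parameter; there are `(d + 1)` of them in each cell. -/
noncomputable def Phi (a : ActuatorData D) (M : ℕ) (j : D.Cell M × Fin (d + 1)) : H D :=
  (memLp_actuator D a.l (a.c₁ j.2) M j.1).toLp _

/-- The actuators `Ψ_j^M` on the temperature; there is one of them in each cell. -/
noncomputable def Psi (a : ActuatorData D) (M : ℕ) (j : D.Cell M) : H D :=
  (memLp_actuator D a.l a.c₂ M j).toLp _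

/-- The auxiliary functions associated with the actuators `Φ_j^M` (rescaled copies of `φ²`). -/
noncomputable def PhiAux (a : ActuatorData D) (M : ℕ) (j : D.Cell M × Fin (d + 1)) : H D :=
  (memLp_bump_pow D a.l (a.c₁ j.2) M j.1 2).toLp _

/-- The auxiliary functions associated with the actuators `Ψ_j^M` (rescaled copies of `φ`). -/
noncomputable def PsiAux (a : ActuatorData D) (M : ℕ) (j : D.Cell M) : H D :=
  (memLp_bump_pow D a.l a.c₂ M j 1).toLp _

end ActuatorData

/-! ### The feedback -/

section Feedback

variable {D : Domain d} {X : Type*} [NormedAddCommGroup X] [NormedSpace ℝ X]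

/-- The oblique projection `P_F^G w`: the element `p` of `F` with `w - p ∈ G`. It is seen as an
element of a space `X` with an inclusion `e` in `H` whose range contains `F`. -/
noncomputable def obliqueProj (e : X →L[ℝ] H D) (F G : Submodule ℝ (H D)) (w : H D) : X :=
  Classical.epsilon fun p : X => e p ∈ F ∧ w - e p ∈ G

/-- The extension to the dual `X'` of the oblique projection `P_F^{G⊥}`, where `G ⊆ X ⊆ H`: the
element `u` of `F` such that `ξ - u` vanishes on `G`. -/
noncomputable def obliqueProjDual (e : X →L[ℝ] H D) (F G : Submodule ℝ (H D))
    (ξ : StrongDual ℝ X) : H D :=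
  Classical.epsilon fun u : H D => u ∈ F ∧ ∀ w : X, e w ∈ G → inner ℝ u (e w) = ξ w

variable {ι : Type*} [Fintype ι]

/-- The operator `u ↦ ∑ j, u j • Φ j` associated with a family of actuators. -/
noncomputable def actuate (Φ : ι → H D) : (ι → ℝ) →ₗ[ℝ] H D := Fintype.linearCombination ℝ Φ

/-- The feedback input `-λ (U^⋄)⁻¹ P_U^{Ũ⊥} B P_Ũ^{U⊥} w`, with `U` the span of the actuators `Φ`,
`Ũ` the span of the auxiliary functions `Φ'`, `U^⋄` the operator `actuate Φ`, and `B : X → X'`. -/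
noncomputable def feedbackInput (e : X →L[ℝ] H D) (B : X → StrongDual ℝ X) (Φ Φ' : ι → H D)
    (lam : ℝ) (w : H D) : ι → ℝ :=
  (-lam) • Function.invFun (actuate Φ)
    (obliqueProjDual e (Submodule.span ℝ (Set.range Φ)) (Submodule.span ℝ (Set.range Φ'))
      (B (obliqueProj e (Submodule.span ℝ (Set.range Φ')) (Submodule.span ℝ (Set.range Φ))ᗮ w)))

/-- The feedback operator `K₁`, as a function of `y₁`. -/
noncomputable def K₁ (bc : BoundaryCondition) (a : ActuatorData D) (M : ℕ) (lam₁ : ℝ) (y₁ : H D) :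
    D.Cell M × Fin (d + 1) → ℝ :=
  feedbackInput (DA.toH D bc) (DA.Asq D bc) (a.Phi M) (a.PhiAux M) lam₁ y₁

/-- The feedback operator `K₂`, as a function of `y₂ + ν₀ y₁`. -/
noncomputable def K₂ (bc : BoundaryCondition) (a : ActuatorData D) (M : ℕ) (lam₂ : ℝ) (w : H D) :
    D.Cell M → ℝ :=
  feedbackInput (V.toH D bc) (V.A D bc) (a.Psi M) (a.PsiAux M) lam₂ w

end Feedback

/-! ### Solutions of the Cahn-Hilliard system -/

/-- `F` belongs to `L²((0, T), X)` for all `T > 0`. -/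
def L2Loc {X : Type*} [NormedAddCommGroup X] (F : ℝ → X) : Prop :=
  ∀ T > 0, MemLp F 2 (volume.restrict (Ioc 0 T))

/-- `ξ` is the derivative of `y : [0, ∞) → H` in the dual of a space `X` with inclusion `e` in
`H`. -/
def IsTimeDeriv {D : Domain d} {X : Type*} [NormedAddCommGroup X] [NormedSpace ℝ X]
    (e : X →L[ℝ] H D) (y : ℝ → H D) (ξ : ℝ → StrongDual ℝ X) : Prop :=
  ∀ φ : X, ∀ s t, 0 ≤ s → s ≤ t →
    inner ℝ (y t) (e φ) - inner ℝ (y s) (e φ) = ∫ τ in s..t, ξ τ φ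

/-- `(y₁, y₂)` is a weak solution, on the time interval `[0, ∞)`, of
`∂ₜ y₁ + ν₂ Δ² y₁ - Δ (f(y₁) - ν₁ y₂) + g(y₁) = h₁ + q₁`,
`∂ₜ (y₂ + ν₀ y₁) - Δ y₂ = h₂ + q₂`,
with the boundary conditions `bc`: `y` is continuous with values in `H × H`,
`y ∈ L²_loc(D(A) × V)`, `∂ₜ y₁ ∈ L²_loc(D(A)')`, `∂ₜ (y₂ + ν₀ y₁) ∈ L²_loc(V')`, and the equations
hold in `D(A)'` and in `V'`, for almost all `t > 0`. The constant `f(0)` is subtracted from `f(y₁)`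
in the duality pairing `⟨A₀ f(y₁), φ⟩ = (f(y₁) - f(0), A₀ φ)`, because `-Δ` annihilates constants;
this makes a difference only under Dirichlet boundary conditions with `f(0) ≠ 0`, where the pairing
`(1, A₀ φ)` is a boundary term. -/
structure IsSolution (D : Domain d) (bc : BoundaryCondition) (ν₀ ν₁ ν₂ : ℝ) (f g : ℝ → ℝ)
    (h₁ : ℝ → StrongDual ℝ (DA D bc)) (h₂ : ℝ → StrongDual ℝ (V D bc)) (q₁ q₂ : ℝ → H D)
    (y₁ y₂ : ℝ → H D) : Prop where
  continuousOn₁ : ContinuousOn y₁ (Ici 0)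
  continuousOn₂ : ContinuousOn y₂ (Ici 0)
  exists_weak : ∃ (Y₁ : ℝ → DA D bc) (Y₂ : ℝ → V D bc)
    (ξ₁ : ℝ → StrongDual ℝ (DA D bc)) (ξ₂ : ℝ → StrongDual ℝ (V D bc)),
    L2Loc Y₁ ∧ L2Loc Y₂ ∧ L2Loc ξ₁ ∧ L2Loc ξ₂ ∧
    IsTimeDeriv (DA.toH D bc) y₁ ξ₁ ∧
    IsTimeDeriv (V.toH D bc) (fun t => y₂ t + ν₀ • y₁ t) ξ₂ ∧
    ∀ᵐ t ∂volume.restrict (Ioi (0 : ℝ)),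
      DA.toH D bc (Y₁ t) = y₁ t ∧ V.toH D bc (Y₂ t) = y₂ t ∧
      MemLp (fun x => f (y₁ t x)) 2 (volume.restrict D.region) ∧
      MemLp (fun x => g (y₁ t x)) 2 (volume.restrict D.region) ∧
      (∀ φ : DA D bc,
        ξ₁ t φ + ν₂ * inner ℝ (DA.A₀ D bc (Y₁ t)) (DA.A₀ D bc φ)
          + (∫ x in D.region, (f (y₁ t x) - f 0) * DA.A₀ D bc φ x)
          - ν₁ * inner ℝ (y₂ t) (DA.A₀ D bc φ)
          + (∫ x in D.region, g (y₁ t x) * DA.toH D bc φ x)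
        = h₁ t φ + inner ℝ (q₁ t) (DA.toH D bc φ)) ∧
      (∀ ψ : V D bc,
        ξ₂ t ψ + inner ℝ (V.grad D bc (Y₂ t)) (V.grad D bc ψ)
        = h₂ t ψ + inner ℝ (q₂ t) (V.toH D bc ψ))

/-- The trajectory `(y₁, y₂)` of the uncontrolled system. -/
def IsTrajectory (D : Domain d) (bc : BoundaryCondition) (ν₀ ν₁ ν₂ : ℝ) (f g : ℝ → ℝ)
    (h₁ : ℝ → StrongDual ℝ (DA D bc)) (h₂ : ℝ → StrongDual ℝ (V D bc))
    (y₁ y₂ : ℝ → H D) : Prop :=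
  IsSolution D bc ν₀ ν₁ ν₂ f g h₁ h₂ (fun _ => 0) (fun _ => 0) y₁ y₂

/-- The trajectory `(c₁, c₂)` of the system controlled by the feedback input
`(K₁ (c₁ - r₁), K₂ ((c₂ - r₂) + ν₀ (c₁ - r₁)))`, where `(r₁, r₂)` is the targeted trajectory. -/
def IsControlledTrajectory (D : Domain d) (bc : BoundaryCondition) (a : ActuatorData D)
    (M : ℕ) (lam₁ lam₂ : ℝ) (ν₀ ν₁ ν₂ : ℝ) (f g : ℝ → ℝ)
    (h₁ : ℝ → StrongDual ℝ (DA D bc)) (h₂ : ℝ → StrongDual ℝ (V D bc))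
    (r₁ r₂ c₁ c₂ : ℝ → H D) : Prop :=
  IsSolution D bc ν₀ ν₁ ν₂ f g h₁ h₂
    (fun t => actuate (a.Phi M) (K₁ bc a M lam₁ (c₁ t - r₁ t)))
    (fun t => actuate (a.Psi M) (K₂ bc a M lam₂ ((c₂ t - r₂ t) + ν₀ • (c₁ t - r₁ t))))
    c₁ c₂

/-- The growth assumption on `N_f(t, z) = f(r₁(t) + z) - f(r₁(t))` along the target: for almost all
`t > 0` and all `z ∈ D(A)`,
`-⟨A₀ N_f(t, z), z⟩ ≤ C ∑ᵢ ‖z‖_H ^ (ζ i) * ‖z‖_{D(A)} ^ (η i)`.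
It is only asked for those `z` with `N_f(t, z) ∈ L²(Ω)`. -/
def GrowthF (D : Domain d) (bc : BoundaryCondition) (f : ℝ → ℝ) (r₁ : ℝ → H D) {n : ℕ}
    (C : ℝ) (ζ η : Fin n → ℝ) : Prop :=
  ∀ᵐ t ∂volume.restrict (Ioi (0 : ℝ)), ∀ z : DA D bc,
    MemLp (fun x => f (r₁ t x + DA.toH D bc z x) - f (r₁ t x)) 2 (volume.restrict D.region) →
    -(∫ x in D.region, (f (r₁ t x + DA.toH D bc z x) - f (r₁ t x)) * DA.A₀ D bc z x)
      ≤ C * ∑ i, ‖DA.toH D bc z‖ ^ ζ i * ‖DA.A D bc z‖ ^ η i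

/-- The growth assumption on `N_g(t, z) = g(r₁(t) + z) - g(r₁(t))` along the target: for almost all
`t > 0` and all `z ∈ D(A)`,
`-⟨N_g(t, z), z⟩ ≤ C ∑ᵢ ‖z‖_H ^ (ζ i) * ‖z‖_{D(A)} ^ (η i)`.
It is only asked for those `z` with `N_g(t, z) ∈ L²(Ω)`. -/
def GrowthG (D : Domain d) (bc : BoundaryCondition) (g : ℝ → ℝ) (r₁ : ℝ → H D) {n : ℕ}
    (C : ℝ) (ζ η : Fin n → ℝ) : Prop :=
  ∀ᵐ t ∂volume.restrict (Ioi (0 : ℝ)), ∀ z : DA D bc,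
    MemLp (fun x => g (r₁ t x + DA.toH D bc z x) - g (r₁ t x)) 2 (volume.restrict D.region) →
    -(∫ x in D.region, (g (r₁ t x + DA.toH D bc z x) - g (r₁ t x)) * DA.toH D bc z x)
      ≤ C * ∑ i, ‖DA.toH D bc z‖ ^ ζ i * ‖DA.A D bc z‖ ^ η i

/-- The norm of `H × H`. -/
noncomputable def normHH {D : Domain d} (u v : H D) : ℝ := √(‖u‖ ^ 2 + ‖v‖ ^ 2)

end CahnHilliard

/-!
Let `z` be the difference of the controlled trajectory and the target. The energy
`‖z₁‖² + ‖z₂ + ν₀ z₁‖²` is equivalent to `‖z‖²`, and since the second equation is an equation for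
`z₂ + ν₀ z₁` its derivative is the sum of the dissipation, of lower order coupling terms, of the
nonlinear terms and of the feedback. The coupling terms cost a multiple of `‖z₁‖²`, and so do the
nonlinear terms by Young's inequality, because `η < 2`, as long as `‖z₁‖` stays below a fixed bound.

This multiple is absorbed as follows. The feedback is diagonal with respect to the actuators: up to
the factor `-λ` it gives back the squared norm of the oblique projection of the state. A function
whose integrals against the actuators of a cell all vanish satisfies a Poincaré inequality on that
cell, with a constant that tends to `0` with the size of the cell; for `z₁` it becomes an
inequality between `‖z₁‖` and `‖A z₁‖` because `‖∇z₁‖² ≤ ‖A z₁‖ ‖z₁‖`. Hence for fine subdivisions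
and large `λ` the dissipation and the feedback dominate any given multiple of the norm in `H`.
Below the bound the energy therefore decays exponentially, so that it never reaches the bound.

The energy estimate tests the equations with functions that are only square integrable in time.
It is obtained from difference quotients and the continuity of translations in `L²`.
-/

namespace CahnHilliard

open Filter Topology

section EnergyInequality

variable {X Y Z : Type*} [NormedAddCommGroup X] [NormedSpace ℝ X] [NormedAddCommGroup Y]
  [NormedSpace ℝ Y] [NormedAddCommGroup Z] [NormedSpace ℝ Z] {f : ℝ → Y} {g : ℝ → X}

theorem continuous_setIntegral_bilin_translate (B : Y →L[ℝ] X →L[ℝ] Z) (hf : MemLp f 2 volume)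
    (hg : MemLp g 2 volume) (S : Set ℝ) :
    Continuous fun p : ℝ × ℝ => ∫ τ in S, B (f (p.1 + τ)) (g (p.2 + τ)) := by
  have : Fact ((2 : ENNReal) ≠ ⊤) := ⟨ENNReal.ofNat_ne_top⟩
  have hmk : Continuous (DomAddAct.mk : ℝ → ℝᵈᵃᵃ) := DomAddAct.mkHomeomorph.continuous
  have hf' : Continuous fun p : ℝ × ℝ => DomAddAct.mk p.1 +ᵥ hf.toLp f :=
    (hmk.comp continuous_fst).vadd continuous_const
  have hg' : Continuous fun p : ℝ × ℝ => DomAddAct.mk p.2 +ᵥ hg.toLp g :=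
    (hmk.comp continuous_snd).vadd continuous_const
  have hB : Continuous fun p : ℝ × ℝ =>
      B.holderL volume 2 2 1 (DomAddAct.mk p.1 +ᵥ hf.toLp f) (DomAddAct.mk p.2 +ᵥ hg.toLp g) :=
    ((B.holderL volume 2 2 1).continuous.comp hf').clm_apply hg'
  refine ((continuous_setIntegral S).comp hB).congr fun p =>
    integral_congr_ae (ae_restrict_of_ae ?_)
  simp only [DomAddAct.mk_vadd_toLp, ContinuousLinearMap.holderL_apply_apply]
  filter_upwards [B.coeFn_holder (p := 2) (q := 2) (r := 1) (MemLp.toLp _ _) (MemLp.toLp _ _),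
    (hf.comp_measurePreserving (measurePreserving_vadd p.1 volume)).coeFn_toLp,
    (hg.comp_measurePreserving (measurePreserving_vadd p.2 volume)).coeFn_toLp] with τ hB hf hg
  exact hB.trans (congrArg₂ (fun y x => B y x) hf hg)

theorem integrable_prod_bilin_translate (B : Y →L[ℝ] X →L[ℝ] Z) (hf : MemLp f 2 volume)
    (hg : MemLp g 2 volume) (h : ℝ) (ν : Measure ℝ) [IsFiniteMeasure ν] :
    Integrable (fun p : ℝ × ℝ => B (f (p.1 + p.2)) (g (h + p.2))) (ν.prod volume) := by
  have hf' : MemLp (fun p : ℝ × ℝ => f (p.1 + p.2)) 2 (ν.prod volume) :=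
    (hf.comp_snd ν).comp_measurePreserving (measurePreserving_prod_add ν volume)
  have hg' : MemLp (fun p : ℝ × ℝ => g (h + p.2)) 2 (ν.prod volume) :=
    (hg.comp_measurePreserving (measurePreserving_add_left volume h)).comp_snd ν
  exact memLp_one_iff_integrable.1 (B.memLp_of_bilin 1 hf' hg')

theorem integral_translate_sub {E : ℝ → ℝ} (hE : Continuous E) (s t h : ℝ) :
    ∫ τ in s..t, (E (h + τ) - E τ)
      = h * ((∫ u in (0 : ℝ)..1, E (t + h * u)) - ∫ u in (0 : ℝ)..1, E (s + h * u)) := by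
  have hEi (a b : ℝ) : IntervalIntegrable E volume a b := hE.intervalIntegrable a b
  have hrescale (a : ℝ) : h * ∫ u in (0 : ℝ)..1, E (a + h * u) = ∫ τ in a..a + h, E τ := by
    simp
  rw [mul_sub, hrescale, hrescale, intervalIntegral.integral_sub
    (Continuous.intervalIntegrable (by fun_prop) _ _) (hEi _ _),
    intervalIntegral.integral_comp_add_left E h, add_comm h s, add_comm h t]
  linarith [intervalIntegral.integral_add_adjacent_intervals (hEi s (s + h)) (hEi (s + h) (t + h)),
    intervalIntegral.integral_add_adjacent_intervals (hEi s t) (hEi t (t + h))]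

/- Both sides of the integrated inequality are `h` times averages over translations of size at most
`h`, which depend continuously on `h` although `f` and `g` are only square integrable. -/
theorem sub_le_integral_of_translate_sub_le {E : ℝ → ℝ} (hE : Continuous E)
    (B : Y →L[ℝ] X →L[ℝ] ℝ) (hf : MemLp f 2 volume) (hg : MemLp g 2 volume) {s t : ℝ} (hst : s ≤ t)
    (hinc : ∀ h ∈ Ioo (0 : ℝ) 1, ∀ᵐ τ ∂volume.restrict (Ioc s t),
      E (h + τ) - E τ ≤ ∫ r in Ioc 0 h, B (f (r + τ)) (g (h + τ))) :
    E t - E s ≤ ∫ τ in Ioc s t, B (f τ) (g τ) := by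
  let F : ℝ × ℝ → ℝ := fun p => ∫ τ in Ioc s t, B (f (p.1 + τ)) (g (p.2 + τ))
  have hF : Continuous F := continuous_setIntegral_bilin_translate B hf hg _
  let G : ℝ → ℝ → ℝ := fun a h => ∫ u in (0 : ℝ)..1, E (a + h * u)
  have hG (a : ℝ) : Continuous (G a) :=
    intervalIntegral.continuous_parametric_intervalIntegral_of_continuous' (by fun_prop) _ _
  have hGF : ∀ h ∈ Ioo (0 : ℝ) 1, G t h - G s h ≤ ∫ u in (0 : ℝ)..1, F (h * u, h) := by
    intro h hh
    have hint := (integrable_prod_bilin_translate B hf hg h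
      (volume.restrict (Ioc 0 h))).mono_measure
        (Measure.prod_mono le_rfl (Measure.restrict_le_self (s := Ioc s t)))
    have hFubini : ∫ τ in s..t, (E (h + τ) - E τ) ≤ ∫ r in (0 : ℝ)..h, F (r, h) := by
      rw [intervalIntegral.integral_of_le hst, intervalIntegral.integral_of_le hh.1.le,
        integral_integral_swap hint]
      exact integral_mono_ae (by fun_prop : Continuous fun τ => E (h + τ) - E τ).integrableOn_Ioc
        hint.integral_prod_right (hinc h hh)
    have hrescale : h * ∫ u in (0 : ℝ)..1, F (h * u, h) = ∫ r in (0 : ℝ)..h, F (r, h) := by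
      simpa using intervalIntegral.smul_integral_comp_mul_left (a := 0) (b := 1)
        (fun r => F (r, h)) h
    rw [integral_translate_sub hE, ← hrescale] at hFubini
    exact le_of_mul_le_mul_left hFubini hh.1
  have hlim : G t 0 - G s 0 ≤ ∫ u in (0 : ℝ)..1, F (0 * u, 0) := by
    refine ContinuousWithinAt.closure_le (s := Ioo (0 : ℝ) 1) (by simp)
      ((hG t).sub (hG s)).continuousWithinAt (Continuous.continuousWithinAt ?_) hGF
    exact intervalIntegral.continuous_parametric_intervalIntegral_of_continuous' (by fun_prop) _ _
  simpa [F, G] using hlim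

omit [NormedSpace ℝ X] in
theorem L2Loc.memLp_indicator {F : ℝ → X} (hF : L2Loc F) {T : ℝ} (hT : 0 < T) :
    MemLp ((Ioc 0 T).indicator F) 2 volume :=
  (memLp_indicator_iff_restrict measurableSet_Ioc).2 (hF T hT)

theorem norm_sq_sub_norm_sq_le {F : Type*} [NormedAddCommGroup F] [InnerProductSpace ℝ F]
    (u v : F) : ‖u‖ ^ 2 - ‖v‖ ^ 2 ≤ 2 * (inner ℝ u u - inner ℝ v u) := by
  have := norm_sub_sq_real u v
  rw [real_inner_self_eq_norm_sq, real_inner_comm]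
  nlinarith [sq_nonneg ‖u - v‖]

theorem norm_sq_translate_sub_le {F : Type*} [NormedAddCommGroup F] [InnerProductSpace ℝ F]
    {e : X → F} {y : ℝ → F} {ξ : ℝ → StrongDual ℝ X}
    (hderiv : ∀ φ, ∀ s t, 0 ≤ s → s ≤ t →
      inner ℝ (y t) (e φ) - inner ℝ (y s) (e φ) = ∫ τ in s..t, ξ τ φ) {τ h : ℝ} (hτ : 0 ≤ τ)
    (hh : 0 ≤ h) {x : X} (hx : e x = y (h + τ)) :
    ‖y (h + τ)‖ ^ 2 - ‖y τ‖ ^ 2 ≤ ∫ r in Ioc 0 h, 2 * ξ (r + τ) x := by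
  calc ‖y (h + τ)‖ ^ 2 - ‖y τ‖ ^ 2
      ≤ 2 * (inner ℝ (y (h + τ)) (y (h + τ)) - inner ℝ (y τ) (y (h + τ))) :=
        norm_sq_sub_norm_sq_le _ _
    _ = 2 * ∫ σ in τ..h + τ, ξ σ x := by
        rw [← hderiv x τ (h + τ) hτ (by linarith), hx]
    _ = ∫ r in Ioc 0 h, 2 * ξ (r + τ) x := by
        rw [integral_const_mul, ← intervalIntegral.integral_of_le hh,
          intervalIntegral.integral_comp_add_right (fun σ => ξ σ x) τ, zero_add]

theorem norm_sq_sub_norm_sq_le_integral {F : Type*} [NormedAddCommGroup F] [InnerProductSpace ℝ F]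
    {e : X → F} {y : ℝ → F} {Y : ℝ → X} {ξ : ℝ → StrongDual ℝ X} (hy : ContinuousOn y (Ici 0))
    (hY : L2Loc Y) (hξ : L2Loc ξ)
    (hderiv : ∀ φ, ∀ s t, 0 ≤ s → s ≤ t →
      inner ℝ (y t) (e φ) - inner ℝ (y s) (e φ) = ∫ τ in s..t, ξ τ φ)
    (hYy : ∀ᵐ t ∂volume.restrict (Ioi (0 : ℝ)), e (Y t) = y t) {s t : ℝ} (hs : 0 ≤ s)
    (hst : s ≤ t) :
    ‖y t‖ ^ 2 - ‖y s‖ ^ 2 ≤ 2 * ∫ τ in s..t, ξ τ (Y τ) := by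
  have hT : 0 < t + 1 := by linarith
  have hE : Continuous fun τ : ℝ => ‖y (max τ 0)‖ ^ 2 :=
    (hy.comp_continuous (by fun_prop) fun τ => mem_Ici.2 (le_max_right _ _)).norm.pow 2
  have hlimit := sub_le_integral_of_translate_sub_le hE
    ((2 : ℝ) • ContinuousLinearMap.id ℝ (StrongDual ℝ X)) (hξ.memLp_indicator hT)
    (hY.memLp_indicator hT) hst fun h hh => by
    have hYy' : ∀ᵐ τ : ℝ, 0 < h + τ → e (Y (h + τ)) = y (h + τ) :=
      (measurePreserving_add_left volume h).quasiMeasurePreserving.ae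
        ((ae_restrict_iff' measurableSet_Ioi).1 hYy)
    filter_upwards [ae_restrict_of_ae hYy', ae_restrict_mem measurableSet_Ioc] with τ hτ hτst
    obtain ⟨hh0, hh1⟩ := hh
    have hτ0 : 0 < τ := hs.trans_lt hτst.1
    have hmem : ∀ r ∈ Icc 0 h, r + τ ∈ Ioc 0 (t + 1) := fun r hr =>
      ⟨by linarith [hr.1], by linarith [hr.2, hτst.2]⟩
    rw [max_eq_left hτ0.le, max_eq_left (by linarith)]
    refine (norm_sq_translate_sub_le hderiv hτ0.le hh0.le (hτ (by linarith))).trans_eq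
      (setIntegral_congr_fun measurableSet_Ioc fun r hr => ?_)
    simp [indicator_of_mem (hmem r (Ioc_subset_Icc_self hr)),
      indicator_of_mem (hmem h ⟨hh0.le, le_rfl⟩)]
  simp only [max_eq_left hs, max_eq_left (hs.trans hst)] at hlimit
  rw [intervalIntegral.integral_of_le hst, ← integral_const_mul]
  refine hlimit.trans_eq (setIntegral_congr_fun measurableSet_Ioc fun τ hτ => ?_)
  have : τ ∈ Ioc 0 (t + 1) := ⟨hs.trans_lt hτ.1, by linarith [hτ.2]⟩
  simp [this]

end EnergyInequality

section Decay

theorem hasDerivWithinAt_primitive_Ici {E : ℝ → ℝ} (hE : ContinuousOn E (Ici 0)) {x : ℝ}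
    (hx : 0 ≤ x) : HasDerivWithinAt (fun z => ∫ τ in x..z, E τ) (E x) (Ioi x) x := by
  have hsub : Ici x ⊆ Ici 0 := Ici_subset_Ici.2 hx
  refine (intervalIntegral.integral_hasDerivWithinAt_right (s := Ici x) (t := Ioi x) (by simp)
    ⟨Ici x, mem_of_superset self_mem_nhdsWithin Ioi_subset_Ici_self,
      (hE.mono hsub).aestronglyMeasurable measurableSet_Ici⟩
    ((hE x hx).mono (Ioi_subset_Ici_self.trans hsub))).mono Ioi_subset_Ici_self

theorem le_exp_mul_of_sub_le_integral {E : ℝ → ℝ} {μ s : ℝ} (hE : ContinuousOn E (Ici 0))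
    (hs : 0 ≤ s) (hdecr : ∀ x z, s ≤ x → x ≤ z → E z - E x ≤ -μ * ∫ τ in x..z, E τ) {t : ℝ}
    (hst : s ≤ t) : E t ≤ Real.exp (-μ * (t - s)) * E s := by
  have hslope : ∀ x ∈ Ico s t, ∀ r, -μ * E x < r →
      ∃ᶠ z in 𝓝[>] x, (z - x)⁻¹ * (E z - E x) < r := by
    intro x hx r hr
    have hderiv := (hasDerivWithinAt_primitive_Ici hE (hs.trans hx.1)).const_mul (-μ)
    rw [hasDerivWithinAt_iff_tendsto_slope' self_notMem_Ioi] at hderiv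
    refine Eventually.frequently ?_
    filter_upwards [hderiv.eventually_lt_const hr, self_mem_nhdsWithin] with z hzr hxz
    refine lt_of_le_of_lt ?_ hzr
    rw [slope_def_field, intervalIntegral.integral_same, mul_zero, sub_zero, div_eq_inv_mul]
    gcongr
    · exact inv_nonneg.2 (sub_nonneg.2 (mem_Ioi.1 hxz).le)
    · exact hdecr x z hx.1 (mem_Ioi.1 hxz).le
  have hgronwall := le_gronwallBound_of_liminf_deriv_right_le (K := -μ) (ε := 0)
    (hE.mono (Icc_subset_Ici_self.trans (Ici_subset_Ici.2 hs))) hslope le_rfl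
    (fun x _ => (add_zero _).ge) t (right_mem_Icc.2 hst)
  rwa [gronwallBound_ε0, mul_comm] at hgronwall

theorem le_of_le_while_le {E : ℝ → ℝ} {ρ : ℝ} (hE : ContinuousOn E (Ici 0)) (h0 : E 0 < ρ)
    (hdecr : ∀ x z, 0 ≤ x → x ≤ z → (∀ τ ∈ Icc x z, E τ ≤ ρ) → E z ≤ E x) {t : ℝ} (ht : 0 ≤ t) :
    E t ≤ E 0 := by
  have hclosed : IsClosed ({τ | E τ ≤ E 0} ∩ Icc 0 t) := by
    rw [inter_comm]
    exact (hE.mono Icc_subset_Ici_self).preimage_isClosed_of_isClosed isClosed_Icc isClosed_Iic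
  refine hclosed.Icc_subset_of_forall_mem_nhdsWithin (le_refl (E 0)) (fun x hx => ?_)
    (right_mem_Icc.2 ht)
  have hbelow : ∀ᶠ τ in 𝓝[≥] x, E τ < ρ :=
    ((hE x hx.2.1).mono (Ici_subset_Ici.2 hx.2.1)).eventually_lt_const (hx.1.trans_lt h0)
  obtain ⟨u, hu, hsub⟩ := mem_nhdsGE_iff_exists_Ico_subset.1 hbelow
  filter_upwards [Ioo_mem_nhdsGT hu] with z hz
  exact (hdecr x z hx.2.1 hz.1.le fun τ hτ =>
    (hsub ⟨hτ.1, hτ.2.trans_lt hz.2⟩).le).trans hx.1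

theorem exponential_decay_of_decay_below {E b : ℝ → ℝ} {μ ρ : ℝ} (hμ : 0 ≤ μ)
    (hE : ContinuousOn E (Ici 0)) (hE0 : ∀ t, 0 ≤ t → 0 ≤ E t) (hρ : E 0 < ρ)
    (hb : ∀ s t, 0 ≤ s → s ≤ t → IntervalIntegrable b volume s t)
    (hEb : ∀ s t, 0 ≤ s → s ≤ t → E t - E s ≤ ∫ τ in s..t, b τ)
    (hbE : ∀ᵐ τ ∂volume.restrict (Ioi (0 : ℝ)), E τ ≤ ρ → b τ ≤ -μ * E τ)
    {s t : ℝ} (hs : 0 ≤ s) (hst : s ≤ t) :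
    E t ≤ Real.exp (-μ * (t - s)) * E s := by
  have hdecr : ∀ x z, 0 ≤ x → x ≤ z → (∀ τ ∈ Icc x z, E τ ≤ ρ) →
      E z - E x ≤ -μ * ∫ τ in x..z, E τ := by
    intro x z hx hxz hle
    refine (hEb x z hx hxz).trans ?_
    rw [← intervalIntegral.integral_const_mul, intervalIntegral.integral_of_le hxz,
      intervalIntegral.integral_of_le hxz]
    refine integral_mono_ae (hb x z hx hxz).1
      (((hE.mono fun y hy => hx.trans hy.1).intervalIntegrable_of_Icc hxz).const_mul _).1 ?_
    filter_upwards [ae_restrict_of_ae_restrict_of_subset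
      (Ioc_subset_Ioi_self.trans (Ioi_subset_Ioi hx)) hbE, ae_restrict_mem measurableSet_Ioc]
      with τ hτ hmem using hτ (hle τ (Ioc_subset_Icc_self hmem))
  have hle : ∀ τ, 0 ≤ τ → E τ ≤ E 0 := fun τ hτ =>
    le_of_le_while_le hE hρ (fun x z hx hxz hle => by
      have := hdecr x z hx hxz hle
      have : 0 ≤ ∫ τ in x..z, E τ :=
        intervalIntegral.integral_nonneg hxz fun u hu => hE0 u (hx.trans hu.1)
      nlinarith) hτ
  exact le_exp_mul_of_sub_le_integral hE hs (fun x z hx hxz => hdecr x z (hs.trans hx) hxz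
    fun τ hτ => (hle τ ((hs.trans hx).trans hτ.1)).trans hρ.le) hst

end Decay

section Sobolev

variable {d : ℕ} {D : Domain d} {bc : BoundaryCondition}

theorem Domain.isOpen_region (D : Domain d) : IsOpen D.region := by
  cases D with
  | box L =>
    have hcoord (n : Fin d) : Continuous fun x : E d => x n := by fun_prop
    simp only [Domain.region, ofPred_forall]
    exact isOpen_iInter_of_finite fun n =>
      (isOpen_lt continuous_const (hcoord n)).and (isOpen_lt (hcoord n) continuous_const)
  | triangle p => exact isOpen_interior

theorem inner_toLp_left {f : E d → ℝ} (hf : MemLp f 2 (volume.restrict D.region)) (u : H D) :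
    inner ℝ (hf.toLp f) u = ∫ x in D.region, u x * f x := by
  rw [L2.inner_def]
  refine integral_congr_ae ?_
  filter_upwards [hf.coeFn_toLp] with x hx
  simp [hx]

theorem isClosed_W12 (D : Domain d) (bc : BoundaryCondition) :
    IsClosed (W12 D bc : Set (HGrad D)) := by
  have hW : (W12 D bc : Set (HGrad D)) = ⋂ φ, ⋂ h : IsTestFunction D bc φ, ⋂ i : Fin d,
      {p : HGrad D | inner ℝ ((memLp_of_continuous D (continuous_pderiv h.contDiff i)).toLp _) p.fst
        = - inner ℝ ((memLp_of_continuous D h.contDiff.continuous).toLp _) (p.snd i)} := by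
    ext p
    simp only [mem_iInter, mem_ofPred_eq, inner_toLp_left]
    rfl
  rw [hW]
  refine isClosed_iInter fun φ => isClosed_iInter fun h => isClosed_iInter fun i => isClosed_eq
    (continuous_const.inner (WithLp.fstL 2 ℝ (H D) (PiLp 2 fun _ : Fin d => H D)).continuous)
    (continuous_const.inner ?_).neg
  exact (PiLp.proj 2 (fun _ : Fin d => H D) i : _ →L[ℝ] H D).continuous.comp
    (WithLp.sndL 2 ℝ (H D) (PiLp 2 fun _ : Fin d => H D)).continuous

theorem pderiv_eq_zero_of_notMem_tsupport {φ : E d → ℝ} {x : E d} (hx : x ∉ tsupport φ)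
    (i : Fin d) : pderiv φ i x = 0 := by
  rw [pderiv, Function.notMem_support.1 fun h => hx (support_fderiv_subset ℝ h),
    zero_apply]

theorem integral_mul_pderiv {φ η : E d → ℝ} (hφ : IsTestFunction D .dirichlet φ)
    (hη : ContDiff ℝ ∞ η) (i : Fin d) :
    ∫ x in D.region, φ x * pderiv η i x = - ∫ x in D.region, pderiv φ i x * η x := by
  obtain ⟨hφ, hc, hs⟩ := hφ
  have hc' : HasCompactSupport (pderiv φ i) :=
    hc.mono' fun x hx => not_imp_comm.1 (pderiv_eq_zero_of_notMem_tsupport · i) hx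
  rw [setIntegral_eq_integral_of_forall_compl_eq_zero fun x hx => by
      rw [image_eq_zero_of_notMem_tsupport fun h => hx (hs h), zero_mul],
    setIntegral_eq_integral_of_forall_compl_eq_zero fun x hx => by
      rw [pderiv_eq_zero_of_notMem_tsupport (fun h => hx (hs h)), zero_mul]]
  exact integral_mul_fderiv_eq_neg_fderiv_mul_of_integrable
    (((continuous_pderiv hφ i).mul hη.continuous).integrable_of_hasCompactSupport hc'.mul_right)
    ((hφ.continuous.mul (continuous_pderiv hη i)).integrable_of_hasCompactSupport hc.mul_right)
    ((hφ.continuous.mul hη.continuous).integrable_of_hasCompactSupport hc.mul_right)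
    (fun x _ => (hφ.differentiable (by simp)) x) (fun x _ => (hη.differentiable (by simp)) x)

theorem W012_le_W12 (D : Domain d) (bc : BoundaryCondition) : W012 D ≤ W12 D bc := by
  refine Submodule.topologicalClosure_minimal _ (Submodule.span_le.2 ?_) (isClosed_W12 D bc)
  rintro p ⟨φ, hφ, hfst, hsnd⟩ η hη i
  exact (integral_congr_ae (hfst.mul .rfl)).trans <|
    (integral_mul_pderiv hφ hη.contDiff i).trans <|
      congrArg Neg.neg (integral_congr_ae ((hsnd i).mul .rfl)).symm

theorem W012_le_VSub (D : Domain d) : ∀ bc, W012 D ≤ VSub D bc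
  | .dirichlet => le_rfl
  | .neumann => W012_le_W12 D _
  | .periodic => W012_le_W12 D _

/-- The vector with index `k` of the lattice of periods of the torus. -/
noncomputable def latticeVector (L : Fin d → ℝ) (k : Fin d → ℤ) : E d :=
  WithLp.toLp 2 fun n => (k n : ℝ) * L n

/-- The periodization of `φ`, the sum of its translates by the vectors of the lattice of periods. It
is `0` by convention where infinitely many translates are nonzero. -/
noncomputable def periodization (L : Fin d → ℝ) (φ : E d → ℝ) (x : E d) : ℝ :=
  ∑ᶠ k : Fin d → ℤ, φ (x + latticeVector L k)

theorem locallyFinite_support_translate {L : Fin d → ℝ} (hL : ∀ n, 0 < L n) {φ : E d → ℝ}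
    (hs : Function.support φ ⊆ (Domain.box L).region) :
    LocallyFinite fun k : Fin d → ℤ => Function.support fun x => φ (x + latticeVector L k) := by
  intro x
  have hfin : (Set.pi univ fun n : Fin d =>
      Icc ⌊(-x n - 1) / L n⌋ ⌈(L n - x n + 1) / L n⌉).Finite :=
    Set.Finite.pi fun n => finite_Icc _ _
  refine ⟨Metric.ball x 1, Metric.ball_mem_nhds x one_pos, hfin.subset ?_⟩
  rintro k ⟨z, hz, hzx⟩ n -
  have hreg := hs hz n
  simp only [latticeVector, PiLp.add_apply] at hreg
  have hdist : |z n - x n| < 1 :=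
    (PiLp.norm_apply_le (z - x) n).trans_lt (mem_ball_iff_norm.1 hzx)
  rw [abs_lt] at hdist
  have hlower : (-x n - 1) / L n ≤ k n := by
    rw [div_le_iff₀ (hL n)]; linarith [hreg.1]
  have hupper : (k n : ℝ) ≤ (L n - x n + 1) / L n := by
    rw [le_div_iff₀ (hL n)]; linarith [hreg.2]
  exact ⟨Int.cast_le.1 ((Int.floor_le _).trans hlower),
    Int.cast_le.1 (hupper.trans (Int.le_ceil _))⟩

theorem contDiff_periodization {L : Fin d → ℝ} (hL : ∀ n, 0 < L n) {φ : E d → ℝ}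
    (hφ : ContDiff ℝ ∞ φ) (hs : Function.support φ ⊆ (Domain.box L).region) :
    ContDiff ℝ ∞ (periodization L φ) :=
  contMDiff_iff_contDiff.1 <| contMDiff_finsum
    (fun _ => contMDiff_iff_contDiff.2 (hφ.comp (contDiff_id.add contDiff_const)))
    (locallyFinite_support_translate hL hs)

theorem periodization_add_single (L : Fin d → ℝ) (φ : E d → ℝ) (n : Fin d) (x : E d) :
    periodization L φ (x + EuclideanSpace.single n (L n)) = periodization L φ x := by
  refine finsum_eq_of_bijective (fun k : Fin d → ℤ => k + Pi.single n 1)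
    (Equiv.addRight (Pi.single n 1 : Fin d → ℤ)).bijective fun k => congrArg φ ?_
  ext m
  simp only [latticeVector, PiLp.add_apply, Pi.add_apply]
  rcases eq_or_ne m n with rfl | h
  · simp only [PiLp.single_apply, if_true, Pi.single_eq_same]
    push_cast
    ring
  · simp [h]

theorem periodization_eq {L : Fin d → ℝ} {φ : E d → ℝ}
    (hs : Function.support φ ⊆ (Domain.box L).region) {x : E d} (hx : x ∈ (Domain.box L).region) :
    periodization L φ x = φ x := by
  have hzero : ∀ k : Fin d → ℤ, k ≠ 0 → φ (x + latticeVector L k) = 0 := by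
    intro k hk
    by_contra h
    obtain ⟨n, hn⟩ := Function.ne_iff.1 hk
    have hreg := hs h n
    have hxn := hx n
    simp only [latticeVector, PiLp.add_apply] at hreg
    rcases lt_or_gt_of_ne hn with hneg | hpos
    · have : (k n : ℝ) ≤ -1 := by exact_mod_cast Int.le_sub_one_of_lt hneg
      nlinarith [hxn.1.trans hxn.2]
    · have : (1 : ℝ) ≤ k n := by exact_mod_cast hpos
      nlinarith [hxn.1.trans hxn.2]
  refine (finsum_eq_single _ 0 hzero).trans (congrArg φ ?_)
  ext n
  simp [latticeVector]

theorem W12_periodic_le {L : Fin d → ℝ} (hL : ∀ n, 0 < L n) :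
    W12 (.box L) .periodic ≤ W12 (.box L) .neumann := by
  intro p hp φ hφ i
  have hs : Function.support φ ⊆ (Domain.box L).region := (subset_tsupport φ).trans hφ.2.2
  have htest : IsTestFunction (.box L) .periodic (periodization L φ) := by
    refine ⟨contDiff_periodization hL hφ.contDiff hs, ?_⟩
    rintro v ⟨n, rfl⟩ x
    exact periodization_add_single L φ n x
  have heq : EqOn (periodization L φ) φ (Domain.box L).region := fun x hx => periodization_eq hs hx
  have hpderiv : EqOn (pderiv (periodization L φ) i) (pderiv φ i) (Domain.box L).region := by
    intro x hx
    rw [pderiv, pderiv, (heq.eventuallyEq_of_mem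
      ((Domain.box L).isOpen_region.mem_nhds hx)).fderiv_eq]
  have hmeas := (Domain.box L).measurableSet_region
  exact (setIntegral_congr_fun hmeas fun x hx => congrArg (p.fst x * ·) (hpderiv hx)).symm.trans <|
    (hp _ htest i).trans <| congrArg Neg.neg <|
      setIntegral_congr_fun hmeas fun x hx => congrArg (p.snd i x * ·) (heq hx)

theorem VSub_le_W12_neumann (hD : D.Admissible bc) : VSub D bc ≤ W12 D .neumann := by
  cases bc
  · exact W012_le_W12 D _
  · exact le_rfl
  · cases D with
    | box L => exact W12_periodic_le hD.2
    | triangle p => exact absurd rfl hD.2.2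

theorem V.isWeakGradient (hD : D.Admissible bc) (v : V D bc) :
    IsWeakGradient D .dirichlet (V.toH D bc v) (V.grad D bc v) :=
  VSub_le_W12_neumann hD v.2

theorem isClosed_VSub (D : Domain d) : ∀ bc, IsClosed (VSub D bc : Set (HGrad D))
  | .dirichlet => Submodule.isClosed_topologicalClosure _
  | .neumann => isClosed_W12 D _
  | .periodic => isClosed_W12 D _

instance (D : Domain d) (bc : BoundaryCondition) : CompleteSpace (V D bc) :=
  (isClosed_VSub D bc).completeSpace_coe

theorem H.eq_zero_of_integral_eq_zero {u : H D}
    (h : ∀ φ, IsTestFunction D .dirichlet φ → ∫ x in D.region, u x * φ x = 0) : u = 0 := by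
  have hint : IntegrableOn u D.region := (Lp.memLp u).integrable (by norm_num)
  have hae := D.isOpen_region.ae_eq_zero_of_integral_contDiff_smul_eq_zero (μ := volume)
    hint.locallyIntegrableOn fun φ hφ hc hs => by
      rw [← h φ ⟨hφ, hc, hs⟩, ← setIntegral_eq_integral_of_forall_compl_eq_zero
        fun x hx => by rw [image_eq_zero_of_notMem_tsupport fun h => hx (hs h), zero_smul]]
      simp only [smul_eq_mul, mul_comm]
  exact Lp.eq_zero_iff_ae_eq_zero.2 ((ae_restrict_iff' D.measurableSet_region).2 hae)

theorem V.toH_injective (hD : D.Admissible bc) : Function.Injective (V.toH D bc) := by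
  refine (injective_iff_map_eq_zero _).2 fun v hv => ?_
  have hgrad : V.grad D bc v = 0 := by
    ext1 i
    refine H.eq_zero_of_integral_eq_zero fun φ hφ => neg_eq_zero.1 ?_
    rw [← V.isWeakGradient hD v φ hφ i, hv]
    refine integral_eq_zero_of_ae ?_
    filter_upwards [Lp.coeFn_zero ℝ 2 (volume.restrict D.region)] with x hx
    exact mul_eq_zero_of_left hx _
  have hnorm := V.inner_eq D bc v v
  rw [hv, hgrad, inner_zero_left, inner_zero_left, add_zero] at hnorm
  exact inner_self_eq_zero.1 hnorm

theorem eq_zero_of_inner_toH_eq_zero {u : H D}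
    (h : ∀ v : V D bc, inner ℝ u (V.toH D bc v) = 0) : u = 0 := by
  refine H.eq_zero_of_integral_eq_zero fun φ hφ => ?_
  have hm := memLp_of_continuous D hφ.contDiff.continuous
  have hm' := fun i => memLp_of_continuous D (continuous_pderiv hφ.contDiff i)
  let p : HGrad D := WithLp.toLp 2 (hm.toLp φ, WithLp.toLp 2 fun i => (hm' i).toLp _)
  have hp : p ∈ W012 D := Submodule.le_topologicalClosure _ (Submodule.subset_span
    ⟨φ, hφ, hm.coeFn_toLp, fun i => (hm' i).coeFn_toLp⟩)
  rw [← inner_toLp_left hm u, real_inner_comm]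
  exact h ⟨p, W012_le_VSub D bc hp⟩

theorem DA.toH_injective (hD : D.Admissible bc) : Function.Injective (DA.toH D bc) := by
  refine (injective_iff_map_eq_zero _).2 fun z hz => ?_
  obtain ⟨v, hv, hinner⟩ := z.2
  have hv0 : v = 0 := V.toH_injective hD (by rw [map_zero]; exact hv.trans hz)
  have hA : DA.A D bc z = 0 := eq_zero_of_inner_toH_eq_zero (bc := bc) fun w => by
    rw [← inner_zero_left (𝕜 := ℝ) w, ← hv0]
    exact (hinner w).symm
  rw [← norm_eq_zero, DA.norm_eq, hA, norm_zero]

/-- The inclusion of `D(A)` in `V`. It is encoded as `z ↦ ι* (A z)`, where `ι : V → H` is the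
inclusion, because `(z, w)_V = (A z, w)_H` for all `w ∈ V`. -/
noncomputable def DA.toV (D : Domain d) (bc : BoundaryCondition) : DA D bc →L[ℝ] V D bc :=
  (ContinuousLinearMap.adjoint (V.toH D bc)).comp (DA.A D bc)

theorem DA.inner_toV (z : DA D bc) (w : V D bc) :
    inner ℝ (DA.toV D bc z) w = inner ℝ (DA.A D bc z) (V.toH D bc w) :=
  ContinuousLinearMap.adjoint_inner_left (V.toH D bc) w (DA.A D bc z)

theorem DA.toH_toV (z : DA D bc) : V.toH D bc (DA.toV D bc z) = DA.toH D bc z := by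
  obtain ⟨v, hv, hinner⟩ := z.2
  have hzv : DA.toV D bc z = v := ext_inner_right ℝ fun w => by
    rw [DA.inner_toV]; exact (hinner w).symm
  exact (congrArg _ hzv).trans hv

theorem V.norm_toH_le (v : V D bc) : ‖V.toH D bc v‖ ≤ ‖v‖ :=
  WithLp.norm_fst_le (H D) v.1

theorem DA.norm_toV_sq_le (z : DA D bc) :
    ‖DA.toV D bc z‖ ^ 2 ≤ ‖DA.A D bc z‖ * ‖DA.toH D bc z‖ := by
  rw [← real_inner_self_eq_norm_sq, DA.inner_toV, DA.toH_toV]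
  exact real_inner_le_norm _ _

theorem DA.norm_toV_le (z : DA D bc) : ‖DA.toV D bc z‖ ≤ ‖DA.A D bc z‖ := by
  by_contra! h
  nlinarith [DA.norm_toV_sq_le z, DA.toH_toV z ▸ V.norm_toH_le (DA.toV D bc z),
    norm_nonneg (DA.A D bc z), norm_nonneg (DA.toH D bc z)]

theorem DA.norm_toH_le (z : DA D bc) : ‖DA.toH D bc z‖ ≤ ‖DA.A D bc z‖ := by
  rw [← DA.toH_toV]
  exact (V.norm_toH_le _).trans (DA.norm_toV_le z)

end Sobolev

section Truncation

/-- A smooth function of `y`, at scale `ε > 0`: it vanishes for `y ≤ ε`, is the identity for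
`2 ε ≤ y`, and its derivative is bounded uniformly in `ε`. -/
noncomputable def truncation (ε y : ℝ) : ℝ := y * Real.smoothTransition (ε⁻¹ * y - 1)

theorem contDiff_truncation (ε : ℝ) : ContDiff ℝ ∞ (truncation ε) :=
  contDiff_id.mul (Real.smoothTransition.contDiff.comp
    ((contDiff_const.mul contDiff_id).sub contDiff_const))

theorem truncation_of_le {ε y : ℝ} (hε : 0 < ε) (h : y ≤ ε) : truncation ε y = 0 := by
  have : ε⁻¹ * y ≤ 1 := (inv_mul_le_one₀ hε).2 h
  rw [truncation, Real.smoothTransition.zero_of_nonpos (by linarith), mul_zero]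

theorem truncation_of_two_mul_le {ε y : ℝ} (hε : 0 < ε) (h : 2 * ε ≤ y) : truncation ε y = y := by
  have : 2 ≤ ε⁻¹ * y := (le_inv_mul_iff₀' hε).2 h
  rw [truncation, Real.smoothTransition.one_of_one_le (by linarith), mul_one]

theorem truncation_eventuallyEq {ε y : ℝ} (hε : 0 < ε) (h : 2 * ε < y) :
    truncation ε =ᶠ[𝓝 y] id := by
  filter_upwards [lt_mem_nhds h] with z hz using truncation_of_two_mul_le hε hz.le

theorem abs_truncation_le (ε y : ℝ) : |truncation ε y| ≤ |y| := by
  rw [truncation, abs_mul, abs_of_nonneg (Real.smoothTransition.nonneg _)]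
  exact mul_le_of_le_one_right (abs_nonneg _) (Real.smoothTransition.le_one _)

theorem deriv_truncation {ε : ℝ} (hε : ε ≠ 0) (y : ℝ) :
    deriv (truncation ε) y = deriv (truncation 1) (ε⁻¹ * y) := by
  have hscale : truncation ε = fun y => ε * truncation 1 (ε⁻¹ * y) := by
    funext y
    simp only [truncation, inv_one, one_mul, mul_assoc, mul_inv_cancel_left₀ hε]
  rw [hscale, deriv_const_mul_field, deriv_comp_mul_left, smul_eq_mul, mul_inv_cancel_left₀ hε]

theorem exists_abs_deriv_truncation_le : ∃ C, ∀ ε > 0, ∀ y, |deriv (truncation ε) y| ≤ C := by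
  have hcont : Continuous (deriv (truncation 1)) :=
    (contDiff_truncation 1).continuous_deriv (by simp)
  obtain ⟨C, hC⟩ := isCompact_Icc.exists_bound_of_continuousOn (s := Icc (1 : ℝ) 2)
    hcont.continuousOn
  refine ⟨max C 1, fun ε hε y => ?_⟩
  rw [deriv_truncation hε.ne']
  rcases lt_or_ge (ε⁻¹ * y) 1 with hlt | hge
  · have hzero : truncation 1 =ᶠ[𝓝 (ε⁻¹ * y)] fun _ => 0 := by
      filter_upwards [gt_mem_nhds hlt] with z hz using truncation_of_le one_pos hz.le
    simp [hzero.deriv_eq]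
  rcases le_or_gt (ε⁻¹ * y) 2 with hle | hgt
  · exact (hC _ ⟨hge, hle⟩).trans (le_max_left _ _)
  · have hid := truncation_eventuallyEq one_pos (show 2 * 1 < ε⁻¹ * y by linarith)
    rw [hid.deriv_eq, deriv_id, abs_one]
    exact le_max_right _ _

end Truncation

section Cutoff

variable {d : ℕ} {D : Domain d} {bc : BoundaryCondition}

theorem contDiff_pderiv {φ : E d → ℝ} (hφ : ContDiff ℝ ∞ φ) (i : Fin d) :
    ContDiff ℝ ∞ (pderiv φ i) :=
  (hφ.fderiv_right (m := ∞) (by simp)).clm_apply contDiff_const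

theorem pderiv_mul {f g : E d → ℝ} (hf : ContDiff ℝ ∞ f) (hg : ContDiff ℝ ∞ g) (i : Fin d)
    (x : E d) : pderiv (fun x => f x * g x) i x = f x * pderiv g i x + g x * pderiv f i x := by
  simp [pderiv, fderiv_fun_mul (hf.differentiable (by simp) x) (hg.differentiable (by simp) x)]

theorem pderiv_comp {f : ℝ → ℝ} {g : E d → ℝ} (hf : Differentiable ℝ f) (hg : Differentiable ℝ g)
    (i : Fin d) (x : E d) : pderiv (fun x => f (g x)) i x = deriv f (g x) * pderiv g i x := by
  change fderiv ℝ (f ∘ g) x _ = _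
  rw [((hf _).hasDerivAt.comp_hasFDerivAt x (hg x).hasFDerivAt).fderiv]
  rfl

/-- `S` is a smooth function which is positive on the open subset `B` of `Ω` and vanishes on its
boundary. -/
structure IsBoundaryWeight (D : Domain d) (B : Set (E d)) (S : E d → ℝ) : Prop where
  isOpen : IsOpen B
  subset : B ⊆ D.region
  contDiff : ContDiff ℝ ∞ S
  pos : ∀ x ∈ B, 0 < S x
  eq_zero : ∀ x ∈ closure B, x ∉ B → S x = 0

/-- The approximation of `1_B S` by functions that vanish near the boundary of `B`. -/
noncomputable def cutoff (B : Set (E d)) (S : E d → ℝ) (ε : ℝ) : E d → ℝ :=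
  B.indicator fun x => truncation ε (S x)

namespace IsBoundaryWeight

variable {B : Set (E d)} {S κ : E d → ℝ} {ε : ℝ}

theorem tsupport_cutoff_subset (hS : IsBoundaryWeight D B S) (hε : 0 < ε) :
    tsupport (cutoff B S ε) ⊆ B := by
  have hclosed : IsClosed (closure B ∩ {x | ε ≤ S x}) :=
    isClosed_closure.inter (isClosed_le continuous_const hS.contDiff.continuous)
  have hsub : tsupport (cutoff B S ε) ⊆ closure B ∩ {x | ε ≤ S x} := by
    refine closure_minimal (fun x hx => ?_) hclosed
    obtain ⟨hxB, hx⟩ := indicator_apply_ne_zero.1 hx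
    exact ⟨subset_closure hxB, not_lt.1 fun h => hx (truncation_of_le hε h.le)⟩
  intro x hx
  by_contra hxB
  have hSx : ε ≤ S x := (hsub hx).2
  rw [hS.eq_zero x (hsub hx).1 hxB] at hSx
  exact hSx.not_gt hε

theorem cutoff_eventuallyEq (hS : IsBoundaryWeight D B S) {x : E d} (hx : x ∈ B) :
    cutoff B S ε =ᶠ[𝓝 x] fun x => truncation ε (S x) := by
  filter_upwards [hS.isOpen.mem_nhds hx] with z hz using indicator_of_mem hz _

theorem contDiff_cutoff (hS : IsBoundaryWeight D B S) (hε : 0 < ε) :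
    ContDiff ℝ ∞ (cutoff B S ε) :=
  contDiff_iff_contDiffAt.2 fun x => by
    by_cases hx : x ∈ tsupport (cutoff B S ε)
    · exact ((contDiff_truncation ε).comp hS.contDiff).contDiffAt.congr_of_eventuallyEq
        (hS.cutoff_eventuallyEq (hS.tsupport_cutoff_subset hε hx))
    · exact contDiffAt_const.congr_of_eventuallyEq (notMem_tsupport_iff_eventuallyEq.1 hx)

theorem pderiv_cutoff (hS : IsBoundaryWeight D B S) (hε : 0 < ε) (i : Fin d) :
    pderiv (cutoff B S ε) i = B.indicator fun x => deriv (truncation ε) (S x) * pderiv S i x := by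
  funext x
  by_cases hx : x ∈ B
  · rw [indicator_of_mem hx, pderiv, (hS.cutoff_eventuallyEq hx).fderiv_eq]
    exact pderiv_comp ((contDiff_truncation ε).differentiable (by simp))
      (hS.contDiff.differentiable (by simp)) i x
  · rw [indicator_of_notMem hx]
    exact pderiv_eq_zero_of_notMem_tsupport (fun h => hx (hS.tsupport_cutoff_subset hε h)) i

theorem isTestFunction_cutoff_mul (hS : IsBoundaryWeight D B S) (hκ : ContDiff ℝ ∞ κ)
    (hε : 0 < ε) : IsTestFunction D .dirichlet fun x => cutoff B S ε x * κ x := by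
  have hsub : tsupport (cutoff B S ε) ⊆ D.region :=
    (hS.tsupport_cutoff_subset hε).trans hS.subset
  have hcomp : HasCompactSupport (cutoff B S ε) :=
    Metric.isCompact_of_isClosed_isBounded (isClosed_tsupport _) (D.isBounded_region.subset hsub)
  exact ⟨(hS.contDiff_cutoff hε).mul hκ, hcomp.mul_right, tsupport_mul_subset_left.trans hsub⟩

theorem eventually_cutoff_mul_eq (hS : IsBoundaryWeight D B S) (x : E d) :
    ∀ᶠ ε in 𝓝[>] 0, cutoff B S ε x * κ x = B.indicator (fun x => S x * κ x) x := by
  by_cases hx : x ∈ B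
  · filter_upwards [Ioo_mem_nhdsGT (half_pos (hS.pos x hx))] with ε hε
    rw [cutoff, indicator_of_mem hx, indicator_of_mem hx,
      truncation_of_two_mul_le hε.1 (by linarith [hε.2])]
  · simp [cutoff, hx]

theorem eventually_pderiv_cutoff_mul_eq (hS : IsBoundaryWeight D B S) (hκ : ContDiff ℝ ∞ κ)
    (i : Fin d) (x : E d) :
    ∀ᶠ ε in 𝓝[>] 0, pderiv (fun x => cutoff B S ε x * κ x) i x
      = B.indicator (pderiv (fun x => S x * κ x) i) x := by
  by_cases hx : x ∈ B
  · filter_upwards [Ioo_mem_nhdsGT (half_pos (hS.pos x hx))] with ε hε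
    have htrunc := truncation_eventuallyEq hε.1 (show 2 * ε < S x by linarith [hε.2])
    rw [pderiv_mul (hS.contDiff_cutoff hε.1) hκ, hS.pderiv_cutoff hε.1, cutoff,
      indicator_of_mem hx, indicator_of_mem hx, indicator_of_mem hx, htrunc.eq_of_nhds,
      htrunc.deriv_eq, deriv_id, pderiv_mul hS.contDiff hκ, id_eq, one_mul]
  · filter_upwards [self_mem_nhdsWithin] with ε hε
    rw [pderiv_mul (hS.contDiff_cutoff hε) hκ, hS.pderiv_cutoff hε, cutoff]
    simp [hx]

theorem abs_cutoff_mul_le (B : Set (E d)) (S κ : E d → ℝ) (ε : ℝ) (x : E d) :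
    |cutoff B S ε x * κ x| ≤ |S x * κ x| := by
  by_cases hx : x ∈ B
  · rw [cutoff, indicator_of_mem hx, abs_mul, abs_mul]
    exact mul_le_mul_of_nonneg_right (abs_truncation_le _ _) (abs_nonneg _)
  · simpa [cutoff, hx] using mul_nonneg (abs_nonneg (S x)) (abs_nonneg (κ x))

theorem abs_pderiv_cutoff_mul_le (hS : IsBoundaryWeight D B S) (hκ : ContDiff ℝ ∞ κ) {C : ℝ}
    (hC : ∀ ε > 0, ∀ y, |deriv (truncation ε) y| ≤ C) (hε : 0 < ε) (i : Fin d) (x : E d) :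
    |pderiv (fun x => cutoff B S ε x * κ x) i x|
      ≤ |S x * pderiv κ i x| + C * |κ x * pderiv S i x| := by
  have hC0 : 0 ≤ C := (abs_nonneg _).trans (hC ε hε 0)
  rw [pderiv_mul (hS.contDiff_cutoff hε) hκ, hS.pderiv_cutoff hε]
  refine (abs_add_le _ _).trans (add_le_add (abs_cutoff_mul_le B S _ ε x) ?_)
  by_cases hx : x ∈ B
  · rw [indicator_of_mem hx, mul_left_comm, abs_mul]
    exact mul_le_mul_of_nonneg_right (hC ε hε _) (abs_nonneg _)
  · rw [indicator_of_notMem hx, mul_zero, abs_zero]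
    positivity

theorem tendsto_integral_mul_cutoff (hS : IsBoundaryWeight D B S) (hκ : ContDiff ℝ ∞ κ)
    (u : H D) :
    Tendsto (fun ε => ∫ x in D.region, u x * (cutoff B S ε x * κ x)) (𝓝[>] 0)
      (𝓝 (∫ x in D.region, u x * B.indicator (fun x => S x * κ x) x)) := by
  have hbound := memLp_of_continuous D (hS.contDiff.mul hκ).continuous.abs
  refine tendsto_integral_filter_of_dominated_convergence _ ?_ ?_
    ((Lp.memLp u).norm.integrable_mul hbound) (Eventually.of_forall fun x =>
      tendsto_nhds_of_eventually_eq ((hS.eventually_cutoff_mul_eq x).mono fun ε h => by rw [h]))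
  · filter_upwards [self_mem_nhdsWithin] with ε hε
    exact (Lp.aestronglyMeasurable u).mul
      (hS.isTestFunction_cutoff_mul hκ hε).contDiff.continuous.aestronglyMeasurable
  · refine Eventually.of_forall fun ε => Eventually.of_forall fun x => ?_
    rw [norm_mul, Pi.mul_apply]
    exact mul_le_mul_of_nonneg_left (abs_cutoff_mul_le B S κ ε x) (norm_nonneg _)

theorem tendsto_integral_mul_pderiv_cutoff (hS : IsBoundaryWeight D B S) (hκ : ContDiff ℝ ∞ κ)
    (u : H D) (i : Fin d) :
    Tendsto (fun ε => ∫ x in D.region, u x * pderiv (fun x => cutoff B S ε x * κ x) i x) (𝓝[>] 0)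
      (𝓝 (∫ x in D.region, u x * B.indicator (pderiv (fun x => S x * κ x) i) x)) := by
  obtain ⟨C, hC⟩ := exists_abs_deriv_truncation_le
  have hbound := memLp_of_continuous D (φ := fun x => |S x * pderiv κ i x|
      + C * |κ x * pderiv S i x|)
    ((hS.contDiff.continuous.mul (continuous_pderiv hκ i)).abs.add
      (continuous_const.mul (hκ.continuous.mul (continuous_pderiv hS.contDiff i)).abs))
  refine tendsto_integral_filter_of_dominated_convergence _ ?_ ?_
    ((Lp.memLp u).norm.integrable_mul hbound) (Eventually.of_forall fun x =>
      tendsto_nhds_of_eventually_eq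
        ((hS.eventually_pderiv_cutoff_mul_eq hκ i x).mono fun ε h => by rw [h]))
  · filter_upwards [self_mem_nhdsWithin] with ε hε
    exact (Lp.aestronglyMeasurable u).mul (continuous_pderiv
      (hS.isTestFunction_cutoff_mul hκ hε).contDiff i).aestronglyMeasurable
  · filter_upwards [self_mem_nhdsWithin] with ε hε
    refine Eventually.of_forall fun x => ?_
    rw [norm_mul, Pi.mul_apply]
    exact mul_le_mul_of_nonneg_left (hS.abs_pderiv_cutoff_mul_le hκ hC hε i x) (norm_nonneg _)

theorem integral_mul_indicator_pderiv (hS : IsBoundaryWeight D B S) (hκ : ContDiff ℝ ∞ κ) {u : H D}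
    {G : Fin d → H D} (hu : IsWeakGradient D .dirichlet u G) (i : Fin d) :
    ∫ x in D.region, u x * B.indicator (pderiv (fun x => S x * κ x) i) x
      = - ∫ x in D.region, G i x * B.indicator (fun x => S x * κ x) x := by
  refine tendsto_nhds_unique (hS.tendsto_integral_mul_pderiv_cutoff hκ u i)
    ((hS.tendsto_integral_mul_cutoff hκ (G i)).neg.congr' ?_)
  filter_upwards [self_mem_nhdsWithin] with ε hε
  exact (hu _ (hS.isTestFunction_cutoff_mul hκ hε) i).symm

/-- The class in `H` of the function `1_B f`. -/
noncomputable def indicatorToH (hS : IsBoundaryWeight D B S) {f : E d → ℝ} (hf : Continuous f) :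
    H D :=
  ((memLp_of_continuous D hf).indicator hS.isOpen.measurableSet).toLp _

theorem indicatorToH_mem_W012 (hS : IsBoundaryWeight D B S) (hκ : ContDiff ℝ ∞ κ) :
    (WithLp.toLp 2 (hS.indicatorToH (hS.contDiff.mul hκ).continuous, WithLp.toLp 2 fun i =>
      hS.indicatorToH (continuous_pderiv (hS.contDiff.mul hκ) i)) : HGrad D) ∈ W012 D := by
  have : CompleteSpace (W012 D) := (Submodule.isClosed_topologicalClosure _).completeSpace_coe
  rw [← Submodule.orthogonal_orthogonal (W012 D), Submodule.mem_orthogonal']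
  intro q hq
  have hzero : ∀ ε > 0, (∫ x in D.region, q.fst x * (cutoff B S ε x * κ x))
      + ∑ i, ∫ x in D.region, q.snd i x * pderiv (fun x => cutoff B S ε x * κ x) i x = 0 := by
    intro ε hε
    have hψ := hS.isTestFunction_cutoff_mul hκ hε
    have hm := memLp_of_continuous D hψ.contDiff.continuous
    have hm' := fun i => memLp_of_continuous D (continuous_pderiv hψ.contDiff i)
    let p : HGrad D := WithLp.toLp 2 (hm.toLp _, WithLp.toLp 2 fun i => (hm' i).toLp _)
    have hp : p ∈ W012 D := Submodule.le_topologicalClosure _ (Submodule.subset_span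
      ⟨_, hψ, hm.coeFn_toLp, fun i => (hm' i).coeFn_toLp⟩)
    have horth := (Submodule.mem_orthogonal _ _).1 hq p hp
    simp only [WithLp.prod_inner_apply, PiLp.inner_apply, inner_toLp_left, p] at horth
    exact horth
  have hlim := (hS.tendsto_integral_mul_cutoff hκ q.fst).add (tendsto_finsetSum Finset.univ
    fun i _ => hS.tendsto_integral_mul_pderiv_cutoff hκ (q.snd i) i)
  have hlim0 := tendsto_nhds_unique hlim (tendsto_const_nhds.congr' (by
    filter_upwards [self_mem_nhdsWithin] with ε hε using (hzero ε hε).symm))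
  simp only [WithLp.prod_inner_apply, PiLp.inner_apply, indicatorToH, inner_toLp_left]
  exact hlim0

theorem exists_V (hS : IsBoundaryWeight D B S) (bc : BoundaryCondition) (hκ : ContDiff ℝ ∞ κ) :
    ∃ v : V D bc, V.toH D bc v = hS.indicatorToH (hS.contDiff.mul hκ).continuous ∧
      ∀ i, V.grad D bc v i = hS.indicatorToH (continuous_pderiv (hS.contDiff.mul hκ) i) :=
  ⟨⟨_, W012_le_VSub D bc (hS.indicatorToH_mem_W012 hκ)⟩, rfl, fun _ => rfl⟩

/- The partial derivatives `S (2 ∂ᵢS)` of `S²` are again of the form `S κ`, so that they can be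
integrated by parts without a boundary term. -/
theorem exists_DA (hS : IsBoundaryWeight D B S) (hD : D.Admissible bc) :
    ∃ z : DA D bc, DA.toH D bc z = hS.indicatorToH (hS.contDiff.mul hS.contDiff).continuous := by
  obtain ⟨v, hv, hgrad⟩ := hS.exists_V bc hS.contDiff
  have hκ : ∀ i, ContDiff ℝ ∞ fun x => 2 * pderiv S i x := fun i =>
    contDiff_const.mul (contDiff_pderiv hS.contDiff i)
  have hpderiv : ∀ i, pderiv (fun x => S x * S x) i = fun x => S x * (2 * pderiv S i x) := by
    intro i
    funext x
    rw [pderiv_mul hS.contDiff hS.contDiff]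
    ring
  let Lu : Fin d → H D := fun i =>
    hS.indicatorToH (continuous_pderiv (hS.contDiff.mul (hκ i)) i)
  refine ⟨⟨(V.toH D bc v, V.toH D bc v - ∑ i, Lu i), v, rfl, fun w => ?_⟩, hv⟩
  have hparts : ∀ i,
      inner ℝ (V.grad D bc v i) (V.grad D bc w i) = - inner ℝ (Lu i) (V.toH D bc w) := by
    intro i
    simp only [hgrad, Lu, indicatorToH, inner_toLp_left, hpderiv]
    exact (neg_eq_iff_eq_neg.2
      (hS.integral_mul_indicator_pderiv (hκ i) (V.isWeakGradient hD w) i)).symm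
  change _ = inner ℝ (V.toH D bc v - ∑ i, Lu i) (V.toH D bc w)
  rw [V.inner_eq, PiLp.inner_apply, Finset.sum_congr rfl fun i _ => hparts i, inner_sub_left,
    sum_inner, Finset.sum_neg_distrib]
  ring

end IsBoundaryWeight

/-- The product of sines in the definition of `bump`, without the indicator function of `ω`. -/
noncomputable def sineProduct (l : Fin d → ℝ) (z : E d) : ℝ :=
  ∏ n, Real.sin (Real.pi * ((z n + l n) / (2 * l n)))

theorem isOpen_omega (l : Fin d → ℝ) : IsOpen (omega l) := by
  have hcoord (n : Fin d) : Continuous fun x : E d => x n := by fun_prop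
  simp only [omega, ofPred_forall]
  exact isOpen_iInter_of_finite fun n =>
    (isOpen_lt continuous_const (hcoord n)).and (isOpen_lt (hcoord n) continuous_const)

theorem closure_omega_subset (l : Fin d → ℝ) :
    closure (omega l) ⊆ {z | ∀ n, -l n ≤ z n ∧ z n ≤ l n} := by
  have hcoord (n : Fin d) : Continuous fun x : E d => x n := by fun_prop
  refine closure_minimal (fun x hx n => ⟨(hx n).1.le, (hx n).2.le⟩) ?_
  simp only [ofPred_forall]
  exact isClosed_iInter fun n =>
    (isClosed_le continuous_const (hcoord n)).inter (isClosed_le (hcoord n) continuous_const)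

theorem contDiff_sineProduct (l : Fin d → ℝ) : ContDiff ℝ ∞ (sineProduct l) :=
  contDiff_prod fun _ _ => Real.contDiff_sin.comp (contDiff_const.mul
    (((contDiff_piLp_apply (p := 2)).add contDiff_const).div_const _))

theorem sineProduct_pos {l : Fin d → ℝ} {z : E d} (hz : z ∈ omega l) : 0 < sineProduct l z := by
  refine Finset.prod_pos fun n _ => ?_
  obtain ⟨hlower, hupper⟩ := hz n
  have hl : 0 < 2 * l n := by linarith
  have hlt : (z n + l n) / (2 * l n) < 1 := (div_lt_one hl).2 (by linarith)
  exact Real.sin_pos_of_pos_of_lt_pi (mul_pos Real.pi_pos (div_pos (by linarith) hl))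
    (mul_lt_of_lt_one_right Real.pi_pos hlt)

theorem sineProduct_eq_zero {l : Fin d → ℝ} (hl : ∀ n, 0 < l n) {z : E d}
    (hz : z ∈ closure (omega l)) (hz' : z ∉ omega l) : sineProduct l z = 0 := by
  obtain ⟨n, hn⟩ := not_forall.1 hz'
  obtain ⟨hlower, hupper⟩ := closure_omega_subset l hz n
  have hl0 : 2 * l n ≠ 0 := by linarith [hl n]
  refine Finset.prod_eq_zero (Finset.mem_univ n) ?_
  rcases hlower.lt_or_eq with hlt | heq
  · rw [le_antisymm hupper (not_lt.1 fun h => hn ⟨hlt, h⟩), ← two_mul, div_self hl0, mul_one,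
      Real.sin_pi]
  · simp [← heq]

theorem isBoundaryWeight_sineProduct {l : Fin d → ℝ} (hl : ∀ n, 0 < l n) {r : ℝ}
    {b : E d} (hB : {x | r • x + b ∈ omega l} ⊆ D.region) :
    IsBoundaryWeight D {x | r • x + b ∈ omega l} fun x => sineProduct l (r • x + b) where
  isOpen := (isOpen_omega l).preimage (f := fun x : E d => r • x + b) (by fun_prop)
  subset := hB
  contDiff := (contDiff_sineProduct l).comp ((contDiff_const_smul r).add contDiff_const)
  pos _ hx := sineProduct_pos hx
  eq_zero _ hx hx' := sineProduct_eq_zero hl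
    ((by fun_prop : Continuous fun x : E d => r • x + b).closure_preimage_subset _ hx) hx'

theorem exists_V_bump {l : Fin d → ℝ} (hl : ∀ n, 0 < l n) {r : ℝ}
    {b : E d} (hB : {x | r • x + b ∈ omega l} ⊆ D.region) (bc : BoundaryCondition) :
    ∃ v : V D bc, V.toH D bc v =ᵐ[volume.restrict D.region] fun x => bump l (r • x + b) := by
  obtain ⟨v, hv, -⟩ := (isBoundaryWeight_sineProduct hl hB).exists_V bc
    (contDiff_const (c := (1 : ℝ)))
  refine ⟨v, hv ▸ (MemLp.coeFn_toLp _).trans (Eventually.of_forall fun x => ?_)⟩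
  simp only [mul_one]
  rfl

theorem exists_DA_bump_sq {l : Fin d → ℝ} (hl : ∀ n, 0 < l n) {r : ℝ}
    {b : E d} (hB : {x | r • x + b ∈ omega l} ⊆ D.region) (hD : D.Admissible bc) :
    ∃ z : DA D bc,
      DA.toH D bc z =ᵐ[volume.restrict D.region] fun x => bump l (r • x + b) ^ 2 := by
  obtain ⟨z, hz⟩ := (isBoundaryWeight_sineProduct hl hB).exists_DA hD
  refine ⟨z, hz ▸ (MemLp.coeFn_toLp _).trans (Eventually.of_forall fun x => ?_)⟩
  by_cases hx : r • x + b ∈ omega l <;> simp [hx, bump, sineProduct, sq]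

end Cutoff

section Cells

variable {d : ℕ} {D : Domain d} {bc : BoundaryCondition}

section Triangle

variable (β : AffineBasis (Fin 3) ℝ (E d))

theorem mem_triangle_region_iff {x : E d} :
    x ∈ (Domain.triangle β).region ↔ ∀ i, 0 < β.coord i x := by
  rw [Domain.region, β.interior_convexHull, mem_ofPred_eq]

theorem coord_two_smul_sub (i j : Fin 3) (x : E d) :
    β.coord i ((2 : ℝ) • x - β j) = 2 * β.coord i x - if i = j then 1 else 0 := by
  have hline : (2 : ℝ) • x - β j = AffineMap.lineMap (β j) x (2 : ℝ) := by
    rw [AffineMap.lineMap_apply, vsub_eq_sub, vadd_eq_add, smul_sub, two_smul ℝ (β j)]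
    abel
  rw [hline, AffineMap.apply_lineMap, β.coord_apply, AffineMap.lineMap_apply, vsub_eq_sub,
    vadd_eq_add, smul_eq_mul]
  ring

theorem coord_sum_sub_two_smul (i : Fin 3) (x : E d) :
    β.coord i (β 0 + β 1 + β 2 - (2 : ℝ) • x) = 1 - 2 * β.coord i x := by
  have hvadd : β 0 + β 1 + β 2 - (2 : ℝ) • x = ((β 0 -ᵥ x) + (β 1 -ᵥ x)) +ᵥ β 2 := by
    rw [vsub_eq_sub, vsub_eq_sub, vadd_eq_add, two_smul]
    abel
  rw [hvadd, AffineMap.map_vadd, map_add, AffineMap.linearMap_vsub, AffineMap.linearMap_vsub,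
    β.coord_apply, β.coord_apply, β.coord_apply]
  fin_cases i <;> simp <;> ring

theorem one_lt_two_mul_coord_iff {i : Fin 4} {x : E d}
    (hx : ∀ j, 0 < β.coord j x)
    (h : triangleUnscale β i x ∈ (Domain.triangle β).region) (j : Fin 3) :
    1 < 2 * β.coord j x ↔ j.val = i.val := by
  rw [mem_triangle_region_iff, triangleUnscale] at h
  split_ifs at h with hi
  · simp only [coord_two_smul_sub] at h
    have hcorner := h ⟨i, hi⟩
    rw [if_pos rfl] at hcorner
    by_cases hj : j = ⟨i, hi⟩
    · simpa [hj] using hcorner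
    · have hle := Finset.add_le_sum (fun m _ => (hx m).le) (Finset.mem_univ j)
        (Finset.mem_univ (⟨i, hi⟩ : Fin 3)) hj
      rw [β.sum_coord_apply_eq_one] at hle
      exact iff_of_false (by linarith) fun hval => hj (Fin.ext hval)
  · simp only [coord_sum_sub_two_smul] at h
    exact iff_of_false (by linarith [h j]) (by omega)

theorem mem_region_of_triangleUnscale_mem {i : Fin 4} {x : E d}
    (h : triangleUnscale β i x ∈ (Domain.triangle β).region) :
    x ∈ (Domain.triangle β).region := by
  rw [mem_triangle_region_iff] at h ⊢
  rw [triangleUnscale] at h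
  intro j
  split_ifs at h with hi
  · have hj := h j
    rw [coord_two_smul_sub] at hj
    split_ifs at hj <;> linarith
  · simp only [coord_sum_sub_two_smul] at h
    have hsum := β.sum_coord_apply_eq_one x
    rw [Fin.sum_univ_three] at hsum
    have h0 := h 0
    have h1 := h 1
    have h2 := h 2
    fin_cases j <;> simp only [Fin.zero_eta, Fin.mk_one, Fin.reduceFinMk] <;> linarith

theorem triangleUnscale_index_unique {i j : Fin 4} {x : E d}
    (hi : triangleUnscale β i x ∈ (Domain.triangle β).region)
    (hj : triangleUnscale β j x ∈ (Domain.triangle β).region) : i = j := by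
  have hx := (mem_triangle_region_iff β).1 (mem_region_of_triangleUnscale_mem β hi)
  have hval (m : Fin 3) : m.val = i.val ↔ m.val = j.val :=
    (one_lt_two_mul_coord_iff β hx hi m).symm.trans (one_lt_two_mul_coord_iff β hx hj m)
  have h0 := hval 0
  have h1 := hval 1
  have h2 := hval 2
  simp only [Fin.val_zero, Fin.val_one, Fin.val_two] at h0 h1 h2
  omega

theorem mem_region_of_foldl_triangleUnscale_mem (s : List (Fin 4)) {x : E d}
    (h : s.foldl (fun y i => triangleUnscale β i y) x ∈ (Domain.triangle β).region) :
    x ∈ (Domain.triangle β).region := by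
  induction s generalizing x with
  | nil => exact h
  | cons i s ih => exact mem_region_of_triangleUnscale_mem β (ih h)

theorem foldl_triangleUnscale_index_unique {s s' : List (Fin 4)} (hlength : s.length = s'.length)
    {x : E d} (h : s.foldl (fun y i => triangleUnscale β i y) x ∈ (Domain.triangle β).region)
    (h' : s'.foldl (fun y i => triangleUnscale β i y) x ∈ (Domain.triangle β).region) :
    s = s' := by
  induction s generalizing x s' with
  | nil => exact (List.length_eq_zero_iff.1 hlength.symm).symm
  | cons i s ih =>
    cases s' with
    | nil => simp at hlength
    | cons j s' =>
      obtain rfl := triangleUnscale_index_unique β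
        (mem_region_of_foldl_triangleUnscale_mem β s h)
        (mem_region_of_foldl_triangleUnscale_mem β s' h')
      rw [ih (Nat.succ.inj hlength) h h']

end Triangle

theorem exists_foldl_triangleUnscale_eq (p : Fin 3 → E d) (s : List (Fin 4)) :
    ∃ (r : ℝ) (b : E d), |r| = 2 ^ s.length ∧
      ∀ x, s.foldl (fun y i => triangleUnscale p i y) x = r • x + b := by
  induction s with
  | nil => exact ⟨1, 0, by simp, fun x => by simp⟩
  | cons i s ih =>
    obtain ⟨r, b, hr, h⟩ := ih
    by_cases hi : i.val < 3
    · refine ⟨r * 2, b - r • p ⟨i.val, hi⟩, by simp [abs_mul, hr, pow_succ], fun x => ?_⟩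
      rw [List.foldl_cons, h, triangleUnscale, dif_pos hi, smul_sub, smul_smul]
      abel
    · refine ⟨-(r * 2), b + r • (p 0 + p 1 + p 2), by simp [abs_mul, hr, pow_succ], fun x => ?_⟩
      rw [List.foldl_cons, h, triangleUnscale, dif_neg hi, smul_sub, smul_smul, neg_smul]
      abel

namespace Domain

theorem Admissible.exists_affineBasis {p : Fin 3 → E d} (hD : (Domain.triangle p).Admissible bc) :
    ∃ β : AffineBasis (Fin 3) ℝ (E d), ⇑β = p :=
  ⟨⟨p, hD.2.1, hD.2.1.affineSpan_eq_top_iff_card_eq_finrank_add_one.2 (by simp [hD.1])⟩, rfl⟩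

/-- The copy of `Ω` with index `k` in the subdivision of `Ω`. -/
def cell (D : Domain d) (M : ℕ) (k : D.Cell M) : Set (E d) :=
  {x | D.unscale M k x ∈ D.region}

theorem cell_subset (hD : D.Admissible bc) {M : ℕ} (k : D.Cell M) : D.cell M k ⊆ D.region := by
  cases D with
  | box L =>
    intro x hx n
    obtain ⟨hlower, hupper⟩ := hx n
    simp only [unscale] at hlower hupper
    have hk : ((k n : ℕ) : ℝ) + 1 ≤ M := by exact_mod_cast (k n).isLt
    have hk0 : (0 : ℝ) ≤ (k n : ℕ) := by positivity
    have hL := hD.2 n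
    have hpos : 0 < (M : ℝ) * x n := by nlinarith [mul_nonneg hk0 hL.le]
    have hlt : (M : ℝ) * x n < M * L n := by nlinarith [mul_le_mul_of_nonneg_right hk hL.le]
    exact ⟨pos_of_mul_pos_right hpos M.cast_nonneg, lt_of_mul_lt_mul_left hlt M.cast_nonneg⟩
  | triangle p =>
    obtain ⟨β, rfl⟩ := hD.exists_affineBasis
    exact fun x hx => mem_region_of_foldl_triangleUnscale_mem β _ hx

theorem cell_index_unique (hD : D.Admissible bc) {M : ℕ} {k k' : D.Cell M} {x : E d}
    (hk : x ∈ D.cell M k) (hk' : x ∈ D.cell M k') : k = k' := by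
  cases D with
  | box L =>
    funext n
    obtain ⟨hlower, hupper⟩ := hk n
    obtain ⟨hlower', hupper'⟩ := hk' n
    simp only [unscale] at hlower hupper hlower' hupper'
    have hL := hD.2 n
    rcases lt_trichotomy (k n) (k' n) with hlt | heq | hlt
    · have hle : ((k n : ℕ) : ℝ) + 1 ≤ (k' n : ℕ) := by exact_mod_cast hlt
      nlinarith [mul_le_mul_of_nonneg_right hle hL.le]
    · exact heq
    · have hle : ((k' n : ℕ) : ℝ) + 1 ≤ (k n : ℕ) := by exact_mod_cast hlt
      nlinarith [mul_le_mul_of_nonneg_right hle hL.le]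
  | triangle p =>
    obtain ⟨β, rfl⟩ := hD.exists_affineBasis
    exact List.ofFn_injective (foldl_triangleUnscale_index_unique β (by simp) hk hk')

/-- The common ratio of the homotheties of the copies of `Ω` onto `Ω`, up to the sign. -/
def ratio : Domain d → ℕ → ℝ
  | .box _, M => M
  | .triangle _, M => 2 ^ (M - 1)

theorem le_ratio (D : Domain d) (M : ℕ) : (M : ℝ) ≤ D.ratio M := by
  cases D with
  | box L => exact le_rfl
  | triangle p =>
    have hle : M ≤ 2 ^ (M - 1) := Nat.le_of_pred_lt (Nat.pred_eq_sub_one ▸ Nat.lt_two_pow_self)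
    change (M : ℝ) ≤ 2 ^ (M - 1)
    exact_mod_cast hle

theorem card_cell (hD : D.Admissible bc) (M : ℕ) :
    (Fintype.card (D.Cell M) : ℝ) = D.ratio M ^ d := by
  cases D with
  | box L =>
    have hcard : Fintype.card (Fin d → Fin M) = M ^ d := by simp
    change ((Fintype.card (Fin d → Fin M) : ℕ) : ℝ) = (M : ℝ) ^ d
    exact_mod_cast hcard
  | triangle p =>
    have hcard : Fintype.card (Fin (M - 1) → Fin 4) = (2 ^ (M - 1)) ^ 2 := by
      rw [← pow_mul, mul_comm, pow_mul]
      simp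
    obtain rfl := hD.1
    change ((Fintype.card (Fin (M - 1) → Fin 4) : ℕ) : ℝ) = ((2 : ℝ) ^ (M - 1)) ^ 2
    exact_mod_cast hcard

theorem exists_unscale_eq (D : Domain d) (M : ℕ) (k : D.Cell M) :
    ∃ (r : ℝ) (b : E d), |r| = D.ratio M ∧ ∀ x, D.unscale M k x = r • x + b := by
  cases D with
  | box L =>
    refine ⟨M, WithLp.toLp 2 fun n => -((k n : ℕ) * L n), Nat.abs_cast M, fun x => ?_⟩
    ext n
    simp [unscale, sub_eq_add_neg]
  | triangle p =>
    obtain ⟨r, b, hr, h⟩ := exists_foldl_triangleUnscale_eq p (List.ofFn k)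
    exact ⟨r, b, by rw [hr, List.length_ofFn, ratio], h⟩

theorem convex_region (D : Domain d) : Convex ℝ D.region := by
  cases D with
  | box L =>
    intro x hx y hy a b ha hb hab n
    exact convex_Ioo 0 (L n) (hx n) (hy n) ha hb hab
  | triangle p => exact (convex_convexHull ℝ _).interior

end Domain

theorem volume_preimage_affine {r : ℝ} (hr : r ≠ 0) (b : E d) (s : Set (E d)) :
    volume {x : E d | r • x + b ∈ s} = ENNReal.ofReal (|r| ^ d)⁻¹ * volume s := by
  change volume ((r • ·) ⁻¹' ((· + b) ⁻¹' s)) = _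
  rw [Measure.addHaar_preimage_smul volume hr, measure_preimage_add_right]
  simp [abs_inv, abs_pow]

end Cells

section Poincare

variable {d : ℕ}

open scoped ENNReal

theorem sq_lintegral_le {α : Type*} [MeasurableSpace α] (ν : Measure α) {f : α → ℝ≥0∞}
    (hf : AEMeasurable f ν) : (∫⁻ a, f a ∂ν) ^ 2 ≤ ν univ * ∫⁻ a, f a ^ 2 ∂ν := by
  have holder := ENNReal.lintegral_mul_le_Lp_mul_Lq ν Real.HolderConjugate.two_two hf
    (aemeasurable_const (b := (1 : ℝ≥0∞)))
  simp only [Pi.mul_apply, mul_one, ENNReal.one_rpow, lintegral_const, one_mul] at holder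
  calc (∫⁻ a, f a ∂ν) ^ 2
      ≤ ((∫⁻ a, f a ^ (2 : ℝ) ∂ν) ^ (1 / 2 : ℝ) * ν univ ^ (1 / 2 : ℝ)) ^ 2 := by gcongr
    _ = ν univ * ∫⁻ a, f a ^ 2 ∂ν := by
      rw [mul_pow, ← ENNReal.rpow_natCast, ← ENNReal.rpow_natCast, ← ENNReal.rpow_mul,
        ← ENNReal.rpow_mul, mul_comm]
      norm_num

theorem enorm_integral_mul_sq_le {α : Type*} [MeasurableSpace α] (ν : Measure α) {g w : α → ℝ}
    (hg : AEMeasurable g ν) (hw : Measurable w) (hw0 : ∀ a, 0 ≤ w a)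
    (hw1 : ∫⁻ a, ENNReal.ofReal (w a) ∂ν ≤ 1) :
    ‖∫ a, g a * w a ∂ν‖ₑ ^ 2 ≤ ∫⁻ a, ENNReal.ofReal (w a) * ‖g a‖ₑ ^ 2 ∂ν := by
  have hdensity := hw.ennreal_ofReal.aemeasurable (μ := ν)
  have hCS := sq_lintegral_le _ (hg.enorm.mono_ac (withDensity_absolutelyContinuous ν
    fun a => ENNReal.ofReal (w a)))
  rw [lintegral_withDensity_eq_lintegral_mul₀ hdensity hg.enorm,
    lintegral_withDensity_eq_lintegral_mul₀ hdensity (hg.enorm.pow_const 2),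
    withDensity_apply _ MeasurableSet.univ, Measure.restrict_univ] at hCS
  calc ‖∫ a, g a * w a ∂ν‖ₑ ^ 2
      ≤ (∫⁻ a, ‖g a * w a‖ₑ ∂ν) ^ 2 := by
        gcongr
        exact enorm_integral_le_lintegral_enorm _
    _ = (∫⁻ a, ENNReal.ofReal (w a) * ‖g a‖ₑ ∂ν) ^ 2 := by
        simp only [enorm_mul, Real.enorm_eq_ofReal (hw0 _), mul_comm]
    _ ≤ (∫⁻ a, ENNReal.ofReal (w a) ∂ν) * ∫⁻ a, ENNReal.ofReal (w a) * ‖g a‖ₑ ^ 2 ∂ν := hCS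
    _ ≤ ∫⁻ a, ENNReal.ofReal (w a) * ‖g a‖ₑ ^ 2 ∂ν := mul_le_of_le_one_left' hw1

/-- The square of the Euclidean norm of the gradient. -/
noncomputable def gradSq (v : E d → ℝ) (x : E d) : ℝ := ∑ i, pderiv v i x ^ 2

theorem gradSq_nonneg (v : E d → ℝ) (x : E d) : 0 ≤ gradSq v x :=
  Finset.sum_nonneg fun _ _ => sq_nonneg _

theorem continuous_gradSq {v : E d → ℝ} (hv : ContDiff ℝ ∞ v) : Continuous (gradSq v) :=
  continuous_finsetSum _ fun i _ => (continuous_pderiv hv i).pow 2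

theorem fderiv_apply_sq_le (v : E d → ℝ) (x h : E d) :
    (fderiv ℝ v x h) ^ 2 ≤ ‖h‖ ^ 2 * gradSq v x := by
  have hsum : fderiv ℝ v x h = ∑ i, h i * pderiv v i x := by
    conv_lhs => rw [← (EuclideanSpace.basisFun (Fin d) ℝ).sum_repr h]
    simp [pderiv]
  rw [hsum, EuclideanSpace.norm_sq_eq, gradSq]
  simp only [Real.norm_eq_abs, sq_abs]
  exact Finset.sum_mul_sq_le_sq_mul_sq _ _ _

theorem sub_eq_integral_fderiv_segment {v : E d → ℝ} (hv : ContDiff ℝ ∞ v) (x y : E d) :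
    v x - v y = ∫ s in Ioc (0 : ℝ) 1, fderiv ℝ v (y + s • (x - y)) (x - y) := by
  have hderiv (s : ℝ) : HasDerivAt (fun s : ℝ => v (y + s • (x - y)))
      (fderiv ℝ v (y + s • (x - y)) (x - y)) s := by
    have hline : HasDerivAt (fun s : ℝ => y + s • (x - y)) (x - y) s := by
      simpa using ((hasDerivAt_id s).smul_const (x - y)).const_add y
    exact (hv.differentiable (by simp) _).hasFDerivAt.comp_hasDerivAt s hline
  have hcont : Continuous fun s : ℝ => fderiv ℝ v (y + s • (x - y)) (x - y) :=
    ((hv.continuous_fderiv (by simp)).comp (by fun_prop)).clm_apply continuous_const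
  rw [← intervalIntegral.integral_of_le zero_le_one,
    intervalIntegral.integral_eq_sub_of_hasDerivAt (fun s _ => hderiv s)
      (hcont.intervalIntegrable _ _)]
  simp

theorem enorm_sub_sq_le {v : E d → ℝ} (hv : ContDiff ℝ ∞ v) {δ : ℝ} {x y : E d}
    (hxy : ‖x - y‖ ≤ δ) :
    ‖v x - v y‖ₑ ^ 2 ≤ ENNReal.ofReal (δ ^ 2)
      * ∫⁻ s in Ioc (0 : ℝ) 1, ENNReal.ofReal (gradSq v (y + s • (x - y))) := by
  have hcont : Continuous fun s : ℝ => fderiv ℝ v (y + s • (x - y)) (x - y) :=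
    ((hv.continuous_fderiv (by simp)).comp (by fun_prop)).clm_apply continuous_const
  rw [sub_eq_integral_fderiv_segment hv]
  calc ‖∫ s in Ioc (0 : ℝ) 1, fderiv ℝ v (y + s • (x - y)) (x - y)‖ₑ ^ 2
      ≤ (∫⁻ s in Ioc (0 : ℝ) 1, ‖fderiv ℝ v (y + s • (x - y)) (x - y)‖ₑ) ^ 2 := by
        gcongr
        exact enorm_integral_le_lintegral_enorm _
    _ ≤ (volume.restrict (Ioc (0 : ℝ) 1)) univ
          * ∫⁻ s in Ioc (0 : ℝ) 1, ‖fderiv ℝ v (y + s • (x - y)) (x - y)‖ₑ ^ 2 :=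
        sq_lintegral_le _ hcont.enorm.measurable.aemeasurable
    _ = ∫⁻ s in Ioc (0 : ℝ) 1, ‖fderiv ℝ v (y + s • (x - y)) (x - y)‖ₑ ^ 2 := by simp
    _ ≤ ∫⁻ s in Ioc (0 : ℝ) 1, ENNReal.ofReal (δ ^ 2)
          * ENNReal.ofReal (gradSq v (y + s • (x - y))) := by
        refine lintegral_mono fun s => ?_
        rw [← ENNReal.ofReal_mul (sq_nonneg δ), Real.enorm_eq_ofReal_abs,
          ← ENNReal.ofReal_pow (abs_nonneg _), sq_abs]
        refine ENNReal.ofReal_le_ofReal ((fderiv_apply_sq_le _ _ _).trans ?_)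
        gcongr
        exact gradSq_nonneg _ _
    _ = _ := lintegral_const_mul _
        (((continuous_gradSq hv).comp (by fun_prop)).measurable.ennreal_ofReal)

theorem lintegral_comp_affine {s : ℝ} (hs : s ≠ 0) (b : E d) {F : E d → ℝ≥0∞}
    (hF : Measurable F) :
    ∫⁻ x, F (s • x + b) = ENNReal.ofReal (|s| ^ d)⁻¹ * ∫⁻ x, F x := by
  have hmap : ∫⁻ x, F (s • x + b) = ∫⁻ z, F (z + b) ∂(Measure.map (s • ·) volume) :=
    (lintegral_map (hF.comp (measurable_add_const b)) (measurable_const_smul s)).symm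
  rw [hmap, Measure.map_addHaar_smul volume hs, lintegral_smul_measure,
    lintegral_add_right_eq_self (fun x => F x) b]
  simp [abs_inv, abs_pow]

section Segments

variable {K : Set (E d)} (hK : Convex ℝ K) (hKm : MeasurableSet K) {F : E d → ℝ≥0∞}
  (hF : Measurable F)

include hK hKm hF

theorem setLIntegral_contraction_le {s : ℝ} (hs : 1 / 2 ≤ s) (hs1 : s ≤ 1) {y : E d}
    (hy : y ∈ K) :
    ∫⁻ x in K, F (y + s • (x - y)) ≤ 2 ^ d * ∫⁻ x in K, F x := by
  have hs0 : 0 < s := by linarith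
  have hinv : s⁻¹ ≤ 2 := by
    rw [inv_le_comm₀ hs0 two_pos]
    linarith
  rw [← lintegral_indicator hKm, ← lintegral_indicator hKm]
  calc ∫⁻ x, K.indicator (fun x => F (y + s • (x - y))) x
      ≤ ∫⁻ x, K.indicator F (s • x + (1 - s) • y) := by
        refine lintegral_mono fun x => ?_
        by_cases hx : x ∈ K
        · rw [indicator_of_mem hx, indicator_of_mem (hK hx hy hs0.le (by linarith) (by ring))]
          exact le_of_eq (congrArg F (by module))
        · rw [indicator_of_notMem hx]
          exact zero_le
    _ = ENNReal.ofReal (|s| ^ d)⁻¹ * ∫⁻ x, K.indicator F x :=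
        lintegral_comp_affine hs0.ne' _ (hF.indicator hKm)
    _ ≤ 2 ^ d * ∫⁻ x, K.indicator F x := by
        gcongr
        rw [abs_of_pos hs0, ← inv_pow, ENNReal.ofReal_pow (by positivity)]
        gcongr
        rw [← ENNReal.ofReal_ofNat 2]
        exact ENNReal.ofReal_le_ofReal hinv

/- The map `x ↦ y + s (x - y)` is not far from an isometry for `s ≥ 1/2`, and so is the map
`y ↦ y + s (x - y)` for `s ≤ 1/2`. -/
theorem lintegral_lintegral_segment_le {s : ℝ} (hs : 0 ≤ s) (hs1 : s ≤ 1) :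
    ∫⁻ x in K, ∫⁻ y in K, F (y + s • (x - y)) ≤ 2 ^ d * volume K * ∫⁻ x in K, F x := by
  have hm : Measurable (Function.uncurry fun x y : E d => F (y + s • (x - y))) :=
    hF.comp (by fun_prop)
  have hconst : ∫⁻ _ in K, (2 ^ d * ∫⁻ x in K, F x) = 2 ^ d * volume K * ∫⁻ x in K, F x := by
    rw [lintegral_const, Measure.restrict_apply_univ]
    ring
  rw [← hconst]
  rcases le_total (1 / 2) s with h | h
  · rw [lintegral_lintegral_swap hm.aemeasurable]
    exact setLIntegral_mono' hKm fun y hy => setLIntegral_contraction_le hK hKm hF h hs1 hy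
  · refine setLIntegral_mono' hKm fun x hx => le_trans (le_of_eq ?_)
      (setLIntegral_contraction_le hK hKm hF (s := 1 - s) (by linarith) (by linarith) hx)
    refine lintegral_congr fun y => congrArg F ?_
    module

theorem lintegral_lintegral_lintegral_segment_le :
    ∫⁻ x in K, ∫⁻ y in K, ∫⁻ s in Ioc (0 : ℝ) 1, F (y + s • (x - y))
      ≤ 2 ^ d * volume K * ∫⁻ x in K, F x := by
  have hswap (x : E d) : ∫⁻ y in K, ∫⁻ s in Ioc (0 : ℝ) 1, F (y + s • (x - y))
      = ∫⁻ s in Ioc (0 : ℝ) 1, ∫⁻ y in K, F (y + s • (x - y)) := by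
    have hm : Measurable (Function.uncurry fun (y : E d) (s : ℝ) => F (y + s • (x - y))) :=
      hF.comp (by fun_prop)
    exact lintegral_lintegral_swap hm.aemeasurable
  have hm : Measurable (Function.uncurry fun (x : E d) (s : ℝ) =>
      ∫⁻ y in K, F (y + s • (x - y))) :=
    Measurable.lintegral_prod_right'
      (f := fun q : (E d × ℝ) × E d => F (q.2 + q.1.2 • (q.1.1 - q.2))) (hF.comp (by fun_prop))
  calc ∫⁻ x in K, ∫⁻ y in K, ∫⁻ s in Ioc (0 : ℝ) 1, F (y + s • (x - y))
      = ∫⁻ s in Ioc (0 : ℝ) 1, ∫⁻ x in K, ∫⁻ y in K, F (y + s • (x - y)) := by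
        rw [lintegral_congr hswap, lintegral_lintegral_swap hm.aemeasurable]
    _ ≤ ∫⁻ _ in Ioc (0 : ℝ) 1, 2 ^ d * volume K * ∫⁻ x in K, F x :=
        setLIntegral_mono' measurableSet_Ioc fun s hs =>
          lintegral_lintegral_segment_le hK hKm hF hs.1.le hs.2
    _ = 2 ^ d * volume K * ∫⁻ x in K, F x := by
        rw [lintegral_const, Measure.restrict_apply_univ, Real.volume_Ioc]
        simp

end Segments

theorem lintegral_prod_enorm_sub_sq_le {K : Set (E d)} (hK : Convex ℝ K) (hKm : MeasurableSet K)
    {δ : ℝ} (hδ : ∀ x ∈ K, ∀ y ∈ K, ‖x - y‖ ≤ δ) {v : E d → ℝ} (hv : ContDiff ℝ ∞ v) :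
    ∫⁻ q in K ×ˢ K, ‖v q.1 - v q.2‖ₑ ^ 2
      ≤ ENNReal.ofReal (δ ^ 2) * (2 ^ d * volume K * ∫⁻ x in K, ENNReal.ofReal (gradSq v x)) := by
  have hm : Measurable fun q : E d × E d => ‖v q.1 - v q.2‖ₑ ^ 2 :=
    (((hv.continuous.comp continuous_fst).sub
      (hv.continuous.comp continuous_snd)).enorm.measurable).pow_const 2
  calc ∫⁻ q in K ×ˢ K, ‖v q.1 - v q.2‖ₑ ^ 2
      = ∫⁻ x in K, ∫⁻ y in K, ‖v x - v y‖ₑ ^ 2 := setLIntegral_prod _ hm.aemeasurable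
    _ ≤ ∫⁻ x in K, ∫⁻ y in K, ENNReal.ofReal (δ ^ 2)
          * ∫⁻ s in Ioc (0 : ℝ) 1, ENNReal.ofReal (gradSq v (y + s • (x - y))) :=
        setLIntegral_mono' hKm fun x hx => setLIntegral_mono' hKm fun y hy =>
          enorm_sub_sq_le hv (hδ x hx y hy)
    _ = ENNReal.ofReal (δ ^ 2) * ∫⁻ x in K, ∫⁻ y in K, ∫⁻ s in Ioc (0 : ℝ) 1,
          ENNReal.ofReal (gradSq v (y + s • (x - y))) := by
        simp only [lintegral_const_mul' _ _ ENNReal.ofReal_ne_top]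
    _ ≤ _ := by
        gcongr
        exact lintegral_lintegral_lintegral_segment_le hK hKm
          (continuous_gradSq hv).measurable.ennreal_ofReal

/-- `G` is the weak gradient of `u` on the open set `U`. -/
def HasWeakGradientOn (U : Set (E d)) (u : E d → ℝ) (G : Fin d → E d → ℝ) : Prop :=
  ∀ φ : E d → ℝ, ContDiff ℝ ∞ φ → HasCompactSupport φ → tsupport φ ⊆ U → ∀ i,
    ∫ x in U, u x * pderiv φ i x = - ∫ x in U, G i x * φ x

/-- The mollification by `ρ` of the extension of `u` by zero outside of `U`. -/
noncomputable def mollify (ρ : ContDiffBump (0 : E d)) (U : Set (E d)) (u : E d → ℝ) : E d → ℝ :=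
  convolution (U.indicator u) (ρ.normed volume) (ContinuousLinearMap.lsmul ℝ ℝ).flip volume

theorem pderiv_comp_sub_left {f : E d → ℝ} (hf : Differentiable ℝ f) (i : Fin d) (x y : E d) :
    pderiv (fun y => f (x - y)) i y = - pderiv f i (x - y) := by
  have h : HasFDerivAt (fun y => f (x - y))
      ((fderiv ℝ f (x - y)).comp (-(ContinuousLinearMap.id ℝ (E d)))) y :=
    (hf _).hasFDerivAt.comp y ((hasFDerivAt_id y).const_sub x)
  rw [pderiv, h.fderiv]
  simp [pderiv]

section Mollify

variable (ρ : ContDiffBump (0 : E d)) {U : Set (E d)} (hU : MeasurableSet U) {u : E d → ℝ}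
  (hu : IntegrableOn u U)

theorem lintegral_ofReal_normed : ∫⁻ z, ENNReal.ofReal (ρ.normed volume z) = 1 := by
  rw [← ofReal_integral_eq_lintegral_ofReal ρ.integrable_normed
    (Eventually.of_forall ρ.nonneg_normed), ρ.integral_normed, ENNReal.ofReal_one]

include hU hu

theorem contDiff_mollify : ContDiff ℝ ∞ (mollify ρ U u) :=
  (ρ.hasCompactSupport_normed).contDiff_convolution_right _
    (hu.integrable_indicator hU).locallyIntegrable (ρ.contDiff_normed (n := ⊤))

theorem ae_tendsto_mollify {ι : Type*} {l : Filter ι} {ρ : ι → ContDiffBump (0 : E d)}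
    (hρ : Tendsto (fun n => (ρ n).rOut) l (𝓝 0)) {K : ℝ}
    (hρK : ∀ᶠ n in l, (ρ n).rOut ≤ K * (ρ n).rIn) :
    ∀ᵐ x ∂volume.restrict U, Tendsto (fun n => mollify (ρ n) U u x) l (𝓝 (u x)) := by
  have hae := ContDiffBump.ae_convolution_tendsto_right_of_locallyIntegrable hρ hρK
    (hu.integrable_indicator hU).locallyIntegrable
  filter_upwards [ae_restrict_of_ae hae, ae_restrict_mem hU] with x hx hxU
  rw [indicator_of_mem hxU] at hx
  exact hx.congr fun n => by rw [mollify, convolution_flip]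

theorem pderiv_mollify_eq_integral (i : Fin d) (x : E d) :
    pderiv (mollify ρ U u) i x = ∫ y in U, u y * pderiv (ρ.normed volume) i (x - y) := by
  have hρ : ContDiff ℝ ∞ (ρ.normed volume) := ρ.contDiff_normed (n := ⊤)
  have hcomp : HasCompactSupport (ρ.normed volume) := ρ.hasCompactSupport_normed
  have hloc : LocallyIntegrable (U.indicator u) := (hu.integrable_indicator hU).locallyIntegrable
  rw [pderiv, mollify, (hcomp.hasFDerivAt_convolution_right _ hloc (hρ.of_le (by simp)) x).fderiv,
    convolution_precompR_apply _ hloc (hcomp.fderiv ℝ) (hρ.continuous_fderiv (by simp)),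
    convolution_def, ← integral_indicator hU]
  refine integral_congr_ae (Eventually.of_forall fun y => ?_)
  by_cases hy : y ∈ U <;> simp [hy, pderiv, mul_comm]

variable {G : Fin d → E d → ℝ} (hG : HasWeakGradientOn U u G)

include hG

theorem pderiv_mollify {x : E d} (hx : Metric.closedBall x ρ.rOut ⊆ U) (i : Fin d) :
    pderiv (mollify ρ U u) i x = ∫ y in U, G i y * ρ.normed volume (x - y) := by
  have hρ : ContDiff ℝ ∞ (ρ.normed volume) := ρ.contDiff_normed (n := ⊤)
  have hsub : tsupport (fun y => ρ.normed volume (x - y)) ⊆ Metric.closedBall x ρ.rOut := by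
    refine closure_minimal (fun y hy => ?_) Metric.isClosed_closedBall
    have hmem : x - y ∈ Function.support (ρ.normed volume) := hy
    rw [ρ.support_normed_eq, mem_ball_zero_iff] at hmem
    rw [Metric.mem_closedBall, dist_comm, dist_eq_norm]
    exact hmem.le
  have hparts := hG _ (hρ.comp (contDiff_const.sub contDiff_id))
    ((isCompact_closedBall x ρ.rOut).of_isClosed_subset (isClosed_tsupport _) hsub)
    (hsub.trans hx) i
  simp only [Function.comp_def, id_eq, pderiv_comp_sub_left (hρ.differentiable (by simp)),
    mul_neg, integral_neg] at hparts
  rw [pderiv_mollify_eq_integral ρ hU hu, neg_injective hparts]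

omit hU hu hG in
theorem lintegral_lintegral_normed_mul {F : E d → ℝ≥0∞} (hF : AEMeasurable F (volume.restrict U)) :
    ∫⁻ x, ∫⁻ y in U, ENNReal.ofReal (ρ.normed volume (x - y)) * F y = ∫⁻ y in U, F y := by
  have hsub : Continuous fun q : E d × E d => ρ.normed volume (q.1 - q.2) :=
    ρ.continuous_normed.comp (by fun_prop)
  rw [lintegral_lintegral_swap (hsub.measurable.ennreal_ofReal.aemeasurable.mul
    (hF.comp_quasiMeasurePreserving Measure.quasiMeasurePreserving_snd))]
  refine lintegral_congr fun y => ?_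
  have hnormed : Measurable fun x => ENNReal.ofReal (ρ.normed volume (x - y)) :=
    (ρ.continuous_normed.comp (by fun_prop : Continuous fun x => x - y)).measurable.ennreal_ofReal
  rw [lintegral_mul_const _ hnormed,
    lintegral_sub_right_eq_self (fun z => ENNReal.ofReal (ρ.normed volume z)) y,
    lintegral_ofReal_normed, one_mul]

theorem lintegral_pderiv_mollify_sq_le (hGm : ∀ i, AEMeasurable (G i) (volume.restrict U))
    {K : Set (E d)} (hKm : MeasurableSet K) (hK : ∀ x ∈ K, Metric.closedBall x ρ.rOut ⊆ U)
    (i : Fin d) :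
    ∫⁻ x in K, ENNReal.ofReal (pderiv (mollify ρ U u) i x ^ 2) ≤ ∫⁻ y in U, ‖G i y‖ₑ ^ 2 := by
  have hpointwise : ∀ x ∈ K, ENNReal.ofReal (pderiv (mollify ρ U u) i x ^ 2)
      ≤ ∫⁻ y in U, ENNReal.ofReal (ρ.normed volume (x - y)) * ‖G i y‖ₑ ^ 2 := fun x hx => by
    rw [pderiv_mollify ρ hU hu hG (hK x hx) i, ← sq_abs, ENNReal.ofReal_pow (abs_nonneg _),
      ← Real.enorm_eq_ofReal_abs]
    refine enorm_integral_mul_sq_le _ (hGm i) (ρ.continuous_normed.comp (by fun_prop)).measurable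
      (fun y => ρ.nonneg_normed _) ((setLIntegral_le_lintegral _ _).trans ?_)
    rw [lintegral_sub_left_eq_self (fun z => ENNReal.ofReal (ρ.normed volume z)) x,
      lintegral_ofReal_normed]
  calc ∫⁻ x in K, ENNReal.ofReal (pderiv (mollify ρ U u) i x ^ 2)
      ≤ ∫⁻ x in K, ∫⁻ y in U, ENNReal.ofReal (ρ.normed volume (x - y)) * ‖G i y‖ₑ ^ 2 :=
        setLIntegral_mono' hKm hpointwise
    _ ≤ ∫⁻ x, ∫⁻ y in U, ENNReal.ofReal (ρ.normed volume (x - y)) * ‖G i y‖ₑ ^ 2 :=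
        setLIntegral_le_lintegral _ _
    _ = ∫⁻ y in U, ‖G i y‖ₑ ^ 2 :=
        lintegral_lintegral_normed_mul ρ ((hGm i).enorm.pow_const 2)

theorem lintegral_gradSq_mollify_le (hGm : ∀ i, AEMeasurable (G i) (volume.restrict U))
    {K : Set (E d)} (hKm : MeasurableSet K) (hK : ∀ x ∈ K, Metric.closedBall x ρ.rOut ⊆ U) :
    ∫⁻ x in K, ENNReal.ofReal (gradSq (mollify ρ U u) x) ≤ ∑ i, ∫⁻ x in U, ‖G i x‖ₑ ^ 2 := by
  simp only [gradSq, ENNReal.ofReal_sum_of_nonneg fun _ _ => sq_nonneg _]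
  rw [lintegral_finsetSum _ fun i _ => ((continuous_pderiv (contDiff_mollify ρ hU hu)
    i).measurable.pow_const 2).ennreal_ofReal]
  exact Finset.sum_le_sum fun i _ =>
    lintegral_pderiv_mollify_sq_le ρ hU hu hG hGm hKm hK i

end Mollify

end Poincare

section ConvexPoincare

variable {d : ℕ}

open scoped ENNReal

/-- The inner parallel set of `U` at distance `ε`. -/
def innerParallel (U : Set (E d)) (ε : ℝ) : Set (E d) := {x | Metric.ball x ε ⊆ U}

theorem isClosed_innerParallel (U : Set (E d)) (ε : ℝ) : IsClosed (innerParallel U ε) := by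
  have hcompl : (innerParallel U ε)ᶜ = Metric.thickening ε Uᶜ := by
    ext x
    simp [innerParallel, Metric.mem_thickening_iff, not_subset, dist_comm x, and_comm]
  exact isOpen_compl_iff.1 (hcompl ▸ Metric.isOpen_thickening)

theorem convex_innerParallel {U : Set (E d)} (hU : Convex ℝ U) (ε : ℝ) :
    Convex ℝ (innerParallel U ε) := by
  intro x hx y hy a b ha hb hab z hz
  have hmem : ∀ p, p + (z - (a • x + b • y)) ∈ Metric.ball p ε := fun p => by
    rwa [Metric.mem_ball, dist_eq_norm, add_sub_cancel_left, ← dist_eq_norm]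
  have hz' : z = a • (x + (z - (a • x + b • y))) + b • (y + (z - (a • x + b • y))) := by
    obtain rfl : b = 1 - a := by linarith
    module
  rw [hz']
  exact hU (hx (hmem x)) (hy (hmem y)) ha hb hab

theorem innerParallel_subset (U : Set (E d)) {ε : ℝ} (hε : 0 < ε) : innerParallel U ε ⊆ U :=
  fun _ hx => hx (Metric.mem_ball_self hε)

theorem innerParallel_anti (U : Set (E d)) : Antitone (innerParallel U) :=
  fun _ _ h _ hx => (Metric.ball_subset_ball h).trans hx

theorem iUnion_innerParallel_prod {U : Set (E d)} (hU : IsOpen U) :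
    ⋃ n : ℕ, innerParallel U (1 / (n + 1)) ×ˢ innerParallel U (1 / (n + 1)) = U ×ˢ U := by
  refine Subset.antisymm (iUnion_subset fun n => ?_) ?_
  · have hsub := innerParallel_subset U (Nat.one_div_pos_of_nat (α := ℝ) (n := n))
    exact prod_mono hsub hsub
  · rintro ⟨x, y⟩ ⟨hx, hy⟩
    obtain ⟨r, hr, hxr⟩ := Metric.isOpen_iff.1 hU x hx
    obtain ⟨r', hr', hyr'⟩ := Metric.isOpen_iff.1 hU y hy
    obtain ⟨n, hn⟩ := exists_nat_one_div_lt (lt_min hr hr')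
    exact mem_iUnion.2 ⟨n, innerParallel_anti U (hn.le.trans (min_le_left _ _)) hxr,
      innerParallel_anti U (hn.le.trans (min_le_right _ _)) hyr'⟩

theorem exists_seq_contDiffBump {ε : ℝ} (hε : 0 < ε) : ∃ ρ : ℕ → ContDiffBump (0 : E d),
    Tendsto (fun n => (ρ n).rOut) atTop (𝓝 0) ∧
      ∀ n, (ρ n).rOut ≤ 2 * (ρ n).rIn ∧ (ρ n).rOut < ε := by
  have hpos (n : ℕ) : 0 < ε / 4 * (1 / ((n : ℝ) + 1)) := by positivity
  refine ⟨fun n => ⟨ε / 4 * (1 / (n + 1)), 2 * (ε / 4 * (1 / (n + 1))), hpos n,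
    lt_two_mul_self (hpos n)⟩, ?_, fun n => ⟨le_rfl, ?_⟩⟩
  · simpa using ((tendsto_one_div_add_atTop_nhds_zero_nat (𝕜 := ℝ)).const_mul (ε / 4)).const_mul 2
  · have hle : 1 / ((n : ℝ) + 1) ≤ 1 := by
      rw [div_le_one (by positivity)]
      linarith [n.cast_nonneg (α := ℝ)]
    change 2 * (ε / 4 * (1 / ((n : ℝ) + 1))) < ε
    nlinarith

theorem measure_mul_enorm_sq_le {α : Type*} [MeasurableSpace α] {μ : Measure α} {B : Set α}
    {u : α → ℝ} (hB0 : μ B ≠ 0) (hB1 : μ B ≠ ⊤) (hu : IntegrableOn u B μ)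
    (huB : ∫ x in B, u x ∂μ = 0) (x : α) :
    μ B * ‖u x‖ₑ ^ 2 ≤ ∫⁻ y in B, ‖u x - u y‖ₑ ^ 2 ∂μ := by
  have hconst : IntegrableOn (fun _ => u x) B μ := integrableOn_const hB1
  have hmean : μ B * ‖u x‖ₑ = ‖∫ y in B, (u x - u y) ∂μ‖ₑ := by
    rw [integral_sub hconst hu, huB, sub_zero, setIntegral_const, smul_eq_mul,
      enorm_mul, Real.enorm_eq_ofReal measureReal_nonneg, measureReal_def,
      ENNReal.ofReal_toReal hB1]
  have hCS := sq_lintegral_le (μ.restrict B) (f := fun y => ‖u x - u y‖ₑ)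
    (hconst.sub hu).aestronglyMeasurable.enorm
  rw [Measure.restrict_apply_univ] at hCS
  refine (ENNReal.mul_le_mul_iff_right hB0 hB1).1 ?_
  calc μ B * (μ B * ‖u x‖ₑ ^ 2)
      = ‖∫ y in B, (u x - u y) ∂μ‖ₑ ^ 2 := by
        rw [← hmean]
        ring
    _ ≤ (∫⁻ y in B, ‖u x - u y‖ₑ ∂μ) ^ 2 := by
        gcongr
        exact enorm_integral_le_lintegral_enorm _
    _ ≤ μ B * ∫⁻ y in B, ‖u x - u y‖ₑ ^ 2 ∂μ := hCS

namespace HasWeakGradientOn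

variable {U : Set (E d)} (hU : IsOpen U) (hUc : Convex ℝ U)
  {δ : ℝ} (hδ : ∀ x ∈ U, ∀ y ∈ U, ‖x - y‖ ≤ δ) {u : E d → ℝ} {G : Fin d → E d → ℝ}
  (hG : HasWeakGradientOn U u G) (hu : IntegrableOn u U)
  (hGm : ∀ i, AEMeasurable (G i) (volume.restrict U))

include hU hUc hδ hG hu hGm

theorem lintegral_innerParallel_prod_le {ε : ℝ} (hε : 0 < ε) :
    ∫⁻ q in innerParallel U ε ×ˢ innerParallel U ε, ‖u q.1 - u q.2‖ₑ ^ 2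
      ≤ ENNReal.ofReal (δ ^ 2) * (2 ^ d * volume U * ∑ i, ∫⁻ x in U, ‖G i x‖ₑ ^ 2) := by
  obtain ⟨ρ, hρ, hρε⟩ := exists_seq_contDiffBump (d := d) hε
  have hUm := hU.measurableSet
  have hKm : MeasurableSet (innerParallel U ε) := (isClosed_innerParallel U ε).measurableSet
  have hKU : innerParallel U ε ⊆ U := innerParallel_subset U hε
  have hv (n : ℕ) : ContDiff ℝ ∞ (mollify (ρ n) U u) := contDiff_mollify (ρ n) hUm hu
  have hlim : ∀ᵐ x ∂volume.restrict (innerParallel U ε),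
      Tendsto (fun n => mollify (ρ n) U u x) atTop (𝓝 (u x)) :=
    ae_restrict_of_ae_restrict_of_subset hKU <|
      ae_tendsto_mollify hUm hu hρ (.of_forall fun n => (hρε n).1)
  have hlim_prod : ∀ᵐ q ∂volume.restrict (innerParallel U ε ×ˢ innerParallel U ε),
      Tendsto (fun n => ‖mollify (ρ n) U u q.1 - mollify (ρ n) U u q.2‖ₑ ^ 2) atTop
        (𝓝 (‖u q.1 - u q.2‖ₑ ^ 2)) := by
    rw [Measure.volume_eq_prod, ← Measure.prod_restrict]
    filter_upwards [Measure.quasiMeasurePreserving_fst.ae hlim,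
      Measure.quasiMeasurePreserving_snd.ae hlim] with q hfst hsnd
    exact ((ENNReal.continuous_pow 2).tendsto _).comp (hfst.sub hsnd).enorm
  have hbound (n : ℕ) : ∫⁻ q in innerParallel U ε ×ˢ innerParallel U ε,
        ‖mollify (ρ n) U u q.1 - mollify (ρ n) U u q.2‖ₑ ^ 2
      ≤ ENNReal.ofReal (δ ^ 2) * (2 ^ d * volume U * ∑ i, ∫⁻ x in U, ‖G i x‖ₑ ^ 2) := by
    refine (lintegral_prod_enorm_sub_sq_le (convex_innerParallel hUc ε) hKm
      (fun x hx y hy => hδ x (hKU hx) y (hKU hy)) (hv n)).trans ?_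
    gcongr
    exact lintegral_gradSq_mollify_le (ρ n) hUm hu hG hGm hKm
      fun x hx => (Metric.closedBall_subset_ball (hρε n).2).trans hx
  have hm (n : ℕ) : Measurable fun q : E d × E d =>
      ‖mollify (ρ n) U u q.1 - mollify (ρ n) U u q.2‖ₑ ^ 2 :=
    ((((hv n).continuous.comp continuous_fst).sub
      ((hv n).continuous.comp continuous_snd)).enorm.measurable).pow_const 2
  exact (lintegral_mono_ae (hlim_prod.mono fun q hq => hq.liminf_eq.ge)).trans <|
    (lintegral_liminf_le hm).trans (liminf_le_of_frequently_le' (.of_forall hbound))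

theorem lintegral_prod_le :
    ∫⁻ q in U ×ˢ U, ‖u q.1 - u q.2‖ₑ ^ 2
      ≤ ENNReal.ofReal (δ ^ 2) * (2 ^ d * volume U * ∑ i, ∫⁻ x in U, ‖G i x‖ₑ ^ 2) := by
  have hmono : Monotone fun n : ℕ =>
      innerParallel U (1 / ((n : ℝ) + 1)) ×ˢ innerParallel U (1 / ((n : ℝ) + 1)) := fun m n hmn =>
    have hsub := innerParallel_anti U (Nat.one_div_le_one_div (α := ℝ) hmn)
    prod_mono hsub hsub
  rw [← iUnion_innerParallel_prod hU, setLIntegral_iUnion_of_directed _ hmono.directed_le]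
  exact iSup_le fun n =>
    lintegral_innerParallel_prod_le hU hUc hδ hG hu hGm Nat.one_div_pos_of_nat

theorem lintegral_sq_le {B : Set (E d)} (hBU : B ⊆ U) (hB0 : volume B ≠ 0)
    (hB1 : volume B ≠ ⊤) (huB : ∫ x in B, u x = 0) :
    ∫⁻ x in U, ‖u x‖ₑ ^ 2 ≤ volume U / volume B * (ENNReal.ofReal (δ ^ 2) * 2 ^ d)
      * ∑ i, ∫⁻ x in U, ‖G i x‖ₑ ^ 2 := by
  have hm : AEMeasurable (fun q : E d × E d => ‖u q.1 - u q.2‖ₑ ^ 2)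
      (volume.restrict (U ×ˢ U)) := by
    rw [Measure.volume_eq_prod, ← Measure.prod_restrict]
    have hum := hu.aestronglyMeasurable.aemeasurable
    exact ((hum.comp_quasiMeasurePreserving Measure.quasiMeasurePreserving_fst).sub
      (hum.comp_quasiMeasurePreserving Measure.quasiMeasurePreserving_snd)).enorm.pow_const 2
  have hmul : volume B * ∫⁻ x in U, ‖u x‖ₑ ^ 2
      ≤ ENNReal.ofReal (δ ^ 2) * (2 ^ d * volume U * ∑ i, ∫⁻ x in U, ‖G i x‖ₑ ^ 2) :=
    calc volume B * ∫⁻ x in U, ‖u x‖ₑ ^ 2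
        = ∫⁻ x in U, volume B * ‖u x‖ₑ ^ 2 := (lintegral_const_mul' _ _ hB1).symm
      _ ≤ ∫⁻ x in U, ∫⁻ y in U, ‖u x - u y‖ₑ ^ 2 := lintegral_mono fun x =>
          (measure_mul_enorm_sq_le hB0 hB1 (hu.mono_set hBU) huB x).trans (lintegral_mono_set hBU)
      _ = ∫⁻ q in U ×ˢ U, ‖u q.1 - u q.2‖ₑ ^ 2 := (setLIntegral_prod _ hm).symm
      _ ≤ _ := lintegral_prod_le hU hUc hδ hG hu hGm
  calc ∫⁻ x in U, ‖u x‖ₑ ^ 2 = (volume B)⁻¹ * (volume B * ∫⁻ x in U, ‖u x‖ₑ ^ 2) := by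
        rw [← mul_assoc, ENNReal.inv_mul_cancel hB0 hB1, one_mul]
    _ ≤ (volume B)⁻¹
        * (ENNReal.ofReal (δ ^ 2) * (2 ^ d * volume U * ∑ i, ∫⁻ x in U, ‖G i x‖ₑ ^ 2)) := by
        gcongr
    _ = _ := by
        rw [div_eq_mul_inv]
        ring

end HasWeakGradientOn

end ConvexPoincare

section CellPoincare

variable {d : ℕ} {D : Domain d} {bc : BoundaryCondition}

open scoped ENNReal

theorem H.ofReal_norm_sq (u : H D) :
    ENNReal.ofReal (‖u‖ ^ 2) = ∫⁻ x in D.region, ‖u x‖ₑ ^ 2 := by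
  have h := eLpNorm_nnreal_pow_eq_lintegral (f := u) (μ := volume.restrict D.region)
    (p := 2) two_ne_zero
  norm_num at h
  rw [ENNReal.ofReal_pow (norm_nonneg _), ofReal_norm, Lp.enorm_def, h]

theorem V.norm_grad_le (v : V D bc) : ‖V.grad D bc v‖ ≤ ‖v‖ :=
  WithLp.norm_snd_le (H D) v.1

theorem DA.norm_grad_toV_sq_le (z : DA D bc) :
    ‖V.grad D bc (DA.toV D bc z)‖ ^ 2 ≤ ‖DA.A D bc z‖ * ‖DA.toH D bc z‖ :=
  (pow_le_pow_left₀ (norm_nonneg _) (V.norm_grad_le _) 2).trans (DA.norm_toV_sq_le z)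

theorem V.hasWeakGradientOn (hD : D.Admissible bc) (v : V D bc) {U : Set (E d)}
    (hU : U ⊆ D.region) :
    HasWeakGradientOn U (V.toH D bc v) fun i => V.grad D bc v i := by
  intro φ hφ hcompact hsupp i
  have hparts := V.isWeakGradient hD v φ ⟨hφ, hcompact, hsupp.trans hU⟩ i
  have hleft {S : Set (E d)} (hS : tsupport φ ⊆ S) :
      ∫ x in S, V.toH D bc v x * pderiv φ i x = ∫ x, V.toH D bc v x * pderiv φ i x :=
    setIntegral_eq_integral_of_forall_compl_eq_zero fun x hx => by
      rw [pderiv_eq_zero_of_notMem_tsupport (fun h => hx (hS h)), mul_zero]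
  have hright {S : Set (E d)} (hS : tsupport φ ⊆ S) :
      ∫ x in S, V.grad D bc v i x * φ x = ∫ x, V.grad D bc v i x * φ x :=
    setIntegral_eq_integral_of_forall_compl_eq_zero fun x hx => by
      rw [image_eq_zero_of_notMem_tsupport (fun h => hx (hS h)), mul_zero]
  rwa [hleft (hsupp.trans hU), hright (hsupp.trans hU), ← hleft hsupp, ← hright hsupp] at hparts

namespace Domain

variable {M : ℕ} (hM : 0 < M) (k : D.Cell M)

theorem isOpen_cell : IsOpen (D.cell M k) :=
  D.isOpen_region.preimage (D.continuous_unscale M k)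

theorem convex_cell : Convex ℝ (D.cell M k) := by
  obtain ⟨r, b, -, hunscale⟩ := D.exists_unscale_eq M k
  have hcell : D.cell M k = (AffineMap.homothety (0 : E d) r + AffineMap.const ℝ (E d) b) ⁻¹'
      D.region := by
    ext x
    simp [cell, hunscale, AffineMap.homothety_apply]
  exact hcell ▸ D.convex_region.affine_preimage _

include hM

theorem ratio_pos (D : Domain d) : 0 < D.ratio M :=
  (Nat.cast_pos.2 hM).trans_le (D.le_ratio M)

theorem volume_preimage_unscale (s : Set (E d)) :
    volume (D.unscale M k ⁻¹' s) = ENNReal.ofReal (D.ratio M ^ d)⁻¹ * volume s := by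
  obtain ⟨r, b, hr, hunscale⟩ := D.exists_unscale_eq M k
  have hr0 : r ≠ 0 := abs_pos.1 (hr ▸ ratio_pos hM D)
  rw [← hr, ← volume_preimage_affine hr0 b s]
  simp only [preimage, hunscale]

theorem norm_sub_le_of_mem_cell {x y : E d} (hx : x ∈ D.cell M k) (hy : y ∈ D.cell M k) :
    ‖x - y‖ ≤ Metric.diam D.region / D.ratio M := by
  obtain ⟨r, b, hr, hunscale⟩ := D.exists_unscale_eq M k
  have hdist := Metric.dist_le_diam_of_mem D.isBounded_region hx hy
  rw [hunscale, hunscale, dist_eq_norm, add_sub_add_right_eq_sub, ← smul_sub, norm_smul,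
    Real.norm_eq_abs, hr] at hdist
  rwa [le_div_iff₀' (ratio_pos hM D)]

omit k in
theorem iUnion_cell_ae_eq (hD : D.Admissible bc) :
    (⋃ k, D.cell M k : Set (E d)) =ᵐ[volume] D.region := by
  have hdisj : Pairwise (Function.onFun Disjoint (D.cell M)) := fun k k' hkk' =>
    Set.disjoint_left.2 fun x hx hx' => hkk' (cell_index_unique hD hx hx')
  have hvolume : volume (⋃ k, D.cell M k) = volume D.region := by
    have hcell (k : D.Cell M) : volume (D.cell M k)
        = ENNReal.ofReal (D.ratio M ^ d)⁻¹ * volume D.region := volume_preimage_unscale hM k _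
    have hpos : 0 < D.ratio M ^ d := pow_pos (ratio_pos hM D) d
    rw [measure_iUnion hdisj fun k => (isOpen_cell k).measurableSet, tsum_fintype]
    simp only [hcell, Finset.sum_const, Finset.card_univ, nsmul_eq_mul]
    rw [← mul_assoc, ← ENNReal.ofReal_natCast, card_cell hD, ← ENNReal.ofReal_mul hpos.le,
      mul_inv_cancel₀ hpos.ne', ENNReal.ofReal_one, one_mul]
  exact ae_eq_of_subset_of_measure_ge (iUnion_subset fun k => D.cell_subset hD k) hvolume.ge
    (isOpen_iUnion isOpen_cell).measurableSet.nullMeasurableSet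
    D.isBounded_region.measure_lt_top.ne

omit k in
theorem lintegral_region_eq_sum (hD : D.Admissible bc) (f : E d → ℝ≥0∞) :
    ∫⁻ x in D.region, f x = ∑ k : D.Cell M, ∫⁻ x in D.cell M k, f x := by
  rw [← setLIntegral_congr (iUnion_cell_ae_eq hM hD),
    lintegral_iUnion (fun k => (isOpen_cell k).measurableSet) fun k k' hkk' =>
      Set.disjoint_left.2 fun x hx hx' => hkk' (cell_index_unique hD hx hx'), tsum_fintype]

end Domain

theorem inner_actuator_eq_setIntegral (hD : D.Admissible bc) {l : Fin d → ℝ} {c : E d}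
    (hc : {x | x - c ∈ omega l} ⊆ D.region) (M : ℕ) (k : D.Cell M) (u : H D) :
    inner ℝ ((memLp_actuator D l c M k).toLp _) u
      = ∫ x in D.unscale M k ⁻¹' {x | x - c ∈ omega l}, u x := by
  have hmeas : MeasurableSet (D.unscale M k ⁻¹' {x | x - c ∈ omega l}) :=
    ((D.continuous_unscale M k).measurable.sub_const c) (measurableSet_omega l)
  have hsub : D.unscale M k ⁻¹' {x | x - c ∈ omega l} ⊆ D.region :=
    fun x hx => D.cell_subset hD k (hc hx)
  rw [inner_toLp_left, ← inter_eq_right.2 hsub, ← setIntegral_indicator hmeas]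
  refine integral_congr_ae (.of_forall fun x => ?_)
  beta_reduce
  by_cases hx : D.unscale M k x - c ∈ omega l
  · rw [indicator_of_mem hx, indicator_of_mem (by exact hx), mul_one]
  · rw [indicator_of_notMem hx, indicator_of_notMem (by exact hx), mul_zero]

/-- The volume ratio of `Ω` and `ω`, which enters the constant of the Poincaré inequality. -/
noncomputable def volumeRatio (D : Domain d) (l : Fin d → ℝ) (c : E d) : ℝ≥0∞ :=
  volume D.region / volume {x | x - c ∈ omega l}

section Mean

variable (hD : D.Admissible bc) {l : Fin d → ℝ} (hl : ∀ n, 0 < l n) {c : E d}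
  (hc : {x | x - c ∈ omega l} ⊆ D.region)

omit hD in
include hl in
theorem volume_omega_translate_ne_zero : volume {x | x - c ∈ omega l} ≠ 0 :=
  (((isOpen_omega l).preimage (continuous_sub_right c)).measure_pos volume
    ⟨c, fun n => by simp [hl n]⟩).ne'

include hD hl hc

theorem lintegral_cell_sq_le {M : ℕ} (hM : 0 < M) (v : V D bc) (k : D.Cell M)
    (hv : inner ℝ ((memLp_actuator D l c M k).toLp _) (V.toH D bc v) = 0) :
    ∫⁻ x in D.cell M k, ‖V.toH D bc v x‖ₑ ^ 2
      ≤ volumeRatio D l c * (ENNReal.ofReal ((Metric.diam D.region / D.ratio M) ^ 2) * 2 ^ d)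
        * ∑ i, ∫⁻ x in D.cell M k, ‖V.grad D bc v i x‖ₑ ^ 2 := by
  have hsub := D.cell_subset hD k
  have hratio0 : ENNReal.ofReal (D.ratio M ^ d)⁻¹ ≠ 0 :=
    (ENNReal.ofReal_pos.2 (inv_pos.2 (pow_pos (Domain.ratio_pos hM D) d))).ne'
  have hvolume := Domain.volume_preimage_unscale hM k {x | x - c ∈ omega l}
  have hratio : volume (D.cell M k) / volume (D.unscale M k ⁻¹' {x | x - c ∈ omega l})
      = volumeRatio D l c := by
    rw [hvolume, Domain.cell, ← preimage, Domain.volume_preimage_unscale hM k,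
      ENNReal.mul_div_mul_left _ _ hratio0 ENNReal.ofReal_ne_top, volumeRatio]
  have hB0 := mul_ne_zero hratio0 (volume_omega_translate_ne_zero hl (c := c))
  have hB1 := ENNReal.mul_ne_top (a := ENNReal.ofReal (D.ratio M ^ d)⁻¹) ENNReal.ofReal_ne_top
    ((measure_mono hc).trans_lt (D.isBounded_region.measure_lt_top (μ := volume))).ne
  rw [← hvolume] at hB0 hB1
  have hint : IntegrableOn (V.toH D bc v) D.region := (Lp.memLp _).integrable (by norm_num)
  rw [← hratio]
  exact (V.hasWeakGradientOn hD v hsub).lintegral_sq_le (Domain.isOpen_cell k)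
    (Domain.convex_cell k) (fun x hx y hy => Domain.norm_sub_le_of_mem_cell hM k hx hy)
    (hint.mono_set hsub)
    (fun i => (Lp.aestronglyMeasurable (V.grad D bc v i)).aemeasurable.mono_measure
      (Measure.restrict_mono hsub le_rfl)) (preimage_mono hc) hB0 hB1
    (inner_actuator_eq_setIntegral hD hc M k _ ▸ hv)

theorem exists_poincare :
    ∃ C : ℝ, 0 ≤ C ∧ ∀ M : ℕ, 0 < M → ∀ v : V D bc,
      (∀ k, inner ℝ ((memLp_actuator D l c M k).toLp _) (V.toH D bc v) = 0) →
      ‖V.toH D bc v‖ ^ 2 ≤ C / (M : ℝ) ^ 2 * ‖V.grad D bc v‖ ^ 2 := by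
  have hfinite : volumeRatio D l c ≠ ⊤ :=
    ENNReal.div_ne_top D.isBounded_region.measure_lt_top.ne (volume_omega_translate_ne_zero hl)
  refine ⟨(volumeRatio D l c).toReal * (Metric.diam D.region ^ 2 * 2 ^ d), by positivity,
    fun M hM v hv => ?_⟩
  have : (0 : ℝ) < M := Nat.cast_pos.2 hM
  have hsq : ‖V.toH D bc v‖ ^ 2 ≤ (volumeRatio D l c).toReal
      * ((Metric.diam D.region / D.ratio M) ^ 2 * 2 ^ d) * ‖V.grad D bc v‖ ^ 2 := by
    refine (ENNReal.ofReal_le_ofReal_iff (by positivity)).1 ?_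
    rw [PiLp.norm_sq_eq_of_L2, ENNReal.ofReal_mul (by positivity),
      ENNReal.ofReal_mul (by positivity), ENNReal.ofReal_mul (by positivity),
      ENNReal.ofReal_toReal hfinite, ENNReal.ofReal_sum_of_nonneg fun i _ => sq_nonneg _,
      ENNReal.ofReal_pow two_pos.le, ENNReal.ofReal_ofNat]
    simp only [H.ofReal_norm_sq, Domain.lintegral_region_eq_sum hM hD]
    rw [Finset.sum_comm, Finset.mul_sum]
    exact Finset.sum_le_sum fun k _ => lintegral_cell_sq_le hD hl hc hM v k (hv k)
  refine hsq.trans ?_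
  rw [mul_div_assoc, mul_div_right_comm, ← div_pow]
  gcongr
  · exact div_nonneg Metric.diam_nonneg (Domain.ratio_pos hM D).le
  · exact D.le_ratio M

theorem eventually_norm_toH_sq_le {η : ℝ} (hη : 0 < η) :
    ∀ᶠ M in atTop, ∀ v : V D bc,
      (∀ k, inner ℝ ((memLp_actuator D l c M k).toLp _) (V.toH D bc v) = 0) →
      ‖V.toH D bc v‖ ^ 2 ≤ η * ‖V.grad D bc v‖ ^ 2 := by
  obtain ⟨C, -, hpoincare⟩ := exists_poincare (bc := bc) hD hl hc
  filter_upwards [eventually_gt_atTop 0,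
    (tendsto_const_div_pow C 2 two_ne_zero).eventually_le_const hη] with M hM hCM v hv
  exact (hpoincare M hM v hv).trans (by gcongr)

theorem DA.eventually_norm_toH_sq_le {η : ℝ} (hη : 0 < η) :
    ∀ᶠ M in atTop, ∀ z : DA D bc,
      (∀ k, inner ℝ ((memLp_actuator D l c M k).toLp _) (DA.toH D bc z) = 0) →
      ‖DA.toH D bc z‖ ^ 2 ≤ η * ‖DA.A D bc z‖ ^ 2 := by
  filter_upwards [CahnHilliard.eventually_norm_toH_sq_le (bc := bc) hD hl hc (Real.sqrt_pos.2 hη)]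
    with M hM z hz
  have hH : ‖DA.toH D bc z‖ ^ 2 ≤ √η * ‖DA.A D bc z‖ * ‖DA.toH D bc z‖ := by
    calc ‖DA.toH D bc z‖ ^ 2
        ≤ √η * ‖V.grad D bc (DA.toV D bc z)‖ ^ 2 := by
          simpa only [DA.toH_toV] using hM (DA.toV D bc z) (by simpa only [DA.toH_toV] using hz)
      _ ≤ √η * (‖DA.A D bc z‖ * ‖DA.toH D bc z‖) := by
          gcongr
          exact DA.norm_grad_toV_sq_le z
      _ = √η * ‖DA.A D bc z‖ * ‖DA.toH D bc z‖ := (mul_assoc _ _ _).symm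
  have hlinear : ‖DA.toH D bc z‖ ≤ √η * ‖DA.A D bc z‖ := by
    rcases (norm_nonneg (DA.toH D bc z)).eq_or_lt with h0 | hpos
    · rw [← h0]; positivity
    · exact le_of_mul_le_mul_right (by rwa [← sq]) hpos
  calc ‖DA.toH D bc z‖ ^ 2 ≤ (√η * ‖DA.A D bc z‖) ^ 2 := by gcongr
    _ = η * ‖DA.A D bc z‖ ^ 2 := by rw [mul_pow, Real.sq_sqrt hη.le]

end Mean

end CellPoincare

section Projections

variable {d : ℕ} {D : Domain d} {bc : BoundaryCondition}

section Biorthogonal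

variable {X : Type*} [NormedAddCommGroup X] [NormedSpace ℝ X] {ι : Type*}
  {e : X →L[ℝ] H D} {Φ Φ' : ι → H D} (hdiag : ∀ i, inner ℝ (Φ i) (Φ' i) ≠ 0)
  (hoff : ∀ i j, i ≠ j → inner ℝ (Φ i) (Φ' j) = 0)

include hoff in
theorem inner_sum_smul_right_eq [Fintype ι] (α : ι → ℝ) (i : ι) :
    inner ℝ (Φ i) (∑ j, α j • Φ' j) = α i * inner ℝ (Φ i) (Φ' i) := by
  rw [inner_sum, Finset.sum_eq_single_of_mem i (Finset.mem_univ i) fun j _ hji => by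
    rw [real_inner_smul_right, hoff i j hji.symm, mul_zero], real_inner_smul_right]

include hdiag hoff

theorem exists_obliqueProj [Finite ι] {χ : ι → X} (hχ : ∀ i, e (χ i) = Φ' i) (w : H D) :
    ∃ p : X, e p ∈ Submodule.span ℝ (range Φ') ∧ w - e p ∈ (Submodule.span ℝ (range Φ))ᗮ := by
  have := Fintype.ofFinite ι
  have he : e (∑ i, (inner ℝ (Φ i) w / inner ℝ (Φ i) (Φ' i)) • χ i)
      = ∑ i, (inner ℝ (Φ i) w / inner ℝ (Φ i) (Φ' i)) • Φ' i := by
    simp only [map_sum, map_smul, hχ]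
  refine ⟨∑ i, (inner ℝ (Φ i) w / inner ℝ (Φ i) (Φ' i)) • χ i, ?_, ?_⟩
  · rw [he]
    exact Submodule.sum_smul_mem _ _ fun i _ => Submodule.subset_span (mem_range_self i)
  · rw [← Submodule.span_singleton_le_iff_mem, ← Submodule.isOrtho_iff_le,
      Submodule.isOrtho_comm, Submodule.isOrtho_span]
    rintro _ ⟨i, rfl⟩ _ rfl
    rw [he, inner_sub_right, inner_sum_smul_right_eq hoff, div_mul_cancel₀ _ (hdiag i), sub_self]

theorem exists_obliqueProjDual [Finite ι] (he : Function.Injective e) {χ : ι → X}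
    (hχ : ∀ i, e (χ i) = Φ' i) (ξ : StrongDual ℝ X) :
    ∃ u : H D, u ∈ Submodule.span ℝ (range Φ) ∧
      ∀ w : X, e w ∈ Submodule.span ℝ (range Φ') → inner ℝ u (e w) = ξ w := by
  have := Fintype.ofFinite ι
  refine ⟨∑ i, (ξ (χ i) / inner ℝ (Φ i) (Φ' i)) • Φ i,
    Submodule.sum_smul_mem _ _ fun i _ => Submodule.subset_span (mem_range_self i), fun w hw => ?_⟩
  obtain ⟨α, hα⟩ := (Submodule.mem_span_range_iff_exists_fun ℝ).1 hw
  have hw' : w = ∑ j, α j • χ j := he (by simp only [← hα, map_sum, map_smul, hχ])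
  rw [← hα, hw', map_sum, sum_inner]
  refine Finset.sum_congr rfl fun i _ => ?_
  rw [real_inner_smul_left, inner_sum_smul_right_eq hoff, map_smul, smul_eq_mul, mul_left_comm,
    div_mul_cancel₀ _ (hdiag i)]

theorem exists_inner_feedbackInput [Fintype ι] (he : Function.Injective e) {χ : ι → X}
    (hχ : ∀ i, e (χ i) = Φ' i) (B : X → StrongDual ℝ X) (lam : ℝ) (w : H D) :
    ∃ p : X, (∀ i, inner ℝ (Φ i) (w - e p) = 0) ∧
      inner ℝ (actuate Φ (feedbackInput e B Φ Φ' lam w)) w = -lam * B p p := by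
  set F := Submodule.span ℝ (range Φ')
  set G := Submodule.span ℝ (range Φ)
  set p : X := obliqueProj e F Gᗮ w
  have hp : e p ∈ F ∧ w - e p ∈ Gᗮ :=
    Classical.epsilon_spec (exists_obliqueProj hdiag hoff hχ w)
  set u : H D := obliqueProjDual e G F (B p)
  have hu : u ∈ G ∧ ∀ z : X, e z ∈ F → inner ℝ u (e z) = B p z :=
    Classical.epsilon_spec (exists_obliqueProjDual hdiag hoff he hχ (B p))
  have hmem : u ∈ LinearMap.range (actuate Φ) := by
    rw [actuate, Fintype.range_linearCombination]
    exact hu.1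
  have hactuate : actuate Φ (feedbackInput e B Φ Φ' lam w) = (-lam) • u := by
    rw [feedbackInput, map_smul, Function.invFun_eq hmem]
  have hinner : inner ℝ u w = B p p := by
    rw [← hu.2 p hp.1, ← sub_eq_zero, ← inner_sub_right]
    exact hp.2 u hu.1
  exact ⟨p, fun i => hp.2 _ (Submodule.subset_span ⟨i, rfl⟩), by
    rw [hactuate, real_inner_smul_left, hinner]⟩

end Biorthogonal

section Bump

variable {l : Fin d → ℝ}

theorem bump_pos {z : E d} (hz : z ∈ omega l) : 0 < bump l z := by
  rw [bump, indicator_of_mem hz]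
  exact sineProduct_pos hz

theorem inner_actuator_bump_pow_eq_setIntegral (hD : D.Admissible bc) {c : E d}
    (hc : {x | x - c ∈ omega l} ⊆ D.region) (c' : E d) (M : ℕ) (k k' : D.Cell M) (m : ℕ) :
    inner ℝ ((memLp_actuator D l c M k).toLp _) ((memLp_bump_pow D l c' M k' m).toLp _)
      = ∫ x in D.unscale M k ⁻¹' {x | x - c ∈ omega l}, bump l (D.unscale M k' x - c') ^ m := by
  rw [inner_actuator_eq_setIntegral hD hc]
  have hsub : D.unscale M k ⁻¹' {x | x - c ∈ omega l} ⊆ D.region :=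
    fun x hx => D.cell_subset hD k (hc hx)
  exact integral_congr_ae (ae_restrict_of_ae_restrict_of_subset hsub (MemLp.coeFn_toLp _))

theorem inner_actuator_bump_pow_eq_zero (hD : D.Admissible bc) {c c' : E d}
    (hc : {x | x - c ∈ omega l} ⊆ D.region) {M : ℕ} {k k' : D.Cell M} {m : ℕ} (hm : m ≠ 0)
    (hdisj : ∀ x, D.unscale M k x - c ∈ omega l → D.unscale M k' x - c' ∉ omega l) :
    inner ℝ ((memLp_actuator D l c M k).toLp _) ((memLp_bump_pow D l c' M k' m).toLp _) = 0 := by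
  rw [inner_actuator_bump_pow_eq_setIntegral hD hc]
  refine setIntegral_eq_zero_of_forall_eq_zero fun x hx => ?_
  rw [bump, indicator_of_notMem (hdisj x hx), zero_pow hm]

theorem inner_actuator_bump_pow_pos (hD : D.Admissible bc) (hl : ∀ n, 0 < l n) {c : E d}
    (hc : {x | x - c ∈ omega l} ⊆ D.region) {M : ℕ} (hM : 0 < M) (k : D.Cell M) (m : ℕ) :
    0 < inner ℝ ((memLp_actuator D l c M k).toLp _) ((memLp_bump_pow D l c M k m).toLp _) := by
  set B := D.unscale M k ⁻¹' {x | x - c ∈ omega l} with hB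
  have hmeas : MeasurableSet B :=
    ((D.continuous_unscale M k).measurable.sub_const c) (measurableSet_omega l)
  have hpos : ∀ x ∈ B, 0 < bump l (D.unscale M k x - c) ^ m := fun x hx => pow_pos (bump_pos hx) m
  have hint : IntegrableOn (fun x => bump l (D.unscale M k x - c) ^ m) B :=
    ((memLp_bump_pow D l c M k m).integrable one_le_two).mono_measure
      (Measure.restrict_mono (fun x hx => D.cell_subset hD k (hc hx)) le_rfl)
  have hvolume : volume B ≠ 0 := by
    rw [hB, Domain.volume_preimage_unscale hM k]
    refine mul_ne_zero (ENNReal.ofReal_pos.2 ?_).ne' (volume_omega_translate_ne_zero hl)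
    exact inv_pos.2 (pow_pos (Domain.ratio_pos hM D) d)
  rw [inner_actuator_bump_pow_eq_setIntegral hD hc,
    setIntegral_pos_iff_support_of_nonneg_ae
      ((ae_restrict_mem hmeas).mono fun x hx => (hpos x hx).le) hint]
  have hsupp : B ⊆ Function.support fun x => bump l (D.unscale M k x - c) ^ m :=
    fun x hx => (hpos x hx).ne'
  rwa [inter_eq_right.2 hsupp, pos_iff_ne_zero]

end Bump

namespace ActuatorData

variable (a : ActuatorData D)

theorem exists_affine (hD : D.Admissible bc) {c : E d}
    (hc : {x | x - c ∈ omega a.l} ⊆ D.region) (M : ℕ) (k : D.Cell M) :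
    ∃ (r : ℝ) (b : E d), (∀ x, D.unscale M k x - c = r • x + b) ∧
      {x | r • x + b ∈ omega a.l} ⊆ D.region := by
  obtain ⟨r, b, -, hunscale⟩ := D.exists_unscale_eq M k
  have haffine (x : E d) : D.unscale M k x - c = r • x + (b - c) := by
    rw [hunscale, add_sub_assoc]
  refine ⟨r, b - c, haffine, fun x hx => D.cell_subset hD k (hc ?_)⟩
  rwa [mem_ofPred_eq, haffine]

theorem exists_toH_eq_PhiAux (hD : D.Admissible bc) (M : ℕ) (j : D.Cell M × Fin (d + 1)) :
    ∃ z : DA D bc, DA.toH D bc z = a.PhiAux M j := by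
  obtain ⟨r, b, haffine, hsub⟩ := a.exists_affine hD (a.subset₁ j.2) M j.1
  obtain ⟨z, hz⟩ := exists_DA_bump_sq a.l_pos hsub hD
  exact ⟨z, Lp.ext <| hz.trans <| .symm <| (MemLp.coeFn_toLp _).trans <|
    .of_forall fun x => by simp only [haffine]⟩

theorem exists_toH_eq_PsiAux (hD : D.Admissible bc) (M : ℕ) (k : D.Cell M) :
    ∃ v : V D bc, V.toH D bc v = a.PsiAux M k := by
  obtain ⟨r, b, haffine, hsub⟩ := a.exists_affine hD a.subset₂ M k
  obtain ⟨v, hv⟩ := exists_V_bump a.l_pos hsub bc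
  exact ⟨v, Lp.ext <| hv.trans <| .symm <| (MemLp.coeFn_toLp _).trans <|
    .of_forall fun x => by simp only [haffine, pow_one]⟩

theorem inner_Phi_PhiAux_of_ne (hD : D.Admissible bc) {M : ℕ} {i j : D.Cell M × Fin (d + 1)}
    (hij : i ≠ j) : inner ℝ (a.Phi M i) (a.PhiAux M j) = 0 := by
  refine inner_actuator_bump_pow_eq_zero hD (a.subset₁ i.2) two_ne_zero fun x hx hx' => ?_
  have hcell : i.1 = j.1 := Domain.cell_index_unique hD (a.subset₁ i.2 hx) (a.subset₁ j.2 hx')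
  have hcenter : i.2 ≠ j.2 := fun h => hij (Prod.ext hcell h)
  rw [← hcell] at hx'
  exact Set.disjoint_left.1 (a.disjoint₁ _ _ hcenter) hx hx'

theorem inner_Psi_PsiAux_of_ne (hD : D.Admissible bc) {M : ℕ} {i j : D.Cell M} (hij : i ≠ j) :
    inner ℝ (a.Psi M i) (a.PsiAux M j) = 0 :=
  inner_actuator_bump_pow_eq_zero hD a.subset₂ one_ne_zero fun _ hx hx' =>
    hij (Domain.cell_index_unique hD (a.subset₂ hx) (a.subset₂ hx'))

variable {M : ℕ} (hM : 0 < M)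

include hM in
theorem exists_inner_actuate_K₁ (hD : D.Admissible bc) (lam : ℝ) (w : H D) :
    ∃ p : DA D bc, (∀ j, inner ℝ (a.Phi M j) (w - DA.toH D bc p) = 0) ∧
      inner ℝ (actuate (a.Phi M) (K₁ bc a M lam w)) w = -lam * ‖DA.A D bc p‖ ^ 2 := by
  choose χ hχ using a.exists_toH_eq_PhiAux hD M
  obtain ⟨p, hp, hinner⟩ := exists_inner_feedbackInput (Φ := a.Phi M) (Φ' := a.PhiAux M)
    (fun j => (inner_actuator_bump_pow_pos hD a.l_pos (a.subset₁ j.2) hM j.1 2).ne')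
    (fun _ _ => a.inner_Phi_PhiAux_of_ne hD) (DA.toH_injective hD) hχ (DA.Asq D bc) lam w
  exact ⟨p, hp, hinner.trans (congrArg _ (real_inner_self_eq_norm_sq (DA.A D bc p)))⟩

include hM in
theorem exists_inner_actuate_K₂ (hD : D.Admissible bc) (lam : ℝ) (w : H D) :
    ∃ p : V D bc, (∀ k, inner ℝ (a.Psi M k) (w - V.toH D bc p) = 0) ∧
      inner ℝ (actuate (a.Psi M) (K₂ bc a M lam w)) w = -lam * ‖p‖ ^ 2 := by
  choose χ hχ using a.exists_toH_eq_PsiAux hD M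
  obtain ⟨p, hp, hinner⟩ := exists_inner_feedbackInput (Φ := a.Psi M) (Φ' := a.PsiAux M)
    (fun k => (inner_actuator_bump_pow_pos hD a.l_pos a.subset₂ hM k 1).ne')
    (fun _ _ => a.inner_Psi_PsiAux_of_ne hD) (V.toH_injective hD) hχ (V.A D bc) lam w
  exact ⟨p, hp, hinner.trans (congrArg _ (real_inner_self_eq_norm_sq p))⟩

end ActuatorData

end Projections

section Coercivity

variable {d : ℕ} {D : Domain d} {bc : BoundaryCondition}

theorem norm_add_sq_le_two_mul {F : Type*} [SeminormedAddCommGroup F] (u v : F) :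
    ‖u + v‖ ^ 2 ≤ 2 * ‖u‖ ^ 2 + 2 * ‖v‖ ^ 2 := by
  calc ‖u + v‖ ^ 2 ≤ (‖u‖ + ‖v‖) ^ 2 := by gcongr; exact norm_add_le u v
    _ ≤ 2 * (‖u‖ ^ 2 + ‖v‖ ^ 2) := add_sq_le
    _ = 2 * ‖u‖ ^ 2 + 2 * ‖v‖ ^ 2 := mul_add _ _ _

theorem mul_norm_sq_le_of_norm_sub_sq_le {X F G : Type*}
    [SeminormedAddCommGroup X] [NormedSpace ℝ X] [SeminormedAddCommGroup F] [NormedSpace ℝ F]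
    [SeminormedAddCommGroup G] [NormedSpace ℝ G]
    (e : X →L[ℝ] F) (T : X →L[ℝ] G)
    {Λ ν b : ℝ} (hΛ : 0 ≤ Λ) (hν : 0 < ν) {y p : X}
    (hep : ‖e p‖ ≤ b) (hTp : ‖T p‖ ≤ b)
    (hyp : ‖e (y - p)‖ ^ 2 ≤ ν / (4 * Λ + 1) * ‖T (y - p)‖ ^ 2) :
    Λ * ‖e y‖ ^ 2 ≤ ν * ‖T y‖ ^ 2 + (2 * Λ + ν) * b ^ 2 := by
  have he : ‖e y‖ ^ 2 ≤ 2 * b ^ 2 + 2 * ‖e (y - p)‖ ^ 2 := by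
    rw [← add_sub_cancel p y, map_add, add_sub_cancel]
    exact (norm_add_sq_le_two_mul _ _).trans (by gcongr)
  have hT : ‖T (y - p)‖ ^ 2 ≤ 2 * ‖T y‖ ^ 2 + 2 * b ^ 2 := by
    rw [sub_eq_add_neg, map_add, map_neg]
    exact (norm_add_sq_le_two_mul _ _).trans (by rw [norm_neg]; gcongr)
  have hη : 4 * Λ * (ν / (4 * Λ + 1)) ≤ ν := by
    rw [mul_div_assoc', div_le_iff₀ (by positivity)]
    linarith
  calc Λ * ‖e y‖ ^ 2
      ≤ Λ * (2 * b ^ 2 + 2 * (ν / (4 * Λ + 1) * (2 * ‖T y‖ ^ 2 + 2 * b ^ 2))) := by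
        gcongr
        exact he.trans (by gcongr; exact hyp.trans (by gcongr))
    _ = 2 * Λ * b ^ 2 + 4 * Λ * (ν / (4 * Λ + 1)) * (‖T y‖ ^ 2 + b ^ 2) := by ring
    _ ≤ 2 * Λ * b ^ 2 + ν * (‖T y‖ ^ 2 + b ^ 2) := by gcongr
    _ = ν * ‖T y‖ ^ 2 + (2 * Λ + ν) * b ^ 2 := by ring

namespace ActuatorData

variable (a : ActuatorData D) (hD : D.Admissible bc) {Λ ν : ℝ} (hΛ : 0 ≤ Λ) (hν : 0 < ν)

include hD hΛ hν

theorem eventually_inner_actuate_K₁_add_le :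
    ∀ᶠ M in atTop, ∀ lam, 2 * Λ + ν ≤ lam → ∀ z : DA D bc,
      inner ℝ (actuate (a.Phi M) (K₁ bc a M lam (DA.toH D bc z))) (DA.toH D bc z)
        + Λ * ‖DA.toH D bc z‖ ^ 2 ≤ ν * ‖DA.A D bc z‖ ^ 2 := by
  filter_upwards [eventually_gt_atTop 0, DA.eventually_norm_toH_sq_le hD a.l_pos (a.subset₁ 0)
    (show 0 < ν / (4 * Λ + 1) by positivity)] with M hM hpoincare lam hlam z
  obtain ⟨p, hp, hinner⟩ := a.exists_inner_actuate_K₁ (bc := bc) hM hD lam (DA.toH D bc z)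
  have hcoercive := mul_norm_sq_le_of_norm_sub_sq_le (DA.toH D bc) (DA.A D bc) hΛ hν
    (DA.norm_toH_le p) le_rfl (hpoincare (z - p) fun k => by rw [map_sub]; exact hp (k, 0))
  have hgain := mul_le_mul_of_nonneg_right hlam (sq_nonneg ‖DA.A D bc p‖)
  linarith

theorem eventually_inner_actuate_K₂_add_le :
    ∀ᶠ M in atTop, ∀ lam, 2 * Λ + ν ≤ lam → ∀ v : V D bc,
      inner ℝ (actuate (a.Psi M) (K₂ bc a M lam (V.toH D bc v))) (V.toH D bc v)
        + Λ * ‖V.toH D bc v‖ ^ 2 ≤ ν * ‖V.grad D bc v‖ ^ 2 := by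
  filter_upwards [eventually_gt_atTop 0, eventually_norm_toH_sq_le hD a.l_pos a.subset₂
    (show 0 < ν / (4 * Λ + 1) by positivity)] with M hM hpoincare lam hlam v
  obtain ⟨p, hp, hinner⟩ := a.exists_inner_actuate_K₂ (bc := bc) hM hD lam (V.toH D bc v)
  have hcoercive := mul_norm_sq_le_of_norm_sub_sq_le (V.toH D bc) (V.grad D bc) hΛ hν
    (V.norm_toH_le p) (V.norm_grad_le p) (hpoincare (v - p) fun k => by rw [map_sub]; exact hp k)
  have hgain := mul_le_mul_of_nonneg_right hlam (sq_nonneg ‖p‖)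
  linarith

end ActuatorData

end Coercivity

section Growth

theorem exists_mul_rpow_mul_rpow_le_add {θ C ε : ℝ} (hθ : 0 ≤ θ) (hθ1 : θ < 1) (hC : 0 ≤ C)
    (hε : 0 < ε) :
    ∃ K, 0 ≤ K ∧ ∀ x y : ℝ, 0 ≤ x → 0 ≤ y → C * (x ^ (1 - θ) * y ^ θ) ≤ ε * y + K * x := by
  have h1θ : 0 < 1 - θ := sub_pos.2 hθ1
  -- The weighted AM-GM inequality for `K x` and `ε y` asks for `K ^ (1 - θ) * ε ^ θ = C`.
  set K := (C * ε ^ (-θ)) ^ (1 - θ)⁻¹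
  have hK : 0 ≤ K := by positivity
  have hKε : K ^ (1 - θ) * ε ^ θ = C := by
    rw [Real.rpow_inv_rpow (by positivity) h1θ.ne', mul_assoc, ← Real.rpow_add hε, neg_add_cancel,
      Real.rpow_zero, mul_one]
  refine ⟨K, hK, fun x y hx hy => ?_⟩
  have hKx : 0 ≤ K * x := mul_nonneg hK hx
  have hεy : 0 ≤ ε * y := mul_nonneg hε.le hy
  calc C * (x ^ (1 - θ) * y ^ θ) = (K * x) ^ (1 - θ) * (ε * y) ^ θ := by
        rw [Real.mul_rpow hK hx, Real.mul_rpow hε.le hy, ← hKε]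
        ring
    _ ≤ (1 - θ) * (K * x) + θ * (ε * y) :=
        Real.geom_mean_le_arith_mean2_weighted h1θ.le hθ hKx hεy (sub_add_cancel 1 θ)
    _ ≤ K * x + ε * y := add_le_add (mul_le_of_le_one_left hKx (sub_le_self 1 hθ))
        (mul_le_of_le_one_left hεy hθ1.le)
    _ = ε * y + K * x := add_comm _ _

theorem rpow_le_mul_rpow_of_le {a ρ ζ κ : ℝ} (ha : 0 ≤ a) (haρ : a ≤ ρ) (hκ : 0 < κ)
    (hκζ : κ ≤ ζ) : a ^ ζ ≤ ρ ^ (ζ - κ) * a ^ κ := by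
  calc a ^ ζ = a ^ (ζ - κ) * a ^ κ := by
        rw [← Real.rpow_add_of_nonneg ha (sub_nonneg.2 hκζ) hκ.le, sub_add_cancel]
    _ ≤ ρ ^ (ζ - κ) * a ^ κ := by
        gcongr

theorem exists_mul_rpow_mul_rpow_le {ζ η C ε ρ : ℝ} (hη : 0 ≤ η) (hη2 : η < 2)
    (hζη : 2 ≤ ζ + η) (hC : 0 ≤ C) (hρ : 0 ≤ ρ) (hε : 0 < ε) :
    ∃ K, 0 ≤ K ∧ ∀ a b : ℝ, 0 ≤ a → a ≤ ρ → 0 ≤ b →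
      C * (a ^ ζ * b ^ η) ≤ ε * b ^ 2 + K * a ^ 2 := by
  obtain ⟨K, hK, hyoung⟩ := exists_mul_rpow_mul_rpow_le_add (θ := η / 2) (by linarith)
    (by linarith) (mul_nonneg hC (Real.rpow_nonneg hρ (ζ - (2 - η)))) hε
  refine ⟨K, hK, fun a b ha haρ hb => ?_⟩
  have hyoung' := hyoung (a ^ 2) (b ^ 2) (sq_nonneg a) (sq_nonneg b)
  rw [← Real.rpow_natCast_mul ha, ← Real.rpow_natCast_mul hb, Nat.cast_ofNat,
    show 2 * (1 - η / 2) = 2 - η by ring, show 2 * (η / 2) = η by ring] at hyoung'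
  calc C * (a ^ ζ * b ^ η)
      ≤ C * (ρ ^ (ζ - (2 - η)) * a ^ (2 - η) * b ^ η) := by
        gcongr
        exact rpow_le_mul_rpow_of_le ha haρ (by linarith) (by linarith)
    _ = C * ρ ^ (ζ - (2 - η)) * (a ^ (2 - η) * b ^ η) := by ring
    _ ≤ ε * b ^ 2 + K * a ^ 2 := hyoung'

theorem exists_mul_sum_rpow_mul_rpow_le {ι : Type*} [Fintype ι] {ζ η : ι → ℝ} {C ε ρ : ℝ}
    (h : ∀ i, 0 ≤ η i ∧ η i < 2 ∧ 2 ≤ ζ i + η i) (hC : 0 ≤ C) (hρ : 0 ≤ ρ) (hε : 0 < ε) :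
    ∃ K, 0 ≤ K ∧ ∀ a b : ℝ, 0 ≤ a → a ≤ ρ → 0 ≤ b →
      C * ∑ i, a ^ ζ i * b ^ η i ≤ ε * b ^ 2 + K * a ^ 2 := by
  set n := (Fintype.card ι : ℝ)
  choose K hK hterm using fun i =>
    exists_mul_rpow_mul_rpow_le (h i).1 (h i).2.1 (h i).2.2 hC hρ
      (show 0 < ε / (n + 1) by positivity)
  refine ⟨∑ i, K i, Finset.sum_nonneg fun i _ => hK i, fun a b ha haρ hb => ?_⟩
  have hn : n * (ε / (n + 1)) ≤ ε := by
    rw [mul_div_assoc', div_le_iff₀ (by positivity)]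
    linarith
  calc C * ∑ i, a ^ ζ i * b ^ η i
      ≤ ∑ i, (ε / (n + 1) * b ^ 2 + K i * a ^ 2) := by
        rw [Finset.mul_sum]
        exact Finset.sum_le_sum fun i _ => hterm i a b ha haρ hb
    _ = n * (ε / (n + 1)) * b ^ 2 + (∑ i, K i) * a ^ 2 := by
        rw [Finset.sum_add_distrib, Finset.sum_const, Finset.card_univ, nsmul_eq_mul,
          ← Finset.sum_mul, mul_assoc]
    _ ≤ ε * b ^ 2 + (∑ i, K i) * a ^ 2 := by gcongr

end Growth

section TimeDependentFunctions

variable {X Y : Type*} [NormedAddCommGroup X] [NormedAddCommGroup Y] {F G : ℝ → X}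

theorem L2Loc.sub (hF : L2Loc F) (hG : L2Loc G) : L2Loc fun t => F t - G t :=
  fun T hT => (hF T hT).sub (hG T hT)

theorem L2Loc.add (hF : L2Loc F) (hG : L2Loc G) : L2Loc fun t => F t + G t :=
  fun T hT => (hF T hT).add (hG T hT)

variable [NormedSpace ℝ X] [NormedSpace ℝ Y]

theorem L2Loc.clm_comp (L : X →L[ℝ] Y) (hF : L2Loc F) : L2Loc fun t => L (F t) :=
  fun T hT => L.comp_memLp' (hF T hT)

theorem L2Loc.intervalIntegrable_apply {ξ : ℝ → StrongDual ℝ X} (hξ : L2Loc ξ) (hF : L2Loc F)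
    {s t : ℝ} (hs : 0 ≤ s) (hst : s ≤ t) :
    IntervalIntegrable (fun τ => ξ τ (F τ)) volume s t := by
  have hT : 0 < t + 1 := by linarith
  have hint : IntegrableOn (fun τ => ξ τ (F τ)) (Ioc 0 (t + 1)) := memLp_one_iff_integrable.1 <|
    (ContinuousLinearMap.id ℝ (StrongDual ℝ X)).memLp_of_bilin 1 (hξ _ hT) (hF _ hT)
  rw [intervalIntegrable_iff_integrableOn_Ioc_of_le hst]
  exact hint.mono_set (Ioc_subset_Ioc hs (by linarith))

theorem IsTimeDeriv.sub {d : ℕ} {D : Domain d} {e : X →L[ℝ] H D} {y z : ℝ → H D}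
    {ξ χ : ℝ → StrongDual ℝ X} (hy : IsTimeDeriv e y ξ) (hz : IsTimeDeriv e z χ) (hξ : L2Loc ξ)
    (hχ : L2Loc χ) : IsTimeDeriv e (fun t => y t - z t) fun t => ξ t - χ t := by
  intro φ s t hs hst
  have hφ : L2Loc fun _ : ℝ => φ := fun T _ => memLp_const φ
  simp only [sub_apply]
  rw [intervalIntegral.integral_sub (hξ.intervalIntegrable_apply hφ hs hst)
    (hχ.intervalIntegrable_apply hφ hs hst), ← hy φ s t hs hst, ← hz φ s t hs hst, inner_sub_left,
    inner_sub_left]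
  ring

end TimeDependentFunctions

section ErrorEquation

variable {d : ℕ} {D : Domain d} {bc : BoundaryCondition}

theorem DA.inner_A₀ (z : DA D bc) (v : V D bc) :
    inner ℝ (V.toH D bc v) (DA.A₀ D bc z)
      = inner ℝ (V.grad D bc (DA.toV D bc z)) (V.grad D bc v) := by
  have hA := DA.inner_toV z v
  rw [V.inner_eq, DA.toH_toV] at hA
  rw [real_inner_comm, show DA.A₀ D bc z = DA.A D bc z - DA.toH D bc z from rfl, inner_sub_left,
    ← hA]
  ring

theorem DA.norm_A_sq_le (z : DA D bc) :
    ‖DA.A D bc z‖ ^ 2 ≤ 2 * ‖DA.A₀ D bc z‖ ^ 2 + 2 * ‖DA.toH D bc z‖ ^ 2 := by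
  have hA : DA.A D bc z = DA.A₀ D bc z + DA.toH D bc z :=
    (sub_add_cancel (DA.A D bc z) (DA.toH D bc z)).symm
  exact hA ▸ norm_add_sq_le_two_mul _ _

/-- The increment `f(r + z) - f(r)`: the functions `N_f` and `N_g` of the growth assumptions. -/
noncomputable def increment (f : ℝ → ℝ) (r z : H D) (x : E d) : ℝ :=
  f (r x + z x) - f (r x)

theorem increment_ae_eq (f : ℝ → ℝ) {c r z : H D} (hz : z = c - r) :
    increment f r z =ᵐ[volume.restrict D.region] fun x => f (c x) - f (r x) := by
  filter_upwards [Lp.coeFn_sub c r] with x hx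
  rw [increment, hz, hx, Pi.sub_apply, add_sub_cancel]

theorem memLp_increment {f : ℝ → ℝ} {c r z : H D} (hz : z = c - r)
    (hc : MemLp (fun x => f (c x)) 2 (volume.restrict D.region))
    (hr : MemLp (fun x => f (r x)) 2 (volume.restrict D.region)) :
    MemLp (increment f r z) 2 (volume.restrict D.region) :=
  (hc.sub hr).ae_eq (increment_ae_eq f hz).symm

theorem integral_increment_mul {f : ℝ → ℝ} {c r z : H D} (hz : z = c - r)
    (hc : MemLp (fun x => f (c x)) 2 (volume.restrict D.region))
    (hr : MemLp (fun x => f (r x)) 2 (volume.restrict D.region)) (k : ℝ) (u : H D) :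
    ∫ x in D.region, increment f r z x * u x
      = (∫ x in D.region, (f (c x) - k) * u x) - ∫ x in D.region, (f (r x) - k) * u x := by
  have hcu : Integrable (fun x => (f (c x) - k) * u x) (volume.restrict D.region) :=
    (hc.sub (memLp_const k)).integrable_mul (Lp.memLp u)
  have hru : Integrable (fun x => (f (r x) - k) * u x) (volume.restrict D.region) :=
    (hr.sub (memLp_const k)).integrable_mul (Lp.memLp u)
  rw [← integral_sub hcu hru]
  refine integral_congr_ae ?_
  filter_upwards [increment_ae_eq f hz] with x hx
  rw [hx]
  ring

/-- The content of `IsSolution` at a single time: `Y₁ ∈ D(A)` and `Y₂ ∈ V` represent the state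
`(y₁, y₂)`, and the equations hold with `ξ₁` and `ξ₂` in place of the time derivatives. -/
structure EquationsAt (ν₁ ν₂ : ℝ) (f g : ℝ → ℝ) (h₁ : StrongDual ℝ (DA D bc))
    (h₂ : StrongDual ℝ (V D bc)) (q₁ q₂ y₁ y₂ : H D) (Y₁ : DA D bc) (Y₂ : V D bc)
    (ξ₁ : StrongDual ℝ (DA D bc)) (ξ₂ : StrongDual ℝ (V D bc)) : Prop where
  toH_eq₁ : DA.toH D bc Y₁ = y₁
  toH_eq₂ : V.toH D bc Y₂ = y₂
  memLp_f : MemLp (fun x => f (y₁ x)) 2 (volume.restrict D.region)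
  memLp_g : MemLp (fun x => g (y₁ x)) 2 (volume.restrict D.region)
  eq₁ : ∀ φ : DA D bc, ξ₁ φ + ν₂ * inner ℝ (DA.A₀ D bc Y₁) (DA.A₀ D bc φ)
      + (∫ x in D.region, (f (y₁ x) - f 0) * DA.A₀ D bc φ x) - ν₁ * inner ℝ y₂ (DA.A₀ D bc φ)
      + (∫ x in D.region, g (y₁ x) * DA.toH D bc φ x) = h₁ φ + inner ℝ q₁ (DA.toH D bc φ)
  eq₂ : ∀ ψ : V D bc, ξ₂ ψ + inner ℝ (V.grad D bc Y₂) (V.grad D bc ψ)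
      = h₂ ψ + inner ℝ q₂ (V.toH D bc ψ)

/-- The equations, at a single time, of the difference of two solutions with the same forcing: `r`
is the first component of the second solution, `(q₁, q₂)` the difference of the inputs, and `Z` and
`W` represent `z₁` and `z₂ + ν₀ z₁`, where `(z₁, z₂)` is the difference of the states. -/
structure ErrorEquationsAt (ν₀ ν₁ ν₂ : ℝ) (f g : ℝ → ℝ) (r q₁ q₂ : H D) (Z : DA D bc)
    (W : V D bc) (ξ₁ : StrongDual ℝ (DA D bc)) (ξ₂ : StrongDual ℝ (V D bc)) : Prop where
  memLp_f : MemLp (increment f r (DA.toH D bc Z)) 2 (volume.restrict D.region)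
  memLp_g : MemLp (increment g r (DA.toH D bc Z)) 2 (volume.restrict D.region)
  eq₁ : ∀ φ : DA D bc, ξ₁ φ + ν₂ * inner ℝ (DA.A₀ D bc Z) (DA.A₀ D bc φ)
      + (∫ x in D.region, increment f r (DA.toH D bc Z) x * DA.A₀ D bc φ x)
      - ν₁ * inner ℝ (V.toH D bc (W - ν₀ • DA.toV D bc Z)) (DA.A₀ D bc φ)
      + (∫ x in D.region, increment g r (DA.toH D bc Z) x * DA.toH D bc φ x)
      = inner ℝ q₁ (DA.toH D bc φ)
  eq₂ : ∀ ψ : V D bc,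
    ξ₂ ψ + inner ℝ (V.grad D bc (W - ν₀ • DA.toV D bc Z)) (V.grad D bc ψ)
      = inner ℝ q₂ (V.toH D bc ψ)

theorem EquationsAt.sub {ν₁ ν₂ : ℝ} {f g : ℝ → ℝ} {h₁ ξ₁ χ₁ : StrongDual ℝ (DA D bc)}
    {h₂ ξ₂ χ₂ : StrongDual ℝ (V D bc)} {q₁ q₂ c₁ c₂ p₁ p₂ r₁ r₂ : H D} {C₁ R₁ : DA D bc}
    {C₂ R₂ : V D bc} (hc : EquationsAt ν₁ ν₂ f g h₁ h₂ q₁ q₂ c₁ c₂ C₁ C₂ ξ₁ ξ₂)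
    (hr : EquationsAt ν₁ ν₂ f g h₁ h₂ p₁ p₂ r₁ r₂ R₁ R₂ χ₁ χ₂) (ν₀ : ℝ) :
    ErrorEquationsAt ν₀ ν₁ ν₂ f g r₁ (q₁ - p₁) (q₂ - p₂) (C₁ - R₁)
      (C₂ - R₂ + ν₀ • DA.toV D bc (C₁ - R₁)) (ξ₁ - χ₁) (ξ₂ - χ₂) := by
  have hz : DA.toH D bc (C₁ - R₁) = c₁ - r₁ := by rw [map_sub, hc.toH_eq₁, hr.toH_eq₁]
  refine ⟨memLp_increment hz hc.memLp_f hr.memLp_f, memLp_increment hz hc.memLp_g hr.memLp_g,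
    fun φ => ?_, fun ψ => ?_⟩
  · have hintg := integral_increment_mul hz hc.memLp_g hr.memLp_g 0 (DA.toH D bc φ)
    simp only [sub_zero] at hintg
    rw [hintg, integral_increment_mul hz hc.memLp_f hr.memLp_f (f 0), add_sub_cancel_right,
      map_sub (V.toH D bc), hc.toH_eq₂, hr.toH_eq₂, map_sub (DA.A₀ D bc), sub_apply, inner_sub_left,
      inner_sub_left, inner_sub_left]
    linarith [hc.eq₁ φ, hr.eq₁ φ]
  · rw [add_sub_cancel_right, map_sub (V.grad D bc), sub_apply, inner_sub_left, inner_sub_left]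
    linarith [hc.eq₂ ψ, hr.eq₂ ψ]

theorem IsSolution.exists_errorEquationsAt {ν₀ ν₁ ν₂ : ℝ} {f g : ℝ → ℝ}
    {h₁ : ℝ → StrongDual ℝ (DA D bc)} {h₂ : ℝ → StrongDual ℝ (V D bc)}
    {q₁ q₂ c₁ c₂ p₁ p₂ r₁ r₂ : ℝ → H D}
    (hc : IsSolution D bc ν₀ ν₁ ν₂ f g h₁ h₂ q₁ q₂ c₁ c₂)
    (hr : IsSolution D bc ν₀ ν₁ ν₂ f g h₁ h₂ p₁ p₂ r₁ r₂) :
    ∃ (Z : ℝ → DA D bc) (W : ℝ → V D bc) (ξ₁ : ℝ → StrongDual ℝ (DA D bc))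
      (ξ₂ : ℝ → StrongDual ℝ (V D bc)), L2Loc Z ∧ L2Loc W ∧ L2Loc ξ₁ ∧ L2Loc ξ₂ ∧
      IsTimeDeriv (DA.toH D bc) (fun t => c₁ t - r₁ t) ξ₁ ∧
      IsTimeDeriv (V.toH D bc) (fun t => c₂ t - r₂ t + ν₀ • (c₁ t - r₁ t)) ξ₂ ∧
      ∀ᵐ t ∂volume.restrict (Ioi (0 : ℝ)), DA.toH D bc (Z t) = c₁ t - r₁ t ∧
        V.toH D bc (W t) = c₂ t - r₂ t + ν₀ • (c₁ t - r₁ t) ∧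
        ErrorEquationsAt ν₀ ν₁ ν₂ f g (r₁ t) (q₁ t - p₁ t) (q₂ t - p₂ t) (Z t) (W t) (ξ₁ t)
          (ξ₂ t) := by
  obtain ⟨R₁, R₂, χ₁, χ₂, hR₁, hR₂, hχ₁, hχ₂, hrχ₁, hrχ₂, hr⟩ := hr.exists_weak
  obtain ⟨C₁, C₂, ξ₁, ξ₂, hC₁, hC₂, hξ₁, hξ₂, hcξ₁, hcξ₂, hc⟩ := hc.exists_weak
  refine ⟨fun t => C₁ t - R₁ t, fun t => C₂ t - R₂ t + ν₀ • DA.toV D bc (C₁ t - R₁ t),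
    fun t => ξ₁ t - χ₁ t, fun t => ξ₂ t - χ₂ t, hC₁.sub hR₁,
    (hC₂.sub hR₂).add ((hC₁.sub hR₁).clm_comp (ν₀ • DA.toV D bc)), hξ₁.sub hχ₁, hξ₂.sub hχ₂,
    hcξ₁.sub hrχ₁ hξ₁ hχ₁, ?_, ?_⟩
  · convert hcξ₂.sub hrχ₂ hξ₂ hχ₂ using 2 with t
    module
  · filter_upwards [hc, hr] with t hct hrt
    obtain ⟨hC₁, hC₂, hcf, hcg, hc₁, hc₂⟩ := hct
    obtain ⟨hR₁, hR₂, hrf, hrg, hr₁, hr₂⟩ := hrt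
    have hct : EquationsAt ν₁ ν₂ f g (h₁ t) (h₂ t) (q₁ t) (q₂ t) (c₁ t) (c₂ t) (C₁ t) (C₂ t) (ξ₁ t)
        (ξ₂ t) := ⟨hC₁, hC₂, hcf, hcg, hc₁, hc₂⟩
    have hrt : EquationsAt ν₁ ν₂ f g (h₁ t) (h₂ t) (p₁ t) (p₂ t) (r₁ t) (r₂ t) (R₁ t) (R₂ t) (χ₁ t)
        (χ₂ t) := ⟨hR₁, hR₂, hrf, hrg, hr₁, hr₂⟩
    have hZ : DA.toH D bc (C₁ t - R₁ t) = c₁ t - r₁ t := by rw [map_sub, hC₁, hR₁]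
    refine ⟨hZ, ?_, hct.sub hrt ν₀⟩
    rw [map_add, map_smul, DA.toH_toV, hZ, map_sub, hC₂, hR₂]

end ErrorEquation

section Stabilization

variable {d : ℕ} {D : Domain d} {bc : BoundaryCondition}

theorem normHH_sq (u v : H D) : normHH u v ^ 2 = ‖u‖ ^ 2 + ‖v‖ ^ 2 :=
  Real.sq_sqrt (by positivity)

theorem normHH_sq_add_smul_le (ν : ℝ) (u v : H D) :
    normHH u (v + ν • u) ^ 2 ≤ 2 * (1 + ν ^ 2) * normHH u v ^ 2 := by
  rw [normHH_sq, normHH_sq]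
  have hsum : ‖v + ν • u‖ ^ 2 ≤ 2 * ‖v‖ ^ 2 + 2 * (ν ^ 2 * ‖u‖ ^ 2) := by
    simpa [norm_smul, mul_pow] using norm_add_sq_le_two_mul v (ν • u)
  nlinarith [sq_nonneg ‖u‖, mul_nonneg (sq_nonneg ν) (sq_nonneg ‖v‖)]

theorem normHH_sq_le_of_add_smul_le {u v u' v' : H D} {ν κ : ℝ} (hκ : 0 ≤ κ)
    (h : normHH u' (v' + ν • u') ^ 2 ≤ κ * normHH u (v + ν • u) ^ 2) :
    normHH u' v' ^ 2 ≤ 4 * (1 + ν ^ 2) ^ 2 * κ * normHH u v ^ 2 := by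
  calc normHH u' v' ^ 2 ≤ 2 * (1 + ν ^ 2) * normHH u' (v' + ν • u') ^ 2 := by
        simpa using normHH_sq_add_smul_le (-ν) u' (v' + ν • u')
    _ ≤ 2 * (1 + ν ^ 2) * (κ * (2 * (1 + ν ^ 2) * normHH u v ^ 2)) := by
        gcongr
        exact h.trans (by gcongr; exact normHH_sq_add_smul_le ν u v)
    _ = 4 * (1 + ν ^ 2) ^ 2 * κ * normHH u v ^ 2 := by ring

theorem ErrorEquationsAt.energy_eq {ν₀ ν₁ ν₂ : ℝ} {f g : ℝ → ℝ} {r q₁ q₂ : H D} {Z : DA D bc}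
    {W : V D bc} {ξ₁ : StrongDual ℝ (DA D bc)} {ξ₂ : StrongDual ℝ (V D bc)}
    (h : ErrorEquationsAt ν₀ ν₁ ν₂ f g r q₁ q₂ Z W ξ₁ ξ₂) :
    ξ₁ Z + ξ₂ W + ν₂ * ‖DA.A₀ D bc Z‖ ^ 2 + ‖V.grad D bc W‖ ^ 2
      + (∫ x in D.region, increment f r (DA.toH D bc Z) x * DA.A₀ D bc Z x)
      + (∫ x in D.region, increment g r (DA.toH D bc Z) x * DA.toH D bc Z x)
      = (ν₀ + ν₁) * inner ℝ (V.grad D bc (DA.toV D bc Z)) (V.grad D bc W)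
        - ν₀ * ν₁ * ‖V.grad D bc (DA.toV D bc Z)‖ ^ 2
        + inner ℝ q₁ (DA.toH D bc Z) + inner ℝ q₂ (V.toH D bc W) := by
  have h₁ := h.eq₁ Z
  have h₂ := h.eq₂ W
  rw [DA.inner_A₀, map_sub, map_smul, inner_sub_right, inner_smul_right, real_inner_self_eq_norm_sq,
    real_inner_self_eq_norm_sq] at h₁
  rw [map_sub, map_smul, inner_sub_left, real_inner_smul_left, real_inner_self_eq_norm_sq] at h₂
  linarith

/-- A multiple of `‖y₁‖²` large enough to absorb the coupling terms of the energy balance and the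
difference between `A` and `A₀`. -/
noncomputable def gardingConst (ν₀ ν₁ ν₂ : ℝ) : ℝ :=
  ν₂ + 3 * ((ν₀ + ν₁) ^ 2 / 2 + |ν₀ * ν₁|) ^ 2 / ν₂

theorem gardingConst_nonneg (ν₀ ν₁ : ℝ) {ν₂ : ℝ} (hν₂ : 0 ≤ ν₂) : 0 ≤ gardingConst ν₀ ν₁ ν₂ := by
  unfold gardingConst
  positivity

theorem mul_inner_sub_mul_norm_sq_le {F : Type*} [NormedAddCommGroup F] [InnerProductSpace ℝ F]
    (a b : ℝ) (u v : F) :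
    a * inner ℝ u v - b * ‖u‖ ^ 2 ≤ 1 / 2 * ‖v‖ ^ 2 + (a ^ 2 / 2 + |b|) * ‖u‖ ^ 2 := by
  have hsq : 0 ≤ ‖v - a • u‖ ^ 2 := sq_nonneg _
  rw [norm_sub_sq_real, inner_smul_right, real_inner_comm, norm_smul, mul_pow, Real.norm_eq_abs,
    sq_abs] at hsq
  have hb : -b * ‖u‖ ^ 2 ≤ |b| * ‖u‖ ^ 2 := by
    gcongr
    exact neg_le_abs b
  linarith

theorem mul_mul_le_div_add {β ν x y : ℝ} (hν : 0 < ν) :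
    β * (x * y) ≤ ν / 12 * x ^ 2 + 3 * β ^ 2 / ν * y ^ 2 := by
  have hsq : ν / 12 * x ^ 2 + 3 * β ^ 2 / ν * y ^ 2 - β * (x * y)
      = (ν * x - 6 * β * y) ^ 2 / (12 * ν) := by
    field_simp
    ring
  have : 0 ≤ (ν * x - 6 * β * y) ^ 2 / (12 * ν) := by positivity
  linarith

theorem coupling_le (ν₀ ν₁ : ℝ) {ν₂ : ℝ} (hν₂ : 0 < ν₂) (Z : DA D bc) (W : V D bc) :
    (ν₀ + ν₁) * inner ℝ (V.grad D bc (DA.toV D bc Z)) (V.grad D bc W)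
        - ν₀ * ν₁ * ‖V.grad D bc (DA.toV D bc Z)‖ ^ 2
      ≤ 1 / 2 * ‖V.grad D bc W‖ ^ 2 + ν₂ / 12 * ‖DA.A D bc Z‖ ^ 2
        + (gardingConst ν₀ ν₁ ν₂ - ν₂) * ‖DA.toH D bc Z‖ ^ 2 := by
  have hgrad : ((ν₀ + ν₁) ^ 2 / 2 + |ν₀ * ν₁|) * ‖V.grad D bc (DA.toV D bc Z)‖ ^ 2
      ≤ ((ν₀ + ν₁) ^ 2 / 2 + |ν₀ * ν₁|) * (‖DA.A D bc Z‖ * ‖DA.toH D bc Z‖) := by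
    gcongr
    exact DA.norm_grad_toV_sq_le Z
  rw [gardingConst, add_sub_cancel_left]
  linarith [mul_inner_sub_mul_norm_sq_le (ν₀ + ν₁) (ν₀ * ν₁) (V.grad D bc (DA.toV D bc Z))
    (V.grad D bc W), mul_mul_le_div_add (β := (ν₀ + ν₁) ^ 2 / 2 + |ν₀ * ν₁|) (x := ‖DA.A D bc Z‖)
    (y := ‖DA.toH D bc Z‖) hν₂]

theorem ErrorEquationsAt.energy_le {ν₀ ν₁ ν₂ K : ℝ} {f g : ℝ → ℝ} {r q₁ q₂ : H D} {Z : DA D bc}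
    {W : V D bc} {ξ₁ : StrongDual ℝ (DA D bc)} {ξ₂ : StrongDual ℝ (V D bc)}
    (h : ErrorEquationsAt ν₀ ν₁ ν₂ f g r q₁ q₂ Z W ξ₁ ξ₂) (hν₂ : 0 < ν₂)
    (hfg : -(∫ x in D.region, increment f r (DA.toH D bc Z) x * DA.A₀ D bc Z x)
        - (∫ x in D.region, increment g r (DA.toH D bc Z) x * DA.toH D bc Z x)
      ≤ ν₂ / 6 * ‖DA.A D bc Z‖ ^ 2 + K * ‖DA.toH D bc Z‖ ^ 2) :
    ξ₁ Z + ξ₂ W ≤ inner ℝ q₁ (DA.toH D bc Z) + inner ℝ q₂ (V.toH D bc W)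
      + (K + gardingConst ν₀ ν₁ ν₂) * ‖DA.toH D bc Z‖ ^ 2
      - ν₂ / 4 * ‖DA.A D bc Z‖ ^ 2 - 1 / 2 * ‖V.grad D bc W‖ ^ 2 := by
  have hA : ν₂ * ‖DA.A D bc Z‖ ^ 2 ≤ ν₂ * (2 * ‖DA.A₀ D bc Z‖ ^ 2 + 2 * ‖DA.toH D bc Z‖ ^ 2) := by
    gcongr
    exact DA.norm_A_sq_le Z
  linarith [h.energy_eq, coupling_le ν₀ ν₁ hν₂ Z W]

theorem ErrorEquationsAt.energy_le_neg_mul {ν₀ ν₁ ν₂ K μ : ℝ} {f g : ℝ → ℝ} {r q₁ q₂ : H D}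
    {Z : DA D bc} {W : V D bc} {ξ₁ : StrongDual ℝ (DA D bc)} {ξ₂ : StrongDual ℝ (V D bc)}
    (h : ErrorEquationsAt ν₀ ν₁ ν₂ f g r q₁ q₂ Z W ξ₁ ξ₂) (hν₂ : 0 < ν₂)
    (hfg : -(∫ x in D.region, increment f r (DA.toH D bc Z) x * DA.A₀ D bc Z x)
        - (∫ x in D.region, increment g r (DA.toH D bc Z) x * DA.toH D bc Z x)
      ≤ ν₂ / 6 * ‖DA.A D bc Z‖ ^ 2 + K * ‖DA.toH D bc Z‖ ^ 2)
    (hq₁ : inner ℝ q₁ (DA.toH D bc Z) + (K + gardingConst ν₀ ν₁ ν₂ + μ) * ‖DA.toH D bc Z‖ ^ 2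
      ≤ ν₂ / 4 * ‖DA.A D bc Z‖ ^ 2)
    (hq₂ : inner ℝ q₂ (V.toH D bc W) + μ * ‖V.toH D bc W‖ ^ 2 ≤ 1 / 2 * ‖V.grad D bc W‖ ^ 2) :
    ξ₁ Z + ξ₂ W ≤ -μ * normHH (DA.toH D bc Z) (V.toH D bc W) ^ 2 := by
  rw [normHH_sq]
  linarith [h.energy_le hν₂ hfg]

/-- For states at distance at most `ρ` in `H` from `r(t)`, the nonlinear terms of the energy balance
are at most `ε ‖z‖²_{D(A)} + K ‖z‖²_H`. -/
def NonlinearityBound (bc : BoundaryCondition) (f g : ℝ → ℝ) (r : ℝ → H D) (ρ ε K : ℝ) : Prop :=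
  ∀ᵐ t ∂volume.restrict (Ioi (0 : ℝ)), ∀ z : DA D bc, ‖DA.toH D bc z‖ ≤ ρ →
    MemLp (increment f (r t) (DA.toH D bc z)) 2 (volume.restrict D.region) →
    MemLp (increment g (r t) (DA.toH D bc z)) 2 (volume.restrict D.region) →
    -(∫ x in D.region, increment f (r t) (DA.toH D bc z) x * DA.A₀ D bc z x)
        - (∫ x in D.region, increment g (r t) (DA.toH D bc z) x * DA.toH D bc z x)
      ≤ ε * ‖DA.A D bc z‖ ^ 2 + K * ‖DA.toH D bc z‖ ^ 2

theorem exists_nonlinearityBound {n : ℕ} {Cf Cg ρ ε : ℝ} {ζf ηf ζg ηg : Fin n → ℝ}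
    (hf : ∀ i, 0 ≤ ηf i ∧ ηf i < 2 ∧ 2 ≤ ζf i + ηf i)
    (hg : ∀ i, 0 ≤ ηg i ∧ ηg i < 2 ∧ 2 ≤ ζg i + ηg i) (hCf : 0 ≤ Cf) (hCg : 0 ≤ Cg) (hρ : 0 ≤ ρ)
    (hε : 0 < ε) :
    ∃ K, 0 ≤ K ∧ ∀ (f g : ℝ → ℝ) (r : ℝ → H D), GrowthF D bc f r Cf ζf ηf →
      GrowthG D bc g r Cg ζg ηg → NonlinearityBound bc f g r ρ ε K := by
  obtain ⟨Kf, hKf, hf⟩ := exists_mul_sum_rpow_mul_rpow_le hf hCf hρ (half_pos hε)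
  obtain ⟨Kg, hKg, hg⟩ := exists_mul_sum_rpow_mul_rpow_le hg hCg hρ (half_pos hε)
  refine ⟨Kf + Kg, add_nonneg hKf hKg, fun f g r hGf hGg => ?_⟩
  filter_upwards [hGf, hGg] with t hGf hGg z hz hfz hgz
  have hfz := (hGf z hfz).trans (hf _ _ (norm_nonneg _) hz (norm_nonneg _))
  have hgz := (hGg z hgz).trans (hg _ _ (norm_nonneg _) hz (norm_nonneg _))
  simp only [increment]
  linarith

theorem normHH_sq_sub_normHH_sq_le_integral {z w : ℝ → H D} {Z : ℝ → DA D bc} {W : ℝ → V D bc}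
    {ξ₁ : ℝ → StrongDual ℝ (DA D bc)} {ξ₂ : ℝ → StrongDual ℝ (V D bc)}
    (hz : ContinuousOn z (Ici 0)) (hw : ContinuousOn w (Ici 0)) (hZ : L2Loc Z) (hW : L2Loc W)
    (hξ₁ : L2Loc ξ₁) (hξ₂ : L2Loc ξ₂) (hzξ : IsTimeDeriv (DA.toH D bc) z ξ₁)
    (hwξ : IsTimeDeriv (V.toH D bc) w ξ₂)
    (hZz : ∀ᵐ t ∂volume.restrict (Ioi (0 : ℝ)), DA.toH D bc (Z t) = z t)
    (hWw : ∀ᵐ t ∂volume.restrict (Ioi (0 : ℝ)), V.toH D bc (W t) = w t) {s t : ℝ} (hs : 0 ≤ s)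
    (hst : s ≤ t) :
    normHH (z t) (w t) ^ 2 - normHH (z s) (w s) ^ 2
      ≤ ∫ τ in s..t, 2 * (ξ₁ τ (Z τ) + ξ₂ τ (W τ)) := by
  rw [normHH_sq, normHH_sq, intervalIntegral.integral_const_mul, intervalIntegral.integral_add
    (hξ₁.intervalIntegrable_apply hZ hs hst) (hξ₂.intervalIntegrable_apply hW hs hst)]
  linarith [norm_sq_sub_norm_sq_le_integral hz hZ hξ₁ hzξ hZz hs hst,
    norm_sq_sub_norm_sq_le_integral hw hW hξ₂ hwξ hWw hs hst]

theorem IsSolution.normHH_sub_sq_le_exp {ν₀ ν₁ ν₂ K μ R : ℝ} {f g : ℝ → ℝ}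
    {h₁ : ℝ → StrongDual ℝ (DA D bc)} {h₂ : ℝ → StrongDual ℝ (V D bc)} {F₁ F₂ : H D → H D}
    {r₁ r₂ c₁ c₂ : ℝ → H D}
    (hc : IsSolution D bc ν₀ ν₁ ν₂ f g h₁ h₂ (fun t => F₁ (c₁ t - r₁ t))
      (fun t => F₂ (c₂ t - r₂ t + ν₀ • (c₁ t - r₁ t))) c₁ c₂)
    (hr : IsSolution D bc ν₀ ν₁ ν₂ f g h₁ h₂ (fun _ => 0) (fun _ => 0) r₁ r₂)
    (hμ : 0 ≤ μ) (hν₂ : 0 < ν₂) (hR : 0 ≤ R)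
    (hfg : NonlinearityBound bc f g r₁ (R + 1) (ν₂ / 6) K)
    (hF₁ : ∀ z : DA D bc, inner ℝ (F₁ (DA.toH D bc z)) (DA.toH D bc z)
      + (K + gardingConst ν₀ ν₁ ν₂ + μ) * ‖DA.toH D bc z‖ ^ 2 ≤ ν₂ / 4 * ‖DA.A D bc z‖ ^ 2)
    (hF₂ : ∀ v : V D bc, inner ℝ (F₂ (V.toH D bc v)) (V.toH D bc v) + μ * ‖V.toH D bc v‖ ^ 2
      ≤ 1 / 2 * ‖V.grad D bc v‖ ^ 2)
    (h0 : normHH (c₁ 0 - r₁ 0) (c₂ 0 - r₂ 0 + ν₀ • (c₁ 0 - r₁ 0)) ≤ R) {s t : ℝ} (hs : 0 ≤ s)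
    (hst : s ≤ t) :
    normHH (c₁ t - r₁ t) (c₂ t - r₂ t + ν₀ • (c₁ t - r₁ t)) ^ 2
      ≤ Real.exp (-(2 * μ) * (t - s))
        * normHH (c₁ s - r₁ s) (c₂ s - r₂ s + ν₀ • (c₁ s - r₁ s)) ^ 2 := by
  obtain ⟨Z, W, ξ₁, ξ₂, hZ, hW, hξ₁, hξ₂, hzξ, hwξ, herr⟩ := hc.exists_errorEquationsAt hr
  have hz : ContinuousOn (fun t => c₁ t - r₁ t) (Ici 0) := hc.continuousOn₁.sub hr.continuousOn₁
  have hw : ContinuousOn (fun t => c₂ t - r₂ t + ν₀ • (c₁ t - r₁ t)) (Ici 0) :=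
    (hc.continuousOn₂.sub hr.continuousOn₂).add (hz.const_smul ν₀)
  refine exponential_decay_of_decay_below (ρ := R ^ 2 + 1)
    (E := fun t => normHH (c₁ t - r₁ t) (c₂ t - r₂ t + ν₀ • (c₁ t - r₁ t)) ^ 2)
    (b := fun t => 2 * (ξ₁ t (Z t) + ξ₂ t (W t))) (by positivity) ?_ (fun t _ => sq_nonneg _)
    ((pow_le_pow_left₀ (Real.sqrt_nonneg _) h0 2).trans_lt (lt_add_one _))
    (fun s t hs hst => ((hξ₁.intervalIntegrable_apply hZ hs hst).add
      (hξ₂.intervalIntegrable_apply hW hs hst)).const_mul 2)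
    (fun s t hs hst => normHH_sq_sub_normHH_sq_le_integral hz hw hZ hW hξ₁ hξ₂ hzξ hwξ
      (herr.mono fun t ht => ht.1) (herr.mono fun t ht => ht.2.1) hs hst) ?_ hs hst
  · simp only [normHH_sq]
    exact (hz.norm.pow 2).add (hw.norm.pow 2)
  · filter_upwards [herr, hfg] with τ ⟨hZτ, hWτ, hτ⟩ hfgτ hEτ
    have hball : ‖DA.toH D bc (Z τ)‖ ≤ R + 1 := by
      rw [normHH_sq, ← hZτ] at hEτ
      refine le_of_sq_le_sq ?_ (by positivity)
      nlinarith [sq_nonneg ‖c₂ τ - r₂ τ + ν₀ • DA.toH D bc (Z τ)‖]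
    rw [← hWτ, ← hZτ, sub_zero, sub_zero] at hτ
    have hdecay := hτ.energy_le_neg_mul hν₂ (hfgτ _ hball hτ.memLp_f hτ.memLp_g) (hF₁ _) (hF₂ _)
    rw [← hWτ, ← hZτ]
    linarith

end Stabilization

end CahnHilliard

open CahnHilliard in
theorem corollary3p3 {d : ℕ} (D : CahnHilliard.Domain d) (bc : CahnHilliard.BoundaryCondition)
    (hD : D.Admissible bc) (a : CahnHilliard.ActuatorData D) (μ : ℝ) (hμ : 0 < μ) :
    ∃ lam₂bar : ℝ, 0 ≤ lam₂bar ∧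
    ∀ (R : ℝ), 0 < R → ∀ (ν₀ ν₁ ν₂ : ℝ), 0 < ν₂ →
    ∀ (n : ℕ), 0 < n → ∀ (Cf Cg : ℝ), 0 ≤ Cf → 0 ≤ Cg →
    ∀ (ζf ηf ζg ηg : Fin n → ℝ),
    (∀ i, 0 ≤ ζf i ∧ 0 ≤ ηf i ∧ ηf i < 2 ∧ 2 ≤ ζf i + ηf i) →
    (∀ i, 0 ≤ ζg i ∧ 0 ≤ ηg i ∧ ηg i < 2 ∧ 2 ≤ ζg i + ηg i) →
    ∃ Mbar : ℕ, 0 < Mbar ∧ ∃ lam₁bar : ℝ, 0 ≤ lam₁bar ∧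
    ∀ (f g : ℝ → ℝ)
      (h₁ : ℝ → StrongDual ℝ (CahnHilliard.DA D bc)) (h₂ : ℝ → StrongDual ℝ (CahnHilliard.V D bc))
      (yr₁ yr₂ : ℝ → CahnHilliard.H D),
    CahnHilliard.IsTrajectory D bc ν₀ ν₁ ν₂ f g h₁ h₂ yr₁ yr₂ →
    CahnHilliard.GrowthF D bc f yr₁ Cf ζf ηf →
    CahnHilliard.GrowthG D bc g yr₁ Cg ζg ηg →
    ∀ (M : ℕ) (lam₁ lam₂ : ℝ), Mbar ≤ M → lam₁bar ≤ lam₁ → lam₂bar ≤ lam₂ →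
    ∀ (yc₁ yc₂ : ℝ → CahnHilliard.H D),
    CahnHilliard.IsControlledTrajectory D bc a M lam₁ lam₂ ν₀ ν₁ ν₂ f g h₁ h₂ yr₁ yr₂ yc₁ yc₂ →
    CahnHilliard.normHH (yc₁ 0 - yr₁ 0) ((yc₂ 0 - yr₂ 0) + ν₀ • (yc₁ 0 - yr₁ 0)) ≤ R →
    ∀ s t : ℝ, 0 ≤ s → s ≤ t →
      CahnHilliard.normHH (yc₁ t - yr₁ t) (yc₂ t - yr₂ t) ^ 2
        ≤ 4 * (1 + ν₀ ^ 2) ^ 2 * Real.exp (-2 * μ * (t - s))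
          * CahnHilliard.normHH (yc₁ s - yr₁ s) (yc₂ s - yr₂ s) ^ 2 := by
  refine ⟨2 * μ + 1 / 2, by positivity, ?_⟩
  intro R hR ν₀ ν₁ ν₂ hν₂ n _ Cf Cg hCf hCg ζf ηf ζg ηg hf hg
  obtain ⟨K, hK, hbound⟩ := exists_nonlinearityBound (D := D) (bc := bc) (fun i => (hf i).2)
    (fun i => (hg i).2) hCf hCg (show 0 ≤ R + 1 by positivity) (show 0 < ν₂ / 6 by positivity)
  have hΛ : 0 ≤ K + gardingConst ν₀ ν₁ ν₂ + μ :=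
    add_nonneg (add_nonneg hK (gardingConst_nonneg ν₀ ν₁ hν₂.le)) hμ.le
  obtain ⟨M₀, hM₀⟩ := Filter.eventually_atTop.1
    ((a.eventually_inner_actuate_K₁_add_le hD hΛ (show 0 < ν₂ / 4 by positivity)).and
      (a.eventually_inner_actuate_K₂_add_le (bc := bc) hD hμ.le one_half_pos))
  refine ⟨M₀ + 1, M₀.succ_pos, 2 * (K + gardingConst ν₀ ν₁ ν₂ + μ) + ν₂ / 4, by positivity, ?_⟩
  intro f g h₁ h₂ yr₁ yr₂ hr hGf hGg M lam₁ lam₂ hM hlam₁ hlam₂ yc₁ yc₂ hc h0 s t hs hst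
  obtain ⟨hK₁, hK₂⟩ := hM₀ M (M₀.le_succ.trans hM)
  rw [neg_mul]
  exact normHH_sq_le_of_add_smul_le (Real.exp_pos _).le
    (IsSolution.normHH_sub_sq_le_exp (F₁ := fun z => actuate (a.Phi M) (K₁ bc a M lam₁ z))
      (F₂ := fun w => actuate (a.Psi M) (K₂ bc a M lam₂ w)) hc hr hμ.le hν₂ hR.le
      (hbound f g yr₁ hGf hGg) (hK₁ lam₁ hlam₁) (hK₂ lam₂ hlam₂) h0 hs hst)
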